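/- Let $\Bbbk$ be a commutative ring and $k\in\mathbb{Z}$. Composition $a\circ b$ means $a$ after $b$. **The category $\mathcal{H}eis_k$.** It is the strict $\Bbbk$-linear monoidal category generated by objects $\uparrow,\downarrow$ and morphisms $x:\uparrow\to\uparrow$, $s:\uparrow\otimes\uparrow\to\uparrow\otimes\uparrow$, $c:\mathbb{1}\to\downarrow\otimes\uparrow$, $d:\uparrow\otimes\downarrow\to\mathbb{1}$, subject to * (hecke) $s\circ s=1$, $\;(s\otimes 1_\uparrow)(1_\uparrow\otimes s)(s\otimes 1_\uparrow)=(1_\uparrow\otimes s)(s\otimes 1_\uparrow)(1_\uparrow\otimes s)$, $\;(x\otimes 1_\uparrow)\circ s-s\circ(1_\uparrow\otimes x)=1_{\uparrow\otimes\uparrow}$; * (rightadj) $(d\otimes 1_\uparrow)\circ(1_\uparrow\otimes c)=1_\uparrow$, $\;(1_\downarrow\otimes d)\circ(c\otimes 1_\downarrow)=1_\downarrow$; * (inversion) with $t:=(1_{\downarrow\otimes\uparrow}\otimes d)\circ(1_\downarrow\otimes s\otimes 1_\downarrow)\circ(c\otimes 1_{\uparrow\otimes\downarrow}):\uparrow\otimes\downarrow\to\downarrow\otimes\uparrow$,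 the following matrix of morphisms is an isomorphism in the additive envelope (that is, one adjoins the entries of a two-sided inverse as further generators): for $k\ge 0$, the column with entries $t,\ d,\ d\circ(x\otimes 1_\downarrow),\dots,d\circ(x^{k-1}\otimes 1_\downarrow)$, from $\uparrow\otimes\downarrow$ to $(\downarrow\otimes\uparrow)\oplus\mathbb{1}^{\oplus k}$; for $k<0$, the row with entries $t,\ c,\ (1_\downarrow\otimes x)\circ c,\dots,(1_\downarrow\otimes x^{-k-1})\circ c$, from $(\uparrow\otimes\downarrow)\oplus\mathbb{1}^{\oplus(-k)}$ to $\downarrow\otimes\uparrow$. **Notation.** Given morphisms $c':\mathbb{1}\to\uparrow\otimes\downarrow$ and $d':\downarrow\otimes\uparrow\to\mathbb{1}$, put $$t':=(d'\otimes 1_{\uparrow\otimes\downarrow})\circ(1_\downarrow\otimes s\otimes 1_\downarrow)\circ(1_{\downarrow\otimes\uparrow}\otimes c'):\downarrow\otimes\uparrow\to\uparrow\otimes\downarrow .$$ For $n\ge 0$ let $\circlearrowright_n:=d\circ(x^n\otimes 1_\downarrow)\circ c'$ and $\circlearrowleft_n:=d'\circ(1_\downarrow\otimes x^n)\circ c$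 (clockwise and anticlockwise bubbles, in the commutative ring $\operatorname{End}(\mathbb{1})$). For negative numbers of dots define $$\circlearrowleft_{r-k-1}:=\det\bigl(\circlearrowright_{i-j+k}\bigr)_{i,j=1,\dots,r}\quad(r\le k),\qquad \circlearrowright_{r+k-1}:=-\det\bigl(-\circlearrowleft_{i-j-k}\bigr)_{i,j=1,\dots,r}\quad(r\le -k),$$ where the determinants are $1$ if $r=0$ and $0$ if $r<0$. **Theorem.** (a) There are unique morphisms $c':\mathbb{1}\to\uparrow\otimes\downarrow$ and $d':\downarrow\otimes\uparrow\to\mathbb{1}$ in $\mathcal{H}eis_k$ such that the following relations hold: * (pos) $t'\circ t=1_{\uparrow\otimes\downarrow}+\sum_{r,s\ge 0}\bigl((x^r\otimes 1_\downarrow)\circ c'\circ d\circ(x^s\otimes 1_\downarrow)\bigr)\otimes\circlearrowleft_{-r-s-2}$; * (neg) $t\circ t'=1_{\downarrow\otimes\uparrow}+\sum_{r,s\ge 0}\circlearrowright_{-r-s-2}\otimes\bigl((1_\downarrow\otimes x^s)\circ c\circ d'\circ(1_\downarrow\otimes x^r)\bigr)$; * (rightcurl) $(1_\uparrow\otimes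 d)\circ(s\otimes 1_\downarrow)\circ(1_\uparrow\otimes c')=\delta_{k,0}1_\uparrow$ if $k\ge 0$, and $\circlearrowright_r=-\delta_{r,k-1}1_{\mathbb{1}}$ for $0\le r<k$; * (leftcurl) $(d'\otimes 1_\uparrow)\circ(1_\downarrow\otimes s)\circ(c\otimes 1_\uparrow)=\delta_{k,0}1_\uparrow$ if $k\le 0$, and $\circlearrowleft_r=\delta_{r,-k-1}1_{\mathbb{1}}$ for $0\le r<-k$. (The sums are finite, since $\circlearrowleft_{-r-s-2}=0$ unless $r+s<k$ and $\circlearrowright_{-r-s-2}=0$ unless $r+s<-k$.) For these $c',d'$ one has $t'\circ t=1_{\uparrow\otimes\downarrow}+\delta_{k,1}\,c'\circ d$ if $k\le 1$, and $t\circ t'=1_{\downarrow\otimes\uparrow}-\delta_{k,-1}\,c\circ d'$ if $k\ge -1$. (b) $\mathcal{H}eis_k$ is presented equivalently as the strict $\Bbbk$-linear monoidal category generated by the objects $\uparrow,\downarrow$ and the morphisms $x,s,c,d,c',d'$ subject only to (hecke), (rightadj), (pos), (neg), (rightcurl) and (leftcurl): there is an isomorphism of strict $\Bbbk$-linear monoidal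 categories from the category so presented to $\mathcal{H}eis_k$ that is the identity on objects and sends $x,s,c,d$ to $x,s,c,d$ and $c',d'$ to the morphisms of part (a). -/

import Mathlib

open CategoryTheory MonoidalCategory

universe u v w

/-! ## Strict `K`-linear monoidal categories given by generators and relations -/

/-- Generating data for a strict monoidal category whose monoid of objects is the free monoid on
`O`: a type of generating morphisms, each with a source and a target word. -/
structure MonSig (O : Type) where
  Gen : Type
  src : Gen → List O
  tgt : Gen → List O

namespace MonSig

/-- Formal expressions for morphisms between words: all expressions that can be built from the
generating morphisms with identities, composition, tensor product and `K`-linear combinations.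
`comp f g` is `f` followed by `g`. -/
inductive Term (K : Type u) {O : Type} (S : MonSig O) : List O → List O → Type u
  | gen (g : S.Gen) : Term K S (S.src g) (S.tgt g)
  | id (X : List O) : Term K S X X
  | comp {X Y Z : List O} (f : Term K S X Y) (g : Term K S Y Z) : Term K S X Z
  | tensor {X Y X' Y' : List O} (f : Term K S X Y) (g : Term K S X' Y') :
      Term K S (X ++ X') (Y ++ Y')
  | zero (X Y : List O) : Term K S X Y
  | add {X Y : List O} (f g : Term K S X Y) : Term K S X Y
  | smul {X Y : List O} (a : K) (f : Term K S X Y) : Term K S X Y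

/-- The identity of a word, transported along an equality of words. -/
def Term.eqTo (K : Type u) {O : Type} (S : MonSig O) {X Y : List O} (h : X = Y) : Term K S X Y :=
  h ▸ Term.id X

/-- The smallest congruence on formal expressions that contains `R` and forces the axioms of a
strict `K`-linear monoidal category. -/
inductive Rel {K : Type u} [CommRing K] {O : Type} {S : MonSig O}
    (R : ∀ ⦃X Y : List O⦄, Term K S X Y → Term K S X Y → Prop) :
    ∀ ⦃X Y : List O⦄, Term K S X Y → Term K S X Y → Prop
  -- the imposed relations
  | of {X Y} {f g : Term K S X Y} (h : R f g) : Rel R f g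
  -- equivalence relation
  | refl {X Y} (f : Term K S X Y) : Rel R f f
  | symm {X Y} {f g : Term K S X Y} (h : Rel R f g) : Rel R g f
  | trans {X Y} {f g h : Term K S X Y} (h₁ : Rel R f g) (h₂ : Rel R g h) : Rel R f h
  -- compatibility with the operations
  | comp {X Y Z} {f f' : Term K S X Y} {g g' : Term K S Y Z} (h₁ : Rel R f f')
      (h₂ : Rel R g g') : Rel R (f.comp g) (f'.comp g')
  | tensor {X Y X' Y'} {f f' : Term K S X Y} {g g' : Term K S X' Y'} (h₁ : Rel R f f')
      (h₂ : Rel R g g') : Rel R (f.tensor g) (f'.tensor g')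
  | add {X Y} {f f' g g' : Term K S X Y} (h₁ : Rel R f f') (h₂ : Rel R g g') :
      Rel R (f.add g) (f'.add g')
  | smul {X Y} (a : K) {f f' : Term K S X Y} (h : Rel R f f') : Rel R (f.smul a) (f'.smul a)
  -- category
  | id_comp {X Y} (f : Term K S X Y) : Rel R ((Term.id X).comp f) f
  | comp_id {X Y} (f : Term K S X Y) : Rel R (f.comp (Term.id Y)) f
  | comp_assoc {X Y Z W} (f : Term K S X Y) (g : Term K S Y Z) (h : Term K S Z W) :
      Rel R ((f.comp g).comp h) (f.comp (g.comp h))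
  -- morphism spaces are `K`-modules
  | add_assoc {X Y} (f g h : Term K S X Y) : Rel R ((f.add g).add h) (f.add (g.add h))
  | add_comm {X Y} (f g : Term K S X Y) : Rel R (f.add g) (g.add f)
  | zero_add {X Y} (f : Term K S X Y) : Rel R ((Term.zero X Y).add f) f
  | smul_add {X Y} (a : K) (f g : Term K S X Y) :
      Rel R ((f.add g).smul a) ((f.smul a).add (g.smul a))
  | add_smul {X Y} (a b : K) (f : Term K S X Y) :
      Rel R (f.smul (a + b)) ((f.smul a).add (f.smul b))
  | mul_smul {X Y} (a b : K) (f : Term K S X Y) : Rel R (f.smul (a * b)) ((f.smul b).smul a)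
  | one_smul {X Y} (f : Term K S X Y) : Rel R (f.smul 1) f
  | zero_smul {X Y} (f : Term K S X Y) : Rel R (f.smul 0) (Term.zero X Y)
  -- composition and tensor product are bilinear
  | add_comp {X Y Z} (f f' : Term K S X Y) (g : Term K S Y Z) :
      Rel R ((f.add f').comp g) ((f.comp g).add (f'.comp g))
  | comp_add {X Y Z} (f : Term K S X Y) (g g' : Term K S Y Z) :
      Rel R (f.comp (g.add g')) ((f.comp g).add (f.comp g'))
  | smul_comp {X Y Z} (a : K) (f : Term K S X Y) (g : Term K S Y Z) :
      Rel R ((f.smul a).comp g) ((f.comp g).smul a)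
  | comp_smul {X Y Z} (a : K) (f : Term K S X Y) (g : Term K S Y Z) :
      Rel R (f.comp (g.smul a)) ((f.comp g).smul a)
  | add_tensor {X Y X' Y'} (f f' : Term K S X Y) (g : Term K S X' Y') :
      Rel R ((f.add f').tensor g) ((f.tensor g).add (f'.tensor g))
  | tensor_add {X Y X' Y'} (f : Term K S X Y) (g g' : Term K S X' Y') :
      Rel R (f.tensor (g.add g')) ((f.tensor g).add (f.tensor g'))
  | smul_tensor {X Y X' Y'} (a : K) (f : Term K S X Y) (g : Term K S X' Y') :
      Rel R ((f.smul a).tensor g) ((f.tensor g).smul a)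
  | tensor_smul {X Y X' Y'} (a : K) (f : Term K S X Y) (g : Term K S X' Y') :
      Rel R (f.tensor (g.smul a)) ((f.tensor g).smul a)
  -- the tensor product is a bifunctor
  | id_tensor_id (X Y : List O) :
      Rel R ((Term.id X).tensor (Term.id Y)) (Term.id (X ++ Y))
  | interchange {X Y Z X' Y' Z'} (f : Term K S X Y) (g : Term K S Y Z) (f' : Term K S X' Y')
      (g' : Term K S Y' Z') :
      Rel R ((f.tensor f').comp (g.tensor g')) ((f.comp g).tensor (f'.comp g'))
  -- the tensor product is strictly associative and unital
  | tensor_assoc {X Y X' Y' X'' Y''} (f : Term K S X Y) (g : Term K S X' Y')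
      (h : Term K S X'' Y'') :
      Rel R (((f.tensor g).tensor h).comp (Term.eqTo K S (List.append_assoc Y Y' Y'')))
        ((Term.eqTo K S (List.append_assoc X X' X'')).comp (f.tensor (g.tensor h)))
  | unit_tensor {X Y} (f : Term K S X Y) : Rel R ((Term.id []).tensor f) f
  | tensor_unit {X Y} (f : Term K S X Y) :
      Rel R ((f.tensor (Term.id [])).comp (Term.eqTo K S (List.append_nil Y)))
        ((Term.eqTo K S (List.append_nil X)).comp f)

end MonSig

/-- The strict `K`-linear monoidal category generated by the objects `O` and the morphisms of `S`
subject to the relations `R`. Its objects are the words in `O`. -/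
structure Presented (K : Type u) [CommRing K] {O : Type} (S : MonSig O)
    (R : ∀ ⦃X Y : List O⦄, S.Term K X Y → S.Term K X Y → Prop) : Type where
  word : List O

namespace Presented

open MonSig

variable {K : Type u} [CommRing K] {O : Type} {S : MonSig O}
  {R : ∀ ⦃X Y : List O⦄, S.Term K X Y → S.Term K X Y → Prop}

/-- Morphisms between words: formal expressions modulo the congruence. -/
def Mor (R : ∀ ⦃X Y : List O⦄, S.Term K X Y → S.Term K X Y → Prop) (X Y : List O) : Type u :=
  Quot (@MonSig.Rel K _ O S R X Y)

/-- The morphism represented by a formal expression. -/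
def Mor.mk (R : ∀ ⦃X Y : List O⦄, S.Term K X Y → S.Term K X Y → Prop) {X Y : List O}
    (f : S.Term K X Y) : Mor R X Y :=
  Quot.mk _ f

def Mor.comp {X Y Z : List O} (f : Mor R X Y) (g : Mor R Y Z) : Mor R X Z :=
  Quot.map₂ Term.comp (fun _ _ _ h => Rel.comp (Rel.refl _) h)
    (fun _ _ _ h => Rel.comp h (Rel.refl _)) f g

def Mor.tensor {X Y X' Y' : List O} (f : Mor R X Y) (g : Mor R X' Y') :
    Mor R (X ++ X') (Y ++ Y') :=
  Quot.map₂ Term.tensor (fun _ _ _ h => Rel.tensor (Rel.refl _) h)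
    (fun _ _ _ h => Rel.tensor h (Rel.refl _)) f g

def Mor.add {X Y : List O} (f g : Mor R X Y) : Mor R X Y :=
  Quot.map₂ Term.add (fun _ _ _ h => Rel.add (Rel.refl _) h)
    (fun _ _ _ h => Rel.add h (Rel.refl _)) f g

def Mor.smul {X Y : List O} (a : K) (f : Mor R X Y) : Mor R X Y :=
  Quot.map (Term.smul a) (fun _ _ h => Rel.smul a h) f

theorem Mor.ind {X Y : List O} {P : Mor R X Y → Prop} (h : ∀ f, P (Mor.mk R f)) (f : Mor R X Y) :
    P f :=
  Quot.ind h f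

instance (X Y : List O) : Zero (Mor R X Y) := ⟨Mor.mk R (Term.zero X Y)⟩

instance (X Y : List O) : Add (Mor R X Y) := ⟨Mor.add⟩

instance (X Y : List O) : Neg (Mor R X Y) := ⟨Mor.smul (-1)⟩

instance (X Y : List O) : AddCommGroup (Mor R X Y) where
  nsmul := nsmulRec
  zsmul := zsmulRec
  add_assoc f g h := by
    induction f using Mor.ind; induction g using Mor.ind; induction h using Mor.ind
    exact Quot.sound (Rel.add_assoc _ _ _)
  add_comm f g := by
    induction f using Mor.ind; induction g using Mor.ind
    exact Quot.sound (Rel.add_comm _ _)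
  zero_add f := by
    induction f using Mor.ind
    exact Quot.sound (Rel.zero_add _)
  add_zero f := by
    induction f using Mor.ind
    exact Quot.sound ((Rel.add_comm _ _).trans (Rel.zero_add _))
  neg_add_cancel f := by
    induction f using Mor.ind with | h f
    refine Quot.sound (((Rel.add (Rel.refl _) (Rel.one_smul f).symm).trans
      (Rel.add_smul (-1) 1 f).symm).trans ?_)
    rw [neg_add_cancel]
    exact Rel.zero_smul f

instance (X Y : List O) : Module K (Mor R X Y) where
  smul := Mor.smul
  one_smul f := by
    induction f using Mor.ind
    exact Quot.sound (Rel.one_smul _)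
  mul_smul a b f := by
    induction f using Mor.ind
    exact Quot.sound (Rel.mul_smul _ _ _)
  smul_zero a := by
    refine Quot.sound ((Rel.smul a (Rel.zero_smul (Term.zero X Y)).symm).trans
      ((Rel.mul_smul a 0 _).symm.trans ?_))
    rw [mul_zero]
    exact Rel.zero_smul _
  smul_add a f g := by
    induction f using Mor.ind; induction g using Mor.ind
    exact Quot.sound (Rel.smul_add _ _ _)
  add_smul a b f := by
    induction f using Mor.ind
    exact Quot.sound (Rel.add_smul _ _ _)
  zero_smul f := by
    induction f using Mor.ind
    exact Quot.sound (Rel.zero_smul _)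

instance : Category.{u} (Presented K S R) where
  Hom X Y := Mor R X.word Y.word
  id X := Mor.mk R (Term.id X.word)
  comp f g := Mor.comp f g
  id_comp f := by
    induction f using Mor.ind
    exact Quot.sound (Rel.id_comp _)
  comp_id f := by
    induction f using Mor.ind
    exact Quot.sound (Rel.comp_id _)
  assoc f g h := by
    induction f using Mor.ind; induction g using Mor.ind; induction h using Mor.ind
    exact Quot.sound (Rel.comp_assoc _ _ _)

/-- A formal expression, regarded as a morphism of the presented category. -/
def homMk (R : ∀ ⦃X Y : List O⦄, S.Term K X Y → S.Term K X Y → Prop) {X Y : List O}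
    (f : S.Term K X Y) : (⟨X⟩ : Presented K S R) ⟶ ⟨Y⟩ :=
  Mor.mk R f

theorem hom_ind {X Y : Presented K S R} {P : (X ⟶ Y) → Prop}
    (h : ∀ f : S.Term K X.word Y.word, P (homMk R f)) (f : X ⟶ Y) : P f :=
  Quot.ind h f

instance : Preadditive (Presented K S R) where
  homGroup X Y := inferInstanceAs (AddCommGroup (Mor R X.word Y.word))
  add_comp X Y Z f f' g := by
    induction f using hom_ind; induction f' using hom_ind; induction g using hom_ind
    exact Quot.sound (Rel.add_comp _ _ _)
  comp_add X Y Z f g g' := by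
    induction f using hom_ind; induction g using hom_ind; induction g' using hom_ind
    exact Quot.sound (Rel.comp_add _ _ _)

instance : Linear K (Presented K S R) where
  homModule X Y := inferInstanceAs (Module K (Mor R X.word Y.word))
  smul_comp X Y Z a f g := by
    induction f using hom_ind; induction g using hom_ind
    exact Quot.sound (Rel.smul_comp _ _ _)
  comp_smul X Y Z f a g := by
    induction f using hom_ind; induction g using hom_ind
    exact Quot.sound (Rel.comp_smul _ _ _)

theorem ext_word {X Y : Presented K S R} (h : X.word = Y.word) : X = Y := by
  cases X; cases Y; cases h; rfl

theorem homMk_eqTo {X Y : List O} (h : X = Y) :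
    homMk R (Term.eqTo K S h) = eqToHom (congrArg Presented.mk h) := by
  subst h; rfl

/-- The tensor product of objects is concatenation of words, and the associators and unitors are
the identities (transported along the equalities of words). -/
instance : MonoidalCategoryStruct (Presented K S R) where
  tensorObj X Y := ⟨X.word ++ Y.word⟩
  tensorUnit := ⟨[]⟩
  tensorHom f g := Mor.tensor f g
  whiskerLeft X _ _ f := Mor.tensor (Mor.mk R (Term.id X.word)) f
  whiskerRight f Y := Mor.tensor f (Mor.mk R (Term.id Y.word))
  associator X Y Z := eqToIso (ext_word (List.append_assoc X.word Y.word Z.word))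
  leftUnitor X := eqToIso (ext_word (List.nil_append X.word))
  rightUnitor X := eqToIso (ext_word (List.append_nil X.word))

theorem id_tensor_id (X Y : Presented K S R) : 𝟙 X ⊗ₘ 𝟙 Y = 𝟙 (X ⊗ Y) :=
  Quot.sound (Rel.id_tensor_id _ _)

theorem eqToHom_tensor {X Y : Presented K S R} (h : X = Y) (Z : Presented K S R) :
    eqToHom h ⊗ₘ 𝟙 Z = eqToHom (congrArg (fun W => W ⊗ Z) h) := by
  subst h; exact id_tensor_id _ _

theorem tensor_eqToHom {X Y : Presented K S R} (h : X = Y) (Z : Presented K S R) :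
    𝟙 Z ⊗ₘ eqToHom h = eqToHom (congrArg (fun W => Z ⊗ W) h) := by
  subst h; exact id_tensor_id _ _

instance : MonoidalCategory (Presented K S R) :=
  MonoidalCategory.ofTensorHom
    (id_tensorHom_id := id_tensor_id)
    (id_tensorHom := fun _ _ _ _ => rfl)
    (tensorHom_id := fun _ _ => rfl)
    (tensorHom_comp_tensorHom := fun f₁ f₂ g₁ g₂ => by
      induction f₁ using hom_ind; induction f₂ using hom_ind
      induction g₁ using hom_ind; induction g₂ using hom_ind
      exact Quot.sound (Rel.interchange _ _ _ _))
    (associator_naturality := fun {X₁ X₂ X₃ Y₁ Y₂ Y₃} f₁ f₂ f₃ => by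
      induction f₁ using hom_ind; induction f₂ using hom_ind; induction f₃ using hom_ind
      change _ ≫ eqToHom (ext_word (List.append_assoc Y₁.word Y₂.word Y₃.word)) =
        eqToHom (ext_word (List.append_assoc X₁.word X₂.word X₃.word)) ≫ _
      rw [← homMk_eqTo (List.append_assoc Y₁.word Y₂.word Y₃.word),
        ← homMk_eqTo (List.append_assoc X₁.word X₂.word X₃.word)]
      exact Quot.sound (Rel.tensor_assoc _ _ _))
    (leftUnitor_naturality := fun {X Y} f => by
      change _ ≫ 𝟙 Y = 𝟙 X ≫ _
      rw [Category.comp_id, Category.id_comp]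
      induction f using hom_ind
      exact Quot.sound (Rel.unit_tensor _))
    (rightUnitor_naturality := fun {X Y} f => by
      induction f using hom_ind
      change _ ≫ eqToHom (ext_word (List.append_nil Y.word)) =
        eqToHom (ext_word (List.append_nil X.word)) ≫ _
      rw [← homMk_eqTo (List.append_nil Y.word), ← homMk_eqTo (List.append_nil X.word)]
      exact Quot.sound (Rel.tensor_unit _))
    (pentagon := fun W X Y Z => by
      change (eqToHom (ext_word (List.append_assoc _ _ _)) ⊗ₘ _) ≫
        eqToHom (ext_word (List.append_assoc _ _ _)) ≫
          (_ ⊗ₘ eqToHom (ext_word (List.append_assoc _ _ _))) =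
        eqToHom (ext_word (List.append_assoc _ _ _)) ≫ eqToHom (ext_word (List.append_assoc _ _ _))
      rw [eqToHom_tensor, tensor_eqToHom]
      simp only [eqToHom_trans])
    (triangle := fun X Y => by
      change eqToHom (ext_word (List.append_assoc _ _ _)) ≫
        (_ ⊗ₘ eqToHom (ext_word (List.nil_append _))) =
        (eqToHom (ext_word (List.append_nil _)) ⊗ₘ _)
      rw [eqToHom_tensor, tensor_eqToHom]
      simp only [eqToHom_trans])

instance : MonoidalPreadditive (Presented K S R) where
  whiskerLeft_zero {X Y Z} := Quot.sound
    (((Rel.tensor (Rel.refl _) (Rel.zero_smul (Term.zero Y.word Z.word)).symm).trans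
      (Rel.tensor_smul _ _ _)).trans (Rel.zero_smul _))
  zero_whiskerRight {X Y Z} := Quot.sound
    (((Rel.tensor (Rel.zero_smul (Term.zero Y.word Z.word)).symm (Rel.refl _)).trans
      (Rel.smul_tensor _ _ _)).trans (Rel.zero_smul _))
  whiskerLeft_add f g := by
    induction f using hom_ind; induction g using hom_ind
    exact Quot.sound (Rel.tensor_add _ _ _)
  add_whiskerRight f g := by
    induction f using hom_ind; induction g using hom_ind
    exact Quot.sound (Rel.add_tensor _ _ _)

instance : MonoidalLinear K (Presented K S R) where
  whiskerLeft_smul X Y Z a f := by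
    induction f using hom_ind
    exact Quot.sound (Rel.tensor_smul _ _ _)
  smul_whiskerRight a Y Z f X := by
    induction f using hom_ind
    exact Quot.sound (Rel.smul_tensor _ _ _)

/-- An isomorphism, identical on objects, between two strict `K`-linear monoidal categories
presented on the same object generators: `K`-linear bijections on morphism spaces that
respect identities, composition and tensor products. -/
structure StrictIso {K : Type u} [CommRing K] {O : Type} {S S' : MonSig O}
    (R : ∀ ⦃X Y : List O⦄, S.Term K X Y → S.Term K X Y → Prop)
    (R' : ∀ ⦃X Y : List O⦄, S'.Term K X Y → S'.Term K X Y → Prop) where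
  map : ∀ X Y : List O,
    ((⟨X⟩ : Presented K S R) ⟶ ⟨Y⟩) ≃ₗ[K] ((⟨X⟩ : Presented K S' R') ⟶ ⟨Y⟩)
  map_id : ∀ X : List O, map X X (𝟙 _) = 𝟙 _
  map_comp : ∀ {X Y Z : List O} (f : (⟨X⟩ : Presented K S R) ⟶ ⟨Y⟩)
    (g : (⟨Y⟩ : Presented K S R) ⟶ ⟨Z⟩), map X Z (f ≫ g) = map X Y f ≫ map Y Z g
  map_tensor : ∀ {X Y X' Y' : List O} (f : (⟨X⟩ : Presented K S R) ⟶ ⟨Y⟩)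
    (g : (⟨X'⟩ : Presented K S R) ⟶ ⟨Y'⟩),
    map (X ++ X') (Y ++ Y') (f ⊗ₘ g) = map X Y f ⊗ₘ map X' Y' g

end Presented

/-! ## The relations of the Heisenberg category, in a monoidal category

The relations are written with `⊗≫`, which is composition with the associators and unitors
inserted that make source and target match; in a strict monoidal category it is composition.
Diagrams are read from bottom to top, so `f ≫ g` is `g` drawn above `f`. -/

/-- The endomorphisms of the unit object of a monoidal category commute. -/
theorem unitEnd_comm {C : Type u} [Category.{v} C] [MonoidalCategory C] (f g : 𝟙_ C ⟶ 𝟙_ C) : f ≫ g = g ≫ f := by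
  have h : (f ▷ 𝟙_ C) ≫ (𝟙_ C ◁ g) = (𝟙_ C ◁ g) ≫ (f ▷ 𝟙_ C) := (whisker_exchange f g).symm
  have e : (λ_ (𝟙_ C)).inv = (ρ_ (𝟙_ C)).inv := unitors_inv_equal
  rw [id_whiskerLeft, whiskerRight_id, ← unitors_equal, ← e] at h
  simpa using h

section Diagrams

variable {C : Type u} [Category.{v} C] [Preadditive C] [MonoidalCategory C]

instance unitEndCommRing : CommRing (End (𝟙_ C)) :=
  { (inferInstance : Ring (End (𝟙_ C))) with mul_comm := fun f g => unitEnd_comm g f }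

variable (C) in
/-- Objects `up`, `down` with a dot `x`, an upward crossing `s`, a rightward cup `c` and a
rightward cap `d`. -/
structure RightData where
  up : C
  down : C
  x : up ⟶ up
  s : up ⊗ up ⟶ up ⊗ up
  c : 𝟙_ C ⟶ down ⊗ up
  d : up ⊗ down ⟶ 𝟙_ C

namespace RightData

variable (D : RightData C)

/-- `n` dots on an upward strand. -/
def dots : ℕ → (D.up ⟶ D.up)
  | 0 => 𝟙 D.up
  | n + 1 => dots n ≫ D.x

/-- The rightward crossing `t`. -/
def crossR : D.up ⊗ D.down ⟶ D.down ⊗ D.up :=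
  𝟙 (D.up ⊗ D.down) ⊗≫ D.c ▷ (D.up ⊗ D.down) ⊗≫ D.down ◁ D.s ▷ D.down ⊗≫
    (D.down ⊗ D.up) ◁ D.d ⊗≫ 𝟙 (D.down ⊗ D.up)

/-- The rightward cup with `n` dots on its upward strand. -/
def cupDots (n : ℕ) : 𝟙_ C ⟶ D.down ⊗ D.up := D.c ≫ D.down ◁ D.dots n

/-- The rightward cap with `n` dots on its upward strand. -/
def capDots (n : ℕ) : D.up ⊗ D.down ⟶ 𝟙_ C := D.dots n ▷ D.down ≫ D.d

/-- The degenerate Hecke relations and the right adjunction relations. -/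
inductive BasicRel : ∀ ⦃X Y : C⦄, (X ⟶ Y) → (X ⟶ Y) → Prop
  | square : BasicRel (D.s ≫ D.s) (𝟙 (D.up ⊗ D.up))
  | braid : BasicRel
      (𝟙 (D.up ⊗ D.up ⊗ D.up) ⊗≫ D.s ▷ D.up ⊗≫ D.up ◁ D.s ⊗≫ D.s ▷ D.up ⊗≫
        𝟙 (D.up ⊗ D.up ⊗ D.up))
      (𝟙 (D.up ⊗ D.up ⊗ D.up) ⊗≫ D.up ◁ D.s ⊗≫ D.s ▷ D.up ⊗≫ D.up ◁ D.s ⊗≫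
        𝟙 (D.up ⊗ D.up ⊗ D.up))
  | dot : BasicRel (D.s ≫ D.x ▷ D.up - D.up ◁ D.x ≫ D.s) (𝟙 (D.up ⊗ D.up))
  | adj_up : BasicRel (𝟙 D.up ⊗≫ D.up ◁ D.c ⊗≫ D.d ▷ D.up ⊗≫ 𝟙 D.up) (𝟙 D.up)
  | adj_down : BasicRel (𝟙 D.down ⊗≫ D.c ▷ D.down ⊗≫ D.down ◁ D.d ⊗≫ 𝟙 D.down) (𝟙 D.down)

/-- The inversion relation. If `0 ≤ k`, the column with entries `t, d, d(x ⊗ 1), …,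
d(x ^ (k - 1) ⊗ 1)`, as a morphism from `up ⊗ down` to `(down ⊗ up) ⊕ 𝟙 ^ k`, has the row with
entries `tInv, cInv 0, …, cInv (k - 1)` as two-sided inverse. If `k < 0`, the row with entries
`t, c, (1 ⊗ x)c, …, (1 ⊗ x ^ (-k - 1))c`, as a morphism from `(up ⊗ down) ⊕ 𝟙 ^ (-k)` to
`down ⊗ up`, has the column with entries `tInv, dInv 0, …, dInv (-k - 1)` as two-sided inverse.
At least one of the two index types `Fin k.toNat`, `Fin (-k).toNat` is empty. -/
inductive InversionRel (k : ℤ) (tInv : D.down ⊗ D.up ⟶ D.up ⊗ D.down)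
    (cInv : Fin k.toNat → (𝟙_ C ⟶ D.up ⊗ D.down))
    (dInv : Fin (-k).toNat → (D.down ⊗ D.up ⟶ 𝟙_ C)) :
    ∀ ⦃X Y : C⦄, (X ⟶ Y) → (X ⟶ Y) → Prop
  | up_down : InversionRel k tInv cInv dInv
      (D.crossR ≫ tInv + ∑ i : Fin k.toNat, D.capDots i ≫ cInv i) (𝟙 (D.up ⊗ D.down))
  | down_up : InversionRel k tInv cInv dInv
      (tInv ≫ D.crossR + ∑ j : Fin (-k).toNat, dInv j ≫ D.cupDots j) (𝟙 (D.down ⊗ D.up))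
  | cInv_cross (i : Fin k.toNat) : InversionRel k tInv cInv dInv (cInv i ≫ D.crossR) 0
  | tInv_cap (i : Fin k.toNat) : InversionRel k tInv cInv dInv (tInv ≫ D.capDots i) 0
  | cInv_cap (i j : Fin k.toNat) : InversionRel k tInv cInv dInv
      (cInv j ≫ D.capDots i) (if i = j then 𝟙 (𝟙_ C) else 0)
  | cross_dInv (i : Fin (-k).toNat) : InversionRel k tInv cInv dInv (D.crossR ≫ dInv i) 0
  | cup_tInv (j : Fin (-k).toNat) : InversionRel k tInv cInv dInv (D.cupDots j ≫ tInv) 0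
  | cup_dInv (i j : Fin (-k).toNat) : InversionRel k tInv cInv dInv
      (D.cupDots j ≫ dInv i) (if i = j then 𝟙 (𝟙_ C) else 0)

end RightData

variable (C) in
/-- Right data together with a leftward cup `c'` (called `cupL`) and a leftward cap `d'` (called
`capL`). -/
structure FullData extends RightData C where
  cupL : 𝟙_ C ⟶ up ⊗ down
  capL : down ⊗ up ⟶ 𝟙_ C

namespace FullData

variable (D : FullData C)

/-- The leftward crossing `t'`. -/
def crossL : D.down ⊗ D.up ⟶ D.up ⊗ D.down :=
  𝟙 (D.down ⊗ D.up) ⊗≫ (D.down ⊗ D.up) ◁ D.cupL ⊗≫ D.down ◁ D.s ▷ D.down ⊗≫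
    D.capL ▷ (D.up ⊗ D.down) ⊗≫ 𝟙 (D.up ⊗ D.down)

/-- The leftward cup with `n` dots on its upward strand. -/
def cupLDots (n : ℕ) : 𝟙_ C ⟶ D.up ⊗ D.down := D.cupL ≫ D.dots n ▷ D.down

/-- The leftward cap with `n` dots on its upward strand. -/
def capLDots (n : ℕ) : D.down ⊗ D.up ⟶ 𝟙_ C := D.down ◁ D.dots n ≫ D.capL

/-- The clockwise bubble with `n ≥ 0` dots. -/
def clockNat (n : ℕ) : End (𝟙_ C) := D.cupL ≫ D.dots n ▷ D.down ≫ D.d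

/-- The anticlockwise bubble with `n ≥ 0` dots. -/
def antiNat (n : ℕ) : End (𝟙_ C) := D.c ≫ D.down ◁ D.dots n ≫ D.capL

/-- The anticlockwise bubble with any integer number `n` of dots. For `n < 0` and `r = n + k + 1`
it is the determinant of the `r × r` matrix whose `(i, j)` entry is the clockwise bubble with
`i - j + k` dots (a positive number), and `0` if `r < 0`. -/
def anti (k n : ℤ) : End (𝟙_ C) :=
  if 0 ≤ n then D.antiNat n.toNat
  else if n + k + 1 < 0 then 0
  else Matrix.det (Matrix.of fun i j : Fin (n + k + 1).toNat =>
    D.clockNat ((i : ℤ) - (j : ℤ) + k).toNat)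

/-- The clockwise bubble with any integer number `n` of dots. For `n < 0` and `r = n - k + 1`
it is minus the determinant of the `r × r` matrix whose `(i, j)` entry is minus the anticlockwise
bubble with `i - j - k` dots (a positive number), and `0` if `r < 0`. -/
def clock (k n : ℤ) : End (𝟙_ C) :=
  if 0 ≤ n then D.clockNat n.toNat
  else if n - k + 1 < 0 then 0
  else -Matrix.det (Matrix.of fun i j : Fin (n - k + 1).toNat =>
    -D.antiNat ((i : ℤ) - (j : ℤ) - k).toNat)

/-- `f` with the closed diagram `b` drawn to its right. -/
def bubbleRight {X Y : C} (f : X ⟶ Y) (b : End (𝟙_ C)) : X ⟶ Y :=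
  (ρ_ X).inv ≫ (f ⊗ₘ (b : 𝟙_ C ⟶ 𝟙_ C)) ≫ (ρ_ Y).hom

/-- `f` with the closed diagram `b` drawn to its left. -/
def bubbleLeft {X Y : C} (b : End (𝟙_ C)) (f : X ⟶ Y) : X ⟶ Y :=
  (λ_ X).inv ≫ ((b : 𝟙_ C ⟶ 𝟙_ C) ⊗ₘ f) ≫ (λ_ Y).hom

/-- The right curl on an upward strand. -/
def curlR : D.up ⟶ D.up :=
  𝟙 D.up ⊗≫ D.up ◁ D.cupL ⊗≫ D.s ▷ D.down ⊗≫ D.up ◁ D.d ⊗≫ 𝟙 D.up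

/-- The left curl on an upward strand. -/
def curlL : D.up ⟶ D.up :=
  𝟙 D.up ⊗≫ D.c ▷ D.up ⊗≫ D.down ◁ D.s ⊗≫ D.capL ▷ D.up ⊗≫ 𝟙 D.up

/-- The relations on leftward cups and caps. In `pos` and `neg` the sums over all `r, s ≥ 0` are
restricted to `r, s < k` and `r, s < -k`, respectively: all other terms contain a bubble
that is zero by definition. -/
inductive LeftRel (k : ℤ) : ∀ ⦃X Y : C⦄, (X ⟶ Y) → (X ⟶ Y) → Prop
  | pos : LeftRel k (D.crossR ≫ D.crossL)
      (𝟙 (D.up ⊗ D.down) + ∑ r ∈ Finset.range k.toNat, ∑ s ∈ Finset.range k.toNat,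
        bubbleRight (D.capDots s ≫ D.cupLDots r) (D.anti k (-(r : ℤ) - (s : ℤ) - 2)))
  | neg : LeftRel k (D.crossL ≫ D.crossR)
      (𝟙 (D.down ⊗ D.up) + ∑ r ∈ Finset.range (-k).toNat, ∑ s ∈ Finset.range (-k).toNat,
        bubbleLeft (D.clock k (-(r : ℤ) - (s : ℤ) - 2)) (D.capLDots r ≫ D.cupDots s))
  | curlR (hk : 0 ≤ k) : LeftRel k D.curlR (if k = 0 then 𝟙 D.up else 0)
  | clock (r : ℕ) (hr : (r : ℤ) < k) : LeftRel k (X := 𝟙_ C) (Y := 𝟙_ C)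
      (D.clock k r) (-(if (r : ℤ) = k - 1 then 𝟙 (𝟙_ C) else 0))
  | curlL (hk : k ≤ 0) : LeftRel k D.curlL (if k = 0 then 𝟙 D.up else 0)
  | anti (r : ℕ) (hr : (r : ℤ) < -k) : LeftRel k (X := 𝟙_ C) (Y := 𝟙_ C)
      (D.anti k r) (if (r : ℤ) = -k - 1 then 𝟙 (𝟙_ C) else 0)

end FullData

/-- Right data, completed by a leftward cup `c'` and a leftward cap `d'`. -/
abbrev RightData.withLeft (D : RightData C) (c' : 𝟙_ C ⟶ D.up ⊗ D.down)
    (d' : D.down ⊗ D.up ⟶ 𝟙_ C) : FullData C :=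
  ⟨D, c', d'⟩

/-- `D`, completed by the leftward cup `c'` and cap `d'`, satisfies all relations on leftward cups
and caps. -/
def RightData.IsLeftPair (D : RightData C) (k : ℤ) (c' : 𝟙_ C ⟶ D.up ⊗ D.down)
    (d' : D.down ⊗ D.up ⟶ 𝟙_ C) : Prop :=
  ∀ ⦃X Y : C⦄ (f g : X ⟶ Y), (D.withLeft c' d').LeftRel k f g → f = g

end Diagrams

/-! ## The two presentations -/

namespace Heis

/-- The two generating objects. -/
inductive Arrow : Type
  | up
  | down

open Arrow

/-- The generating morphisms of the Heisenberg category: `x`, `s`, `c`, `d`, and the entries of the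
two-sided inverse that the inversion relation demands. -/
inductive Gen (k : ℤ) : Type
  | x
  | s
  | c
  | d
  | tInv
  | cInv (i : Fin k.toNat)
  | dInv (i : Fin (-k).toNat)

def sig (k : ℤ) : MonSig Arrow where
  Gen := Gen k
  src
    | .x => [up]
    | .s => [up, up]
    | .c => []
    | .d => [up, down]
    | .tInv => [down, up]
    | .cInv _ => []
    | .dInv _ => [down, up]
  tgt
    | .x => [up]
    | .s => [up, up]
    | .c => [down, up]
    | .d => []
    | .tInv => [up, down]
    | .cInv _ => [up, down]
    | .dInv _ => []

/-- The generating morphisms of the second presentation. -/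
inductive AltGen : Type
  | x
  | s
  | c
  | d
  | c'
  | d'

def altSig : MonSig Arrow where
  Gen := AltGen
  src
    | .x => [up]
    | .s => [up, up]
    | .c => []
    | .d => [up, down]
    | .c' => []
    | .d' => [down, up]
  tgt
    | .x => [up]
    | .s => [up, up]
    | .c => [down, up]
    | .d => []
    | .c' => [up, down]
    | .d' => []

section

variable {K : Type u} [CommRing K]

open MonSig

/-- The generators `x`, `s`, `c`, `d` in any quotient of the free category on `sig k`. -/
def rightData {k : ℤ} (R : ∀ ⦃X Y : List Arrow⦄, (sig k).Term K X Y → (sig k).Term K X Y → Prop) :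
    RightData (Presented K (sig k) R) where
  up := ⟨[up]⟩
  down := ⟨[down]⟩
  x := Presented.homMk R (Term.gen (S := sig k) Gen.x)
  s := Presented.homMk R (Term.gen (S := sig k) Gen.s)
  c := Presented.homMk R (Term.gen (S := sig k) Gen.c)
  d := Presented.homMk R (Term.gen (S := sig k) Gen.d)

/-- The generators `x`, `s`, `c`, `d`, `c'`, `d'` in any quotient of the free category on
`altSig`. -/
def fullData (R : ∀ ⦃X Y : List Arrow⦄, altSig.Term K X Y → altSig.Term K X Y → Prop) :
    FullData (Presented K altSig R) where
  up := ⟨[up]⟩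
  down := ⟨[down]⟩
  x := Presented.homMk R (Term.gen (S := altSig) AltGen.x)
  s := Presented.homMk R (Term.gen (S := altSig) AltGen.s)
  c := Presented.homMk R (Term.gen (S := altSig) AltGen.c)
  d := Presented.homMk R (Term.gen (S := altSig) AltGen.d)
  cupL := Presented.homMk R (Term.gen (S := altSig) AltGen.c')
  capL := Presented.homMk R (Term.gen (S := altSig) AltGen.d')

/-- No imposed relations: the free strict `K`-linear monoidal category. -/
def noRel {S : MonSig Arrow} ⦃X Y : List Arrow⦄ (_ _ : S.Term K X Y) : Prop := False

variable (K) in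
/-- The defining relations of the Heisenberg category: degenerate Hecke, right adjunction and
inversion. They are relations between morphisms of the free category. -/
def rel (k : ℤ) ⦃X Y : List Arrow⦄ (f g : (sig k).Term K X Y) : Prop :=
  (rightData (K := K) (k := k) noRel).BasicRel (Presented.homMk noRel f) (Presented.homMk noRel g) ∨
  (rightData (K := K) (k := k) noRel).InversionRel k
    (Presented.homMk noRel (Term.gen (S := sig k) Gen.tInv))
    (fun i => Presented.homMk noRel (Term.gen (S := sig k) (Gen.cInv i)))
    (fun i => Presented.homMk noRel (Term.gen (S := sig k) (Gen.dInv i)))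
    (Presented.homMk noRel f) (Presented.homMk noRel g)

variable (K) in
/-- The relations of the second presentation: degenerate Hecke, right adjunction, and the relations
on leftward cups and caps. -/
def altRel (k : ℤ) ⦃X Y : List Arrow⦄ (f g : altSig.Term K X Y) : Prop :=
  (fullData (K := K) noRel).BasicRel (Presented.homMk noRel f) (Presented.homMk noRel g) ∨
  (fullData (K := K) noRel).LeftRel k (Presented.homMk noRel f) (Presented.homMk noRel g)

end

end Heis

/-- The Heisenberg category of central charge `k` over `K`. -/
abbrev HeisCat (K : Type u) [CommRing K] (k : ℤ) : Type := Presented K (Heis.sig k) (Heis.rel K k)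

/-- The generators `x`, `s`, `c`, `d` of the Heisenberg category. -/
def heisData (K : Type u) [CommRing K] (k : ℤ) : RightData (HeisCat K k) :=
  Heis.rightData (Heis.rel K k)

/-- The category given by the second presentation. -/
abbrev AltHeisCat (K : Type u) [CommRing K] (k : ℤ) : Type :=
  Presented K Heis.altSig (Heis.altRel K k)

/-- The generators `x`, `s`, `c`, `d`, `c'`, `d'` of the second presentation. -/
def altData (K : Type u) [CommRing K] (k : ℤ) : FullData (AltHeisCat K k) :=
  Heis.fullData (Heis.altRel K k)

/-! ## Heisenberg actions in components -/

/-! Negative central charges reduce to positive ones. Reversing composition and tensor product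
(rotation by 180 degrees) exchanges `c` and `d`; with `-s`, `-d'`, `-c'` in the roles of `s`, `c'`,
`d'`, it turns the relations for `k` into those for `-k` (`rotate_isInverse`, `rotate_isLeft`). So
let `k = n ≥ 0`, and let `τ`, `e_0, …, e_(n-1)` be the inverse of the column of the inversion
relation.

Uniqueness. The column is split mono, so a morphism into `↑ ⊗ ↓` is known from its composites with
`t` and with the caps carrying `i < n` dots. By adjunction the right curl relation prescribes `t ∘
c'`, and the bubble relations prescribe the composites of `c'` with the dotted caps; this determines
`c'`. Sliding dots through the right curl shows that the cap with `j ≤ n` dots composed with `t'` is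
`δ_{j,n} d'`. As `t ∘ t' = 1`, it follows that `t' = τ`, and `d'` is `τ` followed by the cap with
`n` dots.

Existence. These formulas serve as definitions: `c'` is `-e_(n-1)`, or `τ ∘ c` if `n = 0`. The
negatively dotted bubbles are the coefficients of the inverse of the series `-∑ ↻_{n-1+m} u^m`,
since such coefficients are Toeplitz determinants (`coeff_inv_eq_det`). Hence `e_j = -∑_b ↺_{-j-b-2}
x^b c'` (`IsInverse.e_eq`), and the inversion relation becomes (pos) and (neg) as soon as `t' = τ`.
This last equality, `IsInverse.crossL_eq_inv`, is the heart of the proof. The leftward cup is pulled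
across a downward strand (`IsInverse.twist_t`), the braid relation is applied, and dots are moved
through a crossing; the error terms add up to the sum in (pos).

The two presentations. Each category contains data satisfying the relations of the other
presentation, so the universal properties give strict functors both ways. They are mutually inverse
on generators because a two-sided inverse of a matrix is unique, and so is a left pair.

The diagram calculus is carried out for natural transformations between endofunctors. A monoidal
category acts on itself by tensoring on the left; the interchange law becomes naturality,
associators disappear, and the component at the unit object recovers each morphism. -/

/-- An action of the generators `x`, `s`, `c`, `d` on a preadditive category: additive endofunctors
for the two objects and natural families of morphisms for the generators, subject to the degenerate
Hecke relations and the right adjunction relations. -/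
structure HeisAction (A : Type u) [Category.{v} A] [Preadditive A] where
  U : A ⥤ A
  V : A ⥤ A
  addU : U.Additive
  addV : V.Additive
  x (Z : A) : U.obj Z ⟶ U.obj Z
  s (Z : A) : U.obj (U.obj Z) ⟶ U.obj (U.obj Z)
  c (Z : A) : Z ⟶ V.obj (U.obj Z)
  d (Z : A) : U.obj (V.obj Z) ⟶ Z
  x_nat {Z W : A} (f : Z ⟶ W) : U.map f ≫ x W = x Z ≫ U.map f
  s_nat {Z W : A} (f : Z ⟶ W) : U.map (U.map f) ≫ s W = s Z ≫ U.map (U.map f)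
  c_nat {Z W : A} (f : Z ⟶ W) : f ≫ c W = c Z ≫ V.map (U.map f)
  d_nat {Z W : A} (f : Z ⟶ W) : U.map (V.map f) ≫ d W = d Z ≫ f
  s_s (Z : A) : s Z ≫ s Z = 𝟙 _
  braid (Z : A) : s (U.obj Z) ≫ U.map (s Z) ≫ s (U.obj Z) = U.map (s Z) ≫ s (U.obj Z) ≫ U.map (s Z)
  dot (Z : A) : s Z ≫ x (U.obj Z) - U.map (x Z) ≫ s Z = 𝟙 _
  adj_up (Z : A) : U.map (c Z) ≫ d (U.obj Z) = 𝟙 _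
  adj_down (Z : A) : c (V.obj Z) ≫ V.map (d Z) = 𝟙 _

theorem CategoryTheory.Functor.map_square {A : Type u} [Category.{v} A] {B : Type w} [Category.{v} B] (F : A ⥤ B)
    {X Y Y' Z : A} {f : X ⟶ Y} {g : Y ⟶ Z} {f' : X ⟶ Y'} {g' : Y' ⟶ Z} (h : f ≫ g = f' ≫ g') :
    F.map f ≫ F.map g = F.map f' ≫ F.map g' := by
  rw [← F.map_comp, h, F.map_comp]

namespace HeisAction

variable {A : Type u} [Category.{v} A] [Preadditive A] (H : HeisAction A)

attribute [instance] HeisAction.addU HeisAction.addV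

def t (Z : A) : H.U.obj (H.V.obj Z) ⟶ H.V.obj (H.U.obj Z) :=
  H.c _ ≫ H.V.map (H.s _) ≫ H.V.map (H.U.map (H.d Z))

/-- The downward crossing. -/
def down (Z : A) : H.V.obj (H.V.obj Z) ⟶ H.V.obj (H.V.obj Z) :=
  H.c _ ≫ H.V.map (H.t _) ≫ H.V.map (H.V.map (H.d Z))

def xn : ℕ → ∀ Z : A, H.U.obj Z ⟶ H.U.obj Z
  | 0, _ => 𝟙 _
  | n + 1, Z => xn n Z ≫ H.x Z

def cap (n : ℕ) (Z : A) : H.U.obj (H.V.obj Z) ⟶ Z := H.xn n _ ≫ H.d Z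

@[simp] theorem xn_zero (Z : A) : H.xn 0 Z = 𝟙 _ := rfl

theorem xn_succ (n : ℕ) (Z : A) : H.xn (n + 1) Z = H.xn n Z ≫ H.x Z := rfl

theorem xn_succ' (n : ℕ) (Z : A) : H.xn (n + 1) Z = H.x Z ≫ H.xn n Z := by
  induction n with
  | zero => simp [xn_succ]
  | succ n ih => rw [xn_succ, ih, Category.assoc, ← xn_succ, ih]

theorem xn_nat (n : ℕ) {Z W : A} (f : Z ⟶ W) : H.U.map f ≫ H.xn n W = H.xn n Z ≫ H.U.map f := by
  induction n with
  | zero => simp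
  | succ n ih => rw [xn_succ, reassoc_of% ih, H.x_nat, xn_succ, Category.assoc]

theorem cap_zero (Z : A) : H.cap 0 Z = H.d Z := by simp [cap]

theorem cap_nat (n : ℕ) {Z W : A} (f : Z ⟶ W) :
    H.U.map (H.V.map f) ≫ H.cap n W = H.cap n Z ≫ f := by
  rw [cap, reassoc_of% H.xn_nat n, H.d_nat, cap, Category.assoc]

theorem t_nat {Z W : A} (f : Z ⟶ W) :
    H.U.map (H.V.map f) ≫ H.t W = H.t Z ≫ H.V.map (H.U.map f) := by
  simp only [t, Category.assoc, reassoc_of% H.c_nat]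
  rw [reassoc_of% H.V.map_square (H.s_nat (H.V.map f)),
    H.V.map_square (H.U.map_square (H.d_nat f))]

/-- `t` is the mate of `s` under the adjunction with unit `c` and counit `d`: the zigzag contained
in the composite straightens. -/
theorem map_t_d (Z : A) :
    H.U.map (H.t Z) ≫ H.d (H.U.obj Z) = H.s _ ≫ H.U.map (H.d Z) := by
  simp only [t, Functor.map_comp, Category.assoc, H.d_nat, reassoc_of% H.d_nat,
    reassoc_of% H.adj_up]

theorem map_t_cap (n : ℕ) (Z : A) :
    H.U.map (H.t Z) ≫ H.cap n (H.U.obj Z) = H.xn n _ ≫ H.s _ ≫ H.U.map (H.d Z) := by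
  rw [cap, reassoc_of% H.xn_nat n, map_t_d]

/-- The dot relation conjugated by the involution `s`. -/
theorem x_s (Z : A) : H.x (H.U.obj Z) ≫ H.s Z = H.s Z ≫ H.U.map (H.x Z) + 𝟙 _ := by
  have h := congrArg (fun f => H.s Z ≫ f ≫ H.s Z) (H.dot Z)
  simp only [Preadditive.sub_comp, Preadditive.comp_sub, Category.assoc, H.s_s, Category.comp_id,
    reassoc_of% H.s_s, Category.id_comp] at h
  rw [← h]; abel

theorem s_x (Z : A) : H.s Z ≫ H.x (H.U.obj Z) = H.U.map (H.x Z) ≫ H.s Z + 𝟙 _ := by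
  rw [← H.dot Z]; abel

theorem x_t (Z : A) :
    H.x _ ≫ H.t Z = H.t Z ≫ H.V.map (H.x _) - H.d Z ≫ H.c _ := by
  have h1 : H.U.map (H.x (H.V.obj Z)) ≫ H.s _ = H.s _ ≫ H.x _ - 𝟙 _ := by rw [H.s_x]; abel
  have h2 := congrArg H.V.map h1
  simp only [Functor.map_comp, Functor.map_sub, CategoryTheory.Functor.map_id] at h2
  simp only [t, Category.assoc, reassoc_of% H.c_nat, reassoc_of% h2, Preadditive.sub_comp,
    Preadditive.comp_sub, Category.id_comp, H.c_nat,
    ← H.V.map_square (H.x_nat (H.d Z))]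

theorem map_t_t (Z : A) :
    H.U.map (H.t Z) ≫ H.t (H.U.obj Z) = H.c _ ≫ H.V.map (H.s _) ≫
      H.V.map (H.U.map (H.s _)) ≫ H.V.map (H.U.map (H.U.map (H.d Z))) := by
  rw [t.eq_1 H (H.U.obj Z), reassoc_of% H.c_nat, reassoc_of% H.V.map_square (H.s_nat (H.t Z)),
    H.V.map_square (H.U.map_square (H.map_t_d Z))]

theorem braid_t (Z : A) :
    H.U.map (H.t Z) ≫ H.t (H.U.obj Z) ≫ H.V.map (H.s Z) =
      H.s _ ≫ H.U.map (H.t Z) ≫ H.t (H.U.obj Z) := by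
  have h := congrArg H.V.map (H.braid (H.V.obj Z))
  simp only [Functor.map_comp] at h
  rw [H.map_t_t, reassoc_of% H.map_t_t, H.V.map_square (H.s_nat (H.d Z)), reassoc_of% h,
    reassoc_of% H.c_nat]

/-- `down` is the mate of `t`, just as `t` is the mate of `s`. Through these two identities the
relations for `s` pass to the downward crossing. -/
theorem map_down_d (Z : A) :
    H.U.map (H.down Z) ≫ H.d (H.V.obj Z) = H.t _ ≫ H.V.map (H.d Z) := by
  simp only [down, Functor.map_comp, Category.assoc, H.d_nat, reassoc_of% H.d_nat,
    reassoc_of% H.adj_up]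

theorem map_down_cap (n : ℕ) (Z : A) :
    H.U.map (H.down Z) ≫ H.cap n (H.V.obj Z) = H.xn n _ ≫ H.t _ ≫ H.V.map (H.d Z) := by
  rw [cap, reassoc_of% H.xn_nat n, map_down_d]

theorem c_map_t (Z : A) :
    H.c (H.V.obj Z) ≫ H.V.map (H.t Z) = H.V.map (H.c Z) ≫ H.down (H.U.obj Z) := by
  rw [down, reassoc_of% H.c_nat, reassoc_of% H.V.map_square (H.t_nat (H.c Z)),
    ← H.V.map_comp (H.V.map _), ← H.V.map_comp (H.U.map _), H.adj_up]
  simp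

theorem map_down_t (Z : A) :
    H.U.map (H.down Z) ≫ H.t (H.V.obj Z) = H.c _ ≫ H.V.map (H.s _) ≫
      H.V.map (H.U.map (H.t _)) ≫ H.V.map (H.U.map (H.V.map (H.d Z))) := by
  conv_lhs => rw [t, reassoc_of% H.c_nat, reassoc_of% H.V.map_square (H.s_nat (H.down Z)),
    H.V.map_square (H.U.map_square (H.map_down_d Z))]

/-- Transposition along the adjunction between `U` and `V` is injective. -/
theorem hom_ext_d {X : A} {Z : A} {f g : X ⟶ H.V.obj Z}
    (h : H.U.map f ≫ H.d Z = H.U.map g ≫ H.d Z) : f = g := by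
  have key (f : X ⟶ H.V.obj Z) : f = H.c _ ≫ H.V.map (H.U.map f ≫ H.d Z) := by
    rw [Functor.map_comp, ← reassoc_of% H.c_nat, H.adj_down, Category.comp_id]
  rw [key f, key g, h]

theorem down_down (Z : A) : H.down Z ≫ H.down Z = 𝟙 _ := by
  apply H.hom_ext_d
  have h := congrArg H.V.map (H.s_s (H.V.obj (H.V.obj Z)))
  simp only [Functor.map_comp, CategoryTheory.Functor.map_id] at h
  rw [Functor.map_comp, Category.assoc, map_down_d, reassoc_of% H.map_down_t,
    H.V.map_square (H.d_nat (H.d Z)), reassoc_of% H.V.map_square (H.map_t_d (H.V.obj Z)),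
    reassoc_of% h, ← reassoc_of% H.c_nat, H.adj_down]
  simp

/-- One strand of `braid_t` is bent downwards with `c` and `d`. -/
theorem braid_down (Z : A) :
    H.t (H.V.obj Z) ≫ H.V.map (H.t Z) ≫ H.down (H.U.obj Z) =
      H.U.map (H.down Z) ≫ H.t (H.V.obj Z) ≫ H.V.map (H.t Z) := by
  have h := congrArg H.V.map (H.braid_t (H.V.obj Z))
  simp only [Functor.map_comp] at h
  rw [reassoc_of% H.map_down_t, H.V.map_square (H.t_nat (H.d Z)), ← reassoc_of% h, down,
    reassoc_of% H.c_nat, reassoc_of% H.c_nat, reassoc_of% H.V.map_square (H.t_nat (H.t Z)),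
    H.V.map_square (H.V.map_square (H.map_t_d Z))]

end HeisAction

/-! ### Inverses, leftward cups and leftward caps for nonnegative central charge -/

namespace HeisAction

variable {A : Type u} [Category.{v} A] [Preadditive A] (H : HeisAction A)

/-- The inversion relation for nonnegative central charge `n`. -/
structure IsInverse (n : ℕ) (τ : ∀ Z : A, H.V.obj (H.U.obj Z) ⟶ H.U.obj (H.V.obj Z))
    (e : Fin n → ∀ Z : A, Z ⟶ H.U.obj (H.V.obj Z)) : Prop where
  up_down (Z : A) : H.t Z ≫ τ Z + ∑ i : Fin n, H.cap i Z ≫ e i Z = 𝟙 _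
  down_up (Z : A) : τ Z ≫ H.t Z = 𝟙 _
  e_t (i : Fin n) (Z : A) : e i Z ≫ H.t Z = 0
  inv_cap (i : Fin n) (Z : A) : τ Z ≫ H.cap i Z = 0
  e_cap (i j : Fin n) (Z : A) : e j Z ≫ H.cap i Z = if i = j then 𝟙 _ else 0

/-- The right curl relations on a leftward cup for nonnegative central charge `n`. -/
structure IsCup (n : ℕ) (c' : ∀ Z : A, Z ⟶ H.U.obj (H.V.obj Z)) : Prop where
  nat {Z W : A} (f : Z ⟶ W) : f ≫ c' W = c' Z ≫ H.U.map (H.V.map f)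
  curl (Z : A) : H.U.map (c' Z) ≫ H.s _ ≫ H.U.map (H.d Z) = if n = 0 then 𝟙 _ else 0
  clock (r : ℕ) (hr : r < n) (Z : A) : c' Z ≫ H.cap r Z = -(if r + 1 = n then 𝟙 _ else 0)

/-- Naturality of a leftward cap. -/
def IsCap (d' : ∀ Z : A, H.V.obj (H.U.obj Z) ⟶ Z) : Prop :=
  ∀ ⦃Z W : A⦄ (f : Z ⟶ W), H.V.map (H.U.map f) ≫ d' W = d' Z ≫ f

def crossL (c' : ∀ Z : A, Z ⟶ H.U.obj (H.V.obj Z)) (d' : ∀ Z : A, H.V.obj (H.U.obj Z) ⟶ Z) (Z : A) :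
    H.V.obj (H.U.obj Z) ⟶ H.U.obj (H.V.obj Z) :=
  H.V.map (H.U.map (c' Z)) ≫ H.V.map (H.s _) ≫ d' _

variable {H} {n : ℕ} {τ : ∀ Z : A, H.V.obj (H.U.obj Z) ⟶ H.U.obj (H.V.obj Z)}
  {e : Fin n → ∀ Z : A, Z ⟶ H.U.obj (H.V.obj Z)}
  {c' : ∀ Z : A, Z ⟶ H.U.obj (H.V.obj Z)} {d' : ∀ Z : A, H.V.obj (H.U.obj Z) ⟶ Z}

namespace IsInverse

/-- The column of the inversion relation is a split monomorphism, so its entries are jointly monic.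
-/
theorem hom_ext (h : H.IsInverse n τ e) {X Z : A} {f g : X ⟶ H.U.obj (H.V.obj Z)}
    (ht : f ≫ H.t Z = g ≫ H.t Z) (hc : ∀ i : ℕ, i < n → f ≫ H.cap i Z = g ≫ H.cap i Z) : f = g := by
  rw [← Category.comp_id f, ← Category.comp_id g, ← h.up_down Z]
  simp only [Preadditive.comp_add, Preadditive.comp_sum, reassoc_of% ht]
  congr 1
  exact Finset.sum_congr rfl fun i _ => by rw [reassoc_of% hc i i.2]

/-- Additive functors preserve the splitting. The case needed is `F = V`, in `twist_t`. -/
theorem map_hom_ext (h : H.IsInverse n τ e) {X Z : A} (F : A ⥤ A) [F.Additive]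
    {f g : X ⟶ F.obj (H.U.obj (H.V.obj Z))}
    (ht : f ≫ F.map (H.t Z) = g ≫ F.map (H.t Z))
    (hc : ∀ i : ℕ, i < n → f ≫ F.map (H.cap i Z) = g ≫ F.map (H.cap i Z)) : f = g := by
  rw [← Category.comp_id f, ← Category.comp_id g, ← F.map_id, ← h.up_down Z]
  simp only [Functor.map_add, Functor.map_sum, Functor.map_comp, Preadditive.comp_add,
    Preadditive.comp_sum, reassoc_of% ht]
  congr 1
  exact Finset.sum_congr rfl fun i _ => by rw [reassoc_of% hc i i.2]

end IsInverse

theorem cup_t_curl (Z : A) :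
    c' Z ≫ H.t Z = H.c Z ≫ H.V.map (H.U.map (c' Z) ≫ H.s _ ≫ H.U.map (H.d Z)) := by
  simp only [t, Functor.map_comp, reassoc_of% H.c_nat]

/-- The right curl is determined by the composition of the leftward cup with the rightward
crossing. -/
theorem curl_eq (Z : A) :
    H.U.map (c' Z) ≫ H.s _ ≫ H.U.map (H.d Z) = H.U.map (c' Z ≫ H.t Z) ≫ H.d _ := by
  rw [cup_t_curl, H.U.map_comp, Category.assoc, H.d_nat, reassoc_of% H.adj_up]

namespace IsCup

theorem cup_t (h : H.IsCup n c') (Z : A) : c' Z ≫ H.t Z = if n = 0 then H.c Z else 0 := by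
  rw [cup_t_curl, h.curl]
  split_ifs <;> simp

theorem of_cup_t (nat : ∀ {Z W : A} (f : Z ⟶ W), f ≫ c' W = c' Z ≫ H.U.map (H.V.map f))
    (ht : ∀ Z, c' Z ≫ H.t Z = if n = 0 then H.c Z else 0)
    (clock : ∀ (r : ℕ), r < n → ∀ Z, c' Z ≫ H.cap r Z = -(if r + 1 = n then 𝟙 _ else 0)) :
    H.IsCup n c' where
  nat := nat
  curl Z := by
    rw [curl_eq, ht]
    split_ifs
    · exact H.adj_up Z
    · simp
  clock := clock

/-- Dotted right curls. -/
theorem curl_cap (h : H.IsCup n c') {j : ℕ} (hj : j ≤ n) (Z : A) :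
    H.U.map (c' Z) ≫ H.s _ ≫ H.U.map (H.cap j Z) = if j = n then 𝟙 _ else 0 := by
  induction j with
  | zero => rw [cap_zero, h.curl]; simp [eq_comm]
  | succ j ih =>
    -- Moving one dot through `s` costs the bubble with `j` dots. Since `j < n`, the undisturbed
    -- term vanishes by induction, and the bubble is `-1` exactly when `j + 1 = n`.
    have e1 : H.U.map (c' Z) ≫ H.s _ ≫ H.U.map (H.cap (j + 1) Z) =
        H.x Z ≫ (H.U.map (c' Z) ≫ H.s _ ≫ H.U.map (H.cap j Z)) -
          H.U.map (c' Z ≫ H.cap j Z) := by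
      have h1 : H.s (H.V.obj Z) ≫ H.U.map (H.x _) = H.x _ ≫ H.s _ - 𝟙 _ := by rw [H.x_s]; abel
      rw [cap, xn_succ', Category.assoc, Functor.map_comp, reassoc_of% h1]
      simp only [Preadditive.sub_comp, Preadditive.comp_sub, Category.assoc, Category.id_comp,
        Functor.map_comp, reassoc_of% H.x_nat, cap]
    rw [e1, ih (by omega), h.clock j (by omega), if_neg (by omega)]
    split_ifs <;> simp

/-- The dotted leftward cups composed with the rightward crossing. -/
theorem cup_xn_t (h : H.IsCup n c') {j : ℕ} (hj : j ≤ n) (Z : A) :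
    c' Z ≫ H.xn j _ ≫ H.t Z = if j = n then H.c Z else 0 := by
  induction j with
  | zero => rw [xn_zero, Category.id_comp, h.cup_t]; simp [eq_comm]
  | succ j ih =>
    rw [xn_succ, Category.assoc, H.x_t, Preadditive.comp_sub, Preadditive.comp_sub,
      reassoc_of% (ih (by omega)), if_neg (by omega)]
    have := h.clock j (by omega) Z
    simp only [cap] at this ⊢
    rw [reassoc_of% this]
    split_ifs <;> simp

/-- Naturality of `d'` draws the dotted cap inside a dotted right curl. The case `j = n` recovers
the leftward cap from the leftward crossing. -/
theorem crossL_cap (h : H.IsCup n c') (hd : H.IsCap d') {j : ℕ} (hj : j ≤ n) (Z : A) :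
    H.crossL c' d' Z ≫ H.cap j Z = if j = n then d' Z else 0 := by
  have := congrArg H.V.map (h.curl_cap hj Z)
  simp only [Functor.map_comp] at this
  rw [crossL, Category.assoc, Category.assoc, ← hd, reassoc_of% this]
  split_ifs <;> simp

end IsCup

theorem xn_cap (b i : ℕ) (Z : A) : H.xn b (H.V.obj Z) ≫ H.cap i Z = H.cap (b + i) Z := by
  induction b with
  | zero => simp
  | succ b ih =>
    rw [xn_succ', Category.assoc, ih, Nat.add_right_comm, cap, cap, xn_succ', Category.assoc]

/-- The sums on the left are the candidates for the entries `e_j` of the inverse. In the application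
`g i` is the anticlockwise bubble with `-i - 1` dots. -/
theorem sum_cap (g : ℕ → ∀ Z : A, Z ⟶ Z) (i j : ℕ) (Z : A) :
    (-∑ b ∈ Finset.range n, g (j + b + 1) Z ≫ c' Z ≫ H.xn b _) ≫ H.cap i Z =
      -∑ b ∈ Finset.range n, g (j + b + 1) Z ≫ c' Z ≫ H.cap (b + i) Z := by
  simp only [Preadditive.neg_comp, Preadditive.sum_comp, Category.assoc, xn_cap]

theorem IsCup.sum_t (hc : H.IsCup n c') (g : ℕ → ∀ Z : A, Z ⟶ Z) (j : ℕ) (Z : A) :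
    (-∑ b ∈ Finset.range n, g (j + b + 1) Z ≫ c' Z ≫ H.xn b _) ≫ H.t Z = 0 := by
  simp only [Preadditive.neg_comp, Preadditive.sum_comp, Category.assoc]
  rw [Finset.sum_eq_zero, neg_zero]
  intro b hb
  rw [Finset.mem_range] at hb
  rw [hc.cup_xn_t hb.le, if_neg hb.ne, Limits.comp_zero]

/-- The crossing relations for nonnegative central charge determine the inverse of the column of
the inversion relation. -/
theorem isInverse_of_crossL (hc : H.IsCup n c') (hd : H.IsCap d') {g : ℕ → ∀ Z : A, Z ⟶ Z}
    (pos : ∀ Z, H.t Z ≫ H.crossL c' d' Z = 𝟙 _ + ∑ a ∈ Finset.range n, ∑ b ∈ Finset.range n,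
      H.cap a Z ≫ g (a + b + 1) Z ≫ c' Z ≫ H.xn b _)
    (neg : ∀ Z, H.crossL c' d' Z ≫ H.t Z = 𝟙 _)
    (hg : ∀ i < n, ∀ j < n, ∀ Z,
      ∑ b ∈ Finset.range n, g (j + b + 1) Z ≫ c' Z ≫ H.cap (b + i) Z = if i = j then -𝟙 _ else 0) :
    H.IsInverse n (H.crossL c' d')
      (fun j Z => -∑ b ∈ Finset.range n, g (j + b + 1) Z ≫ c' Z ≫ H.xn b _) where
  up_down Z := by
    rw [pos]
    simp only [Finset.sum_range, Preadditive.comp_neg, Preadditive.comp_sum,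
      Finset.sum_neg_distrib]
    abel
  down_up := neg
  e_t j Z := hc.sum_t _ _ Z
  inv_cap i Z := by rw [hc.crossL_cap hd i.2.le, if_neg i.2.ne]
  e_cap i j Z := by
    rw [sum_cap, hg i i.2 j j.2]
    simp only [Fin.ext_iff]
    split_ifs <;> simp

/-- Leftward cups and caps are determined by the inverse of the column of the inversion relation. -/
theorem IsInverse.crossL_eq (h : H.IsInverse n τ e) (hc : H.IsCup n c') (hd : H.IsCap d')
    (neg : ∀ Z, H.crossL c' d' Z ≫ H.t Z = 𝟙 _) (Z : A) : H.crossL c' d' Z = τ Z := by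
  apply h.hom_ext
  · rw [neg, h.down_up]
  · intro i hi
    rw [hc.crossL_cap hd hi.le, h.inv_cap ⟨i, hi⟩, if_neg hi.ne]

theorem IsInverse.cap_eq (h : H.IsInverse n τ e) (hc : H.IsCup n c') (hd : H.IsCap d')
    (neg : ∀ Z, H.crossL c' d' Z ≫ H.t Z = 𝟙 _) (Z : A) : d' Z = τ Z ≫ H.cap n Z := by
  rw [← h.crossL_eq hc hd neg, hc.crossL_cap hd le_rfl, if_pos rfl]

/-- The curl relation fixes the composite with `t` and the bubble relations fix those with the
dotted caps, which is all that `hom_ext` asks for. -/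
theorem IsInverse.cup_unique (h : H.IsInverse n τ e) {c₁ c₂ : ∀ Z : A, Z ⟶ H.U.obj (H.V.obj Z)}
    (h₁ : H.IsCup n c₁) (h₂ : H.IsCup n c₂) (Z : A) : c₁ Z = c₂ Z := by
  apply h.hom_ext
  · rw [h₁.cup_t, h₂.cup_t]
  · intro i hi
    rw [h₁.clock i hi, h₂.clock i hi]

/-- The leftward cup obtained from the inverse of the column. -/
theorem IsInverse.isCup (h : H.IsInverse n τ e)
    (hc' : ∀ Z, c' Z = (if n = 0 then H.c Z ≫ τ Z else 0) - ∑ i : Fin n, if (i : ℕ) + 1 = n then e i Z else 0)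
    (nat : ∀ {Z W : A} (f : Z ⟶ W), f ≫ c' W = c' Z ≫ H.U.map (H.V.map f)) : H.IsCup n c' := by
  -- For `n > 0` the formula reads `c' = -e_(n-1)`: up to sign, the entry dual to the last dotted
  -- cap. For `n = 0` the sum is empty.
  refine .of_cup_t nat (fun Z => ?_) fun r hr Z => ?_
  · have : ∀ i : Fin n, (if (i : ℕ) + 1 = n then e i Z else 0) ≫ H.t Z = 0 := fun i => by
      split_ifs <;> simp [h.e_t]
    rw [hc', Preadditive.sub_comp, Preadditive.sum_comp, Finset.sum_eq_zero fun i _ => this i]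
    split_ifs <;> simp [h.down_up]
  · have : ∀ i : Fin n, (if (i : ℕ) + 1 = n then e i Z else 0) ≫ H.cap r Z =
        if i = ⟨r, hr⟩ then (if r + 1 = n then 𝟙 _ else 0) else 0 := fun i => by
      have := h.e_cap ⟨r, hr⟩ i Z
      by_cases hi : i = ⟨r, hr⟩
      · subst hi; split_ifs <;> simp_all
      · rw [if_neg (Ne.symm hi)] at this
        split_ifs <;> simp_all
    rw [hc', Preadditive.sub_comp, Preadditive.sum_comp, Finset.sum_congr rfl fun i _ => this i,
      if_neg (by omega)]
    simp

/-- The relation between a leftward cup and the inverse of the column. -/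
theorem IsInverse.e_eq (h : H.IsInverse n τ e) (hc : H.IsCup n c') {g : ℕ → ∀ Z : A, Z ⟶ Z}
    (hg : ∀ i < n, ∀ j < n, ∀ Z,
      ∑ b ∈ Finset.range n, g (j + b + 1) Z ≫ c' Z ≫ H.cap (b + i) Z = if i = j then -𝟙 _ else 0)
    (j : Fin n) (Z : A) :
    e j Z = -∑ b ∈ Finset.range n, g (j + b + 1) Z ≫ c' Z ≫ H.xn b _ := by
  apply h.hom_ext
  · rw [h.e_t, hc.sum_t]
  · intro i hi
    rw [h.e_cap ⟨i, hi⟩, sum_cap, hg i hi j j.2]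
    simp only [Fin.ext_iff]
    split_ifs <;> simp

section LeftAdjunction

variable (h : H.IsInverse n τ e) (hc : H.IsCup n c')
include hc

/-- As `down` is the mate of `t`, the left side is a dotted leftward cup followed by `t` and a cap;
`cup_xn_t` leaves nothing, or a zigzag when `j = n`. -/
theorem IsCup.twist_cap {j : ℕ} (hj : j ≤ n) (Z : A) :
    c' (H.V.obj Z) ≫ H.U.map (H.down Z) ≫ H.cap j (H.V.obj Z) = if j = n then 𝟙 _ else 0 := by
  rw [map_down_cap, reassoc_of% hc.cup_xn_t hj]
  split_ifs
  · exact H.adj_down Z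
  · simp

/-- A dot passing `t` leaves the error term `d ≫ c`, whose cap closes up to a `twist_cap` with fewer
than `n` dots, hence to zero. -/
theorem IsCup.twist_xn_t {j : ℕ} (hj : j ≤ n) (Z : A) :
    c' (H.V.obj Z) ≫ H.U.map (H.down Z) ≫ H.xn j _ ≫ H.t _ =
      c' (H.V.obj Z) ≫ H.U.map (H.down Z) ≫ H.t _ ≫ H.V.map (H.xn j _) := by
  induction j with
  | zero => simp
  | succ j ih =>
    have h1 := hc.twist_cap (j := j) (by omega) Z
    rw [if_neg (by omega), cap] at h1
    have h2 : H.x _ ≫ H.t (H.V.obj Z) = H.t _ ≫ H.V.map (H.x _) - H.d _ ≫ H.c _ := H.x_t _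
    rw [H.xn_succ j (H.V.obj (H.V.obj Z)), H.xn_succ j (H.V.obj Z), Functor.map_comp,
      ← reassoc_of% (ih (by omega)), Category.assoc, h2]
    simp only [Preadditive.comp_sub]
    rw [reassoc_of% h1, Limits.zero_comp, sub_zero]

include h

/-- The leftward cup can be pulled across a downward strand. The inversion relation is what makes
this provable without a left adjunction: it suffices to compare after `V` applied to `t` and to the
dotted caps. -/
theorem IsInverse.twist_t (Z : A) :
    c' (H.V.obj Z) ≫ H.U.map (H.down Z) ≫ H.t _ = H.V.map (c' Z) := by
  apply h.map_hom_ext H.V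
  · rw [Category.assoc, Category.assoc, ← H.braid_down, reassoc_of% hc.cup_t, ← Functor.map_comp,
      hc.cup_t]
    split_ifs
    · rw [reassoc_of% H.c_map_t, H.down_down, Category.comp_id]
    · simp
  · intro i hi
    have h1 := hc.twist_xn_t hi.le Z
    have h2 := congrArg H.U.map (H.down_down Z)
    rw [Functor.map_comp] at h2
    -- With the dots moved back below `t`, the mate identity `map_down_d` produces a second downward
    -- crossing, which cancels the one already there. Bubbles remain on both sides.
    rw [cap, Functor.map_comp, Category.assoc, Category.assoc, ← reassoc_of% h1, ← map_down_d,
      ← reassoc_of% H.xn_nat, reassoc_of% h2, CategoryTheory.Functor.map_id, Category.id_comp,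
      ← Functor.map_comp, ← Functor.map_comp, ← cap, ← cap, hc.clock i hi, hc.clock i hi]
    split_ifs <;> simp

end LeftAdjunction

/-- The error terms form the divided difference of the `i`-th power in the dots on the two strands.
-/
theorem s_xn (i : ℕ) (Z : A) :
    H.s Z ≫ H.xn i _ = H.U.map (H.xn i Z) ≫ H.s Z +
      ∑ a ∈ Finset.range i, H.U.map (H.xn (i - 1 - a) Z) ≫ H.xn a _ := by
  induction i with
  | zero => simp
  | succ i ih =>
    rw [xn_succ, reassoc_of% ih, Preadditive.add_comp, Category.assoc, H.s_x, Finset.sum_range_succ',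
      Preadditive.sum_comp, xn_succ]
    simp only [Preadditive.comp_add, Functor.map_comp, Category.assoc, Category.comp_id, xn_zero,
      xn_succ, Nat.add_sub_cancel, Nat.sub_zero, Nat.sub_add_eq, Nat.sub_right_comm _ _ 1]
    abel

/-- Reindexing by `i = a + b + 1`; the part of the square outside the triangle contributes nothing
by `hf`. -/
theorem sum_range_triangle {M : Type*} [AddCommMonoid M] (n : ℕ) (f : ℕ → ℕ → M)
    (hf : ∀ a b, n ≤ a + b → f a b = 0) :
    ∑ i ∈ Finset.range (n + 1), ∑ a ∈ Finset.range i, f a (i - 1 - a) =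
      ∑ a ∈ Finset.range n, ∑ b ∈ Finset.range n, f a b := by
  rw [Finset.sum_comm' (t' := Finset.range n) (s' := fun a => Finset.Ico (a + 1) (n + 1))
    (by intro x y; simp only [Finset.mem_range, Finset.mem_Ico]; omega)]
  refine Finset.sum_congr rfl fun a ha => ?_
  rw [Finset.sum_Ico_eq_sum_range]
  have : ∀ b, a + 1 + b - 1 - a = b := by omega
  simp only [this]
  apply Finset.sum_subset
  · intro b; simp only [Finset.mem_range]; omega
  · intro b; simp only [Finset.mem_range]; intro _ _; exact hf _ _ (by omega)

/-- The leftward crossing formed from the leftward cup and cap of the inverse of the column is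
the inverse of the rightward crossing. -/
theorem IsInverse.crossL_eq_inv (h : H.IsInverse n τ e) (hc : H.IsCup n c')
    (hd' : ∀ Z, d' Z = τ Z ≫ H.cap n Z) {g : ℕ → ∀ Z : A, Z ⟶ Z}
    (g_nat : ∀ i ⦃Z W : A⦄ (f : Z ⟶ W), f ≫ g i W = g i Z ≫ f)
    (g_top : ∀ Z, g n Z = 𝟙 Z) (g_zero : ∀ i > n, ∀ Z, g i Z = 0)
    (hg : ∀ i < n, ∀ j < n, ∀ Z,
      ∑ b ∈ Finset.range n, g (j + b + 1) Z ≫ c' Z ≫ H.cap (b + i) Z = if i = j then -𝟙 _ else 0)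
    (hg' : ∀ j < n, 1 ≤ j → ∀ Z,
      ∑ b ∈ Finset.range n, g (j + b + 1) Z ≫ c' Z ≫ H.cap (b + n) Z = g j Z) (Z : A) :
    H.crossL c' d' Z = τ Z := by
  -- `d'` begins with `τ`, and the inversion relation expresses `t ≫ τ` as the identity minus the
  -- dotted cap terms.
  have td (W : A) : H.t W ≫ d' W = H.cap n W - ∑ i : Fin n, H.cap i W ≫ e i W ≫ H.cap n W := by
    have := h.up_down W
    rw [hd', ← Category.assoc, eq_sub_of_add_eq this, Preadditive.sub_comp, Preadditive.sum_comp,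
      Category.id_comp]
    simp only [Category.assoc]
  -- the rightward crossing followed by a dotted cap on the right
  have key (i : ℕ) (hi : i ≤ n) : H.U.map (c' (H.V.obj Z)) ≫ H.U.map (H.U.map (H.down Z)) ≫
      H.s _ ≫ H.U.map (H.t _) ≫ H.cap i _ = (if i = n then 𝟙 _ else 0) +
        ∑ a ∈ Finset.range i, H.cap a Z ≫ c' Z ≫ H.xn (i - 1 - a) _ := by
    rw [map_t_cap, reassoc_of% s_xn, Preadditive.add_comp, Category.assoc, reassoc_of% H.s_s,
      ← Functor.map_comp, ← cap, Preadditive.comp_add, Preadditive.comp_add, ← Functor.map_comp,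
      ← Functor.map_comp, hc.twist_cap hi]
    congr 1
    · split_ifs <;> simp
    · rw [Preadditive.sum_comp, Preadditive.comp_sum, Preadditive.comp_sum]
      refine Finset.sum_congr rfl fun a ha => ?_
      rw [Finset.mem_range] at ha
      have e1 := congrArg H.U.map (hc.twist_xn_t (j := i - 1 - a) (by omega) Z)
      have e2 := congrArg H.U.map (h.twist_t hc Z)
      simp only [Functor.map_comp] at e1 e2
      -- `map_t_d` replaces the remaining `s` and cap by `t` and a cap, so that the two twist
      -- identities apply under `U`; the cap then slides off by naturality.
      rw [Category.assoc, ← H.map_t_d, ← reassoc_of% H.xn_nat a, reassoc_of% e1, reassoc_of% e2,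
        ← cap, H.cap_nat, reassoc_of% H.cap_nat]
  have e_cap (i : Fin n) (hi : 1 ≤ (i : ℕ)) (W : A) : e i W ≫ H.cap n W = -g i W := by
    rw [h.e_eq hc hg, sum_cap, hg' i i.2 hi]
  have main : H.t Z ≫ H.crossL c' d' Z = H.t Z ≫ τ Z := by
    rw [eq_sub_of_add_eq (h.up_down Z)]
    -- The cup inside `crossL` is replaced by its twisted form, and `braid_t` moves the upward
    -- crossing so that `t ≫ d'` stands at the end, ready for `td`.
    have e1 : H.t Z ≫ H.crossL c' d' Z = H.U.map (c' (H.V.obj Z)) ≫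
        H.U.map (H.U.map (H.down Z)) ≫ H.s _ ≫ H.U.map (H.t _) ≫ H.t _ ≫ d' _ := by
      have e2 := congrArg H.U.map (h.twist_t hc Z)
      simp only [Functor.map_comp] at e2
      rw [← reassoc_of% H.braid_t, reassoc_of% e2, reassoc_of% H.t_nat, crossL]
    -- The summand `i = n` comes from the leading term of `td`, where `g n` is the identity. The
    -- summands `i < n` come from its corrections, where `e_cap` supplies `g i`.
    have e3 : H.t Z ≫ H.crossL c' d' Z = 𝟙 _ + ∑ i ∈ Finset.range (n + 1),
        ∑ a ∈ Finset.range i, H.cap a Z ≫ g (a + (i - 1 - a) + 1) Z ≫ c' Z ≫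
          H.xn (i - 1 - a) _ := by
      have e4 : ∀ i, ∑ a ∈ Finset.range i, H.cap a Z ≫ g (a + (i - 1 - a) + 1) Z ≫ c' Z ≫
          H.xn (i - 1 - a) _ = (∑ a ∈ Finset.range i, H.cap a Z ≫ c' Z ≫ H.xn (i - 1 - a) _) ≫
            g i _ := by
        intro i
        rw [Preadditive.sum_comp]
        refine Finset.sum_congr rfl fun a ha => ?_
        rw [Finset.mem_range] at ha
        have := g_nat i (c' Z ≫ H.xn (i - 1 - a) _)
        rw [Category.assoc] at this
        rw [Category.assoc, Category.assoc, this, show a + (i - 1 - a) + 1 = i by omega]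
      simp only [e4]
      rw [e1, td, Finset.sum_range_succ, g_top, Category.comp_id]
      simp only [Preadditive.comp_sub]
      rw [key n le_rfl, if_pos rfl, add_comm (∑ _ ∈ _, _), ← add_assoc, sub_eq_add_neg]
      congr 1
      simp only [Preadditive.comp_sum, Finset.sum_range (n := n), ← Finset.sum_neg_distrib]
      refine Finset.sum_congr rfl fun i _ => ?_
      have := key i i.2.le
      rw [if_neg i.2.ne, zero_add] at this
      rw [reassoc_of% this]
      -- `e_cap` says nothing at index `0`, but there the inner sum is empty.
      rcases Nat.eq_zero_or_pos (i : ℕ) with hi | hi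
      · simp [hi]
      · rw [e_cap i hi, Preadditive.comp_neg, neg_neg]
    rw [e3, sum_range_triangle n (fun a b => H.cap a Z ≫ g (a + b + 1) Z ≫ c' Z ≫ H.xn b _)
      (fun a b hab => by rw [g_zero _ (by omega)]; simp), sub_eq_add_neg]
    simp only [h.e_eq hc hg, Preadditive.comp_neg, Preadditive.comp_sum, Finset.sum_neg_distrib,
      neg_neg, Finset.sum_range]
  -- `τ ≫ t` is the identity, so `t` can be cancelled on the left of `main`.
  rw [← Category.id_comp (H.crossL c' d' Z), ← h.down_up, Category.assoc, main, reassoc_of% h.down_up]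

theorem IsInverse.pos (h : H.IsInverse n τ e) (hc : H.IsCup n c') {g : ℕ → ∀ Z : A, Z ⟶ Z}
    (hg : ∀ i < n, ∀ j < n, ∀ Z,
      ∑ b ∈ Finset.range n, g (j + b + 1) Z ≫ c' Z ≫ H.cap (b + i) Z = if i = j then -𝟙 _ else 0)
    (Z : A) : H.t Z ≫ τ Z = 𝟙 _ + ∑ a ∈ Finset.range n, ∑ b ∈ Finset.range n,
      H.cap a Z ≫ g (a + b + 1) Z ≫ c' Z ≫ H.xn b _ := by
  rw [eq_sub_of_add_eq (h.up_down Z), sub_eq_add_neg]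
  simp only [h.e_eq hc hg, Preadditive.comp_neg, Preadditive.comp_sum, Finset.sum_neg_distrib,
    neg_neg, Finset.sum_range]

/-- The left curl for central charge zero. -/
theorem IsInverse.curlL {e : Fin 0 → ∀ Z : A, Z ⟶ H.U.obj (H.V.obj Z)} (h : H.IsInverse 0 τ e)
    (hd : H.IsCap d') (hd' : ∀ Z, d' Z = τ Z ≫ H.cap 0 Z) (Z : A) :
    H.c _ ≫ H.V.map (H.s Z) ≫ d' _ = 𝟙 (H.U.obj Z) := by
  have h1 : H.t (H.U.obj Z) ≫ d' _ = H.d _ := by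
    have := h.up_down (H.U.obj Z)
    rw [Finset.univ_eq_empty, Finset.sum_empty, add_zero] at this
    rw [hd', reassoc_of% this, cap_zero]
  have h2 : H.t (H.U.obj Z) ≫ d' _ = (H.c _ ≫ H.V.map (H.s _) ≫ d' _) ≫ H.d _ := by
    rw [t, Category.assoc, Category.assoc, Category.assoc, Category.assoc, hd (H.d _)]
  -- A zigzag inserted above the curl lets the curl be followed by `d`, where it can be traded for
  -- `t ≫ d'`.
  have h3 : H.c _ ≫ H.V.map (H.s Z) ≫ d' _ = H.U.map (H.c Z) ≫
      (H.c _ ≫ H.V.map (H.s _) ≫ d' _) ≫ H.d _ := by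
    rw [Category.assoc, Category.assoc, reassoc_of% H.c_nat,
      reassoc_of% H.V.map_square (H.s_nat (H.c Z)), reassoc_of% hd (H.U.map (H.c Z)), H.adj_up,
      Category.comp_id]
  rw [h3, ← h2, h1, H.adj_up]

end HeisAction

/-! ## Toeplitz determinants and inverse power series -/

section Toeplitz

variable {B : Type u} [CommRing B]

open Finset

/-- The coefficients of the inverse of a power series with constant coefficient one are Toeplitz
determinants. -/
theorem coeff_inv_eq_det (p q : ℕ → B) (hp : p 0 = 1)
    (hpq : ∀ N, ∑ m ∈ antidiagonal N, p m.1 * q m.2 = if N = 0 then 1 else 0) (r : ℕ) :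
    q r = Matrix.det (Matrix.of fun a b : Fin r =>
      if (b : ℕ) ≤ a + 1 then -p (a + 1 - b) else 0) := by
  -- Lower triangular Toeplitz matrices multiply like truncated power series, so `Q` is the inverse
  -- of `L`. Its bottom left entry `q r` is a signed minor of `L` by Cramer's rule, as `det L = 1`.
  let L : Matrix (Fin (r + 1)) (Fin (r + 1)) B :=
    Matrix.of fun a b => if (b : ℕ) ≤ a then p (a - b) else 0
  let Q : Matrix (Fin (r + 1)) (Fin (r + 1)) B :=
    Matrix.of fun a b => if (b : ℕ) ≤ a then q (a - b) else 0
  have hdet : L.det = 1 := by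
    rw [Matrix.det_of_isLowerTriangular (M := L)]
    · simp [L, hp]
    · intro a b hab
      have : ¬ ((b : ℕ) ≤ a) := by simpa using hab
      exact if_neg this
  have hLQ : L * Q = 1 := by
    ext a b
    rw [Matrix.mul_apply, Matrix.one_apply]
    have h1 : ∀ j : Fin (r + 1), L a j * Q j b =
        if (b : ℕ) ≤ j ∧ (j : ℕ) ≤ a then p (a - j) * q (j - b) else 0 := by
      intro j
      simp only [L, Q, Matrix.of_apply]
      split_ifs <;> first | omega | simp
    simp only [h1]
    rw [← Finset.sum_range (fun j : ℕ => if (b : ℕ) ≤ j ∧ j ≤ a then p (a - j) * q (j - b) else 0),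
      ← Finset.sum_filter]
    by_cases hab : (b : ℕ) ≤ a
    · have := hpq (a - b)
      rw [← Finset.sum_nbij' (s := {j ∈ range (r + 1) | (b : ℕ) ≤ j ∧ j ≤ a})
        (fun j : ℕ => ((a : ℕ) - j, j - (b : ℕ))) (fun m => m.2 + b)
        (f := fun j : ℕ => p (a - j) * q (j - b))] at this
      · rw [this]
        have : ((a : ℕ) - b = 0) ↔ a = b := by rw [Fin.ext_iff]; omega
        simp only [this]
      · intro j hj
        simp only [mem_filter, mem_range] at hj
        simp only [HasAntidiagonal.mem_antidiagonal]; omega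
      · intro m hm
        simp only [HasAntidiagonal.mem_antidiagonal] at hm
        simp only [mem_filter, mem_range]
        have := a.2; omega
      · intro j hj
        simp only [mem_filter, mem_range] at hj
        omega
      · intro m hm
        simp only [HasAntidiagonal.mem_antidiagonal] at hm
        ext <;> simp only <;> omega
      · intro j hj; rfl
    · rw [Finset.filter_false_of_mem (by intro j _; omega), Finset.sum_empty, if_neg]
      rintro rfl; exact hab le_rfl
  have hQ : L.adjugate = Q := by
    have := Matrix.adjugate_mul L
    calc L.adjugate = L.adjugate * (L * Q) := by rw [hLQ, Matrix.mul_one]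
      _ = Q := by rw [← Matrix.mul_assoc, Matrix.adjugate_mul, hdet, one_smul, Matrix.one_mul]
  have h2 : q r = L.adjugate (Fin.last r) 0 := by
    rw [hQ]; simp [Q]
  rw [h2, Matrix.adjugate_fin_succ_eq_det_submatrix]
  -- The cofactor sign is absorbed by negating the `r × r` matrix.
  have h3 : (-1 : B) ^ r = (-1 : B) ^ Fintype.card (Fin r) := by rw [Fintype.card_fin]
  simp only [Fin.val_zero, Fin.val_last, zero_add]
  rw [h3, ← Matrix.det_neg]
  congr 1
  ext a b
  simp only [L, Matrix.neg_apply, Matrix.submatrix_apply, Matrix.of_apply, Fin.succAbove_last,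
    Fin.zero_succAbove, Fin.val_succ, Fin.val_castSucc]
  split_ifs <;> simp

/-- The determinants that define bubbles with a negative number of dots. -/
def bubbleDet (P : ℕ → B) (n r : ℕ) : B :=
  Matrix.det (Matrix.of fun a b : Fin r => P ((a : ℤ) - (b : ℤ) + n).toNat)

variable {P : ℕ → B} {n : ℕ} (hP : ∀ r < n, P r = -(if r + 1 = n then 1 else 0))

include hP

/-- The series with coefficients `-P (n - 1 + m)` has constant term one because `P (n - 1) = -1`,
and `q` is its inverse. The bound `r ≤ n` keeps every index `a - b + n` positive, so that `toNat`
truncates nothing. -/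
theorem exists_bubbleDet_eq (hn : 0 < n) : ∃ q : ℕ → B, (∀ r ≤ n, bubbleDet P n r = q r) ∧
    ∀ N, ∑ m ∈ antidiagonal N, P (n - 1 + m.1) * q m.2 = if N = 0 then -1 else 0 := by
  have hp : -P (n - 1) = 1 := by rw [hP _ (by omega), if_pos (by omega), neg_neg]
  let p : PowerSeries B := PowerSeries.mk fun m => -P (n - 1 + m)
  have h1 : p * PowerSeries.invOfUnit p 1 = 1 :=
    PowerSeries.mul_invOfUnit p 1 (by simpa [p] using hp)
  have h2 : ∀ N, ∑ m ∈ antidiagonal N,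
      (-P (n - 1 + m.1)) * PowerSeries.coeff m.2 (PowerSeries.invOfUnit p 1) =
        if N = 0 then 1 else 0 := by
    intro N
    have := congrArg (PowerSeries.coeff N) h1
    rw [PowerSeries.coeff_mul, PowerSeries.coeff_one] at this
    simpa [p] using this
  refine ⟨fun m => PowerSeries.coeff m (PowerSeries.invOfUnit p 1), fun r hr => ?_, fun N => ?_⟩
  · refine Eq.trans ?_ (coeff_inv_eq_det (fun m => -P (n - 1 + m))
      (fun m => PowerSeries.coeff m (PowerSeries.invOfUnit p 1)) hp h2 r).symm
    rw [bubbleDet]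
    congr 1
    ext a b
    have ha := a.2
    have hb := b.2
    simp only [Matrix.of_apply, neg_neg]
    split_ifs with hab
    · congr 1; omega
    -- Beyond the superdiagonal the index is below `n - 1`, where `P` vanishes.
    · rw [hP _ (by omega), if_neg (by omega), neg_zero]
  · have := congrArg Neg.neg (h2 N)
    rw [← Finset.sum_neg_distrib] at this
    rw [apply_ite Neg.neg, neg_zero] at this
    simpa using this

/-- The infinite Grassmannian relation: this is the coefficient of degree `i - j` in the product of
the series with its inverse, negated. The remaining terms vanish, either because `P` is zero below
`n - 1` or because the second factor is zero. -/
theorem bubbleDet_grassmannian {i j : ℕ} (hi : i < n) (hj : j < n) :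
    ∑ b ∈ range n, P (b + i) * (if j + b + 1 ≤ n then bubbleDet P n (n - (j + b + 1)) else 0) =
      if i = j then -1 else 0 := by
  obtain ⟨q, hq, hpq⟩ := exists_bubbleDet_eq hP (by omega)
  have h1 : ∀ b ∈ range n, P (b + i) * (if j + b + 1 ≤ n then bubbleDet P n (n - (j + b + 1)) else 0) =
      if n ≤ b + i + 1 ∧ j + b + 1 ≤ n then P (b + i) * q (n - (j + b + 1)) else 0 := by
    intro b hb
    by_cases h : n ≤ b + i + 1
    · by_cases h' : j + b + 1 ≤ n
      · rw [if_pos h', if_pos ⟨h, h'⟩, hq _ (by omega)]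
      · rw [if_neg h', if_neg (by omega), mul_zero]
    · rw [if_neg (fun H => h H.1 : ¬ (n ≤ b + i + 1 ∧ j + b + 1 ≤ n)), hP _ (by omega), if_neg (by omega : ¬ b + i + 1 = n), neg_zero,
        zero_mul]
  rw [Finset.sum_congr rfl h1, ← Finset.sum_filter]
  by_cases hij : j ≤ i
  · have := hpq (i - j)
    rw [← Finset.sum_nbij' (s := {b ∈ range n | n ≤ b + i + 1 ∧ j + b + 1 ≤ n})
        (fun b : ℕ => (b + i + 1 - n, n - (j + b + 1))) (fun m => n - 1 + m.1 - i)
        (f := fun b : ℕ => P (b + i) * q (n - (j + b + 1)))] at this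
    · rw [this]
      have : (i - j = 0) ↔ i = j := by omega
      simp only [this]
    · intro b hb
      simp only [mem_filter, mem_range] at hb
      simp only [HasAntidiagonal.mem_antidiagonal]; omega
    · intro m hm
      simp only [HasAntidiagonal.mem_antidiagonal] at hm
      simp only [mem_filter, mem_range]; omega
    · intro b hb
      simp only [mem_filter, mem_range] at hb
      simp only; omega
    · intro m hm
      simp only [HasAntidiagonal.mem_antidiagonal] at hm
      ext <;> simp only <;> omega
    · intro b hb
      simp only [mem_filter, mem_range] at hb
      simp only
      congr 2; omega
  · rw [Finset.filter_false_of_mem (by intro b _; omega), Finset.sum_empty, if_neg (by omega)]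

/-- The Grassmannian relation at `(n - 1, j - 1)`, solved for its term `b = 0`, whose coefficient `P
(n - 1)` is `-1`. -/
theorem bubbleDet_recursion {j : ℕ} (hj : j < n) (hj' : 1 ≤ j) :
    ∑ b ∈ range n, P (b + n) * (if j + b + 1 ≤ n then bubbleDet P n (n - (j + b + 1)) else 0) =
      bubbleDet P n (n - j) := by
  have h := bubbleDet_grassmannian hP (i := n - 1) (j := j - 1) (by omega) (by omega)
  obtain ⟨m, rfl⟩ : ∃ m, n = m + 1 := ⟨n - 1, by omega⟩
  rw [Finset.sum_range_succ', if_neg (by omega : ¬ m + 1 - 1 = j - 1), hP _ (by omega),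
    if_pos (by omega : 0 + (m + 1 - 1) + 1 = m + 1), if_pos (by omega : j - 1 + 0 + 1 ≤ m + 1)] at h
  rw [Finset.sum_range_succ, if_neg (by omega : ¬ (j + m + 1 ≤ m + 1)), mul_zero, add_zero]
  have e : m + 1 - (j - 1 + 0 + 1) = m + 1 - j := by omega
  rw [e, neg_one_mul, ← sub_eq_add_neg, sub_eq_zero] at h
  rw [← h]
  refine Finset.sum_congr rfl fun b _ => ?_
  rw [show b + (m + 1) = b + 1 + (m + 1 - 1) by omega,
    show j - 1 + (b + 1) + 1 = j + b + 1 by omega]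

end Toeplitz

/-! ### The action of a monoidal category on itself by tensoring on the left -/

section LeftTensor

variable {C : Type u} [Category.{v} C] [MonoidalCategory C]

/-! Morphisms between words of length at most two, tensored with an object on the right. -/

def leftCross {X Y X' Y' : C} (f : X ⊗ Y ⟶ X' ⊗ Y') (Z : C) : X ⊗ Y ⊗ Z ⟶ X' ⊗ Y' ⊗ Z :=
  (α_ _ _ _).inv ≫ f ▷ Z ≫ (α_ _ _ _).hom

def leftCup {X Y : C} (f : 𝟙_ C ⟶ X ⊗ Y) (Z : C) : Z ⟶ X ⊗ Y ⊗ Z :=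
  (λ_ _).inv ≫ f ▷ Z ≫ (α_ _ _ _).hom

def leftCap {X Y : C} (f : X ⊗ Y ⟶ 𝟙_ C) (Z : C) : X ⊗ Y ⊗ Z ⟶ Z :=
  (α_ _ _ _).inv ≫ f ▷ Z ≫ (λ_ _).hom

def leftUnit (f : 𝟙_ C ⟶ 𝟙_ C) (Z : C) : Z ⟶ Z :=
  (λ_ _).inv ≫ f ▷ Z ≫ (λ_ _).hom

/-- The component of the action at the unit object recovers the morphism. Hence relations can be
proved in the action and read back in the category. -/
theorem whiskerRight_injective {X Y : C} {f g : X ⟶ Y} (h : f ▷ 𝟙_ C = g ▷ 𝟙_ C) : f = g := by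
  simpa using h

theorem leftCross_ext {X Y X' Y' : C} {f g : X ⊗ Y ⟶ X' ⊗ Y'}
    (h : ∀ Z, leftCross f Z = leftCross g Z) : f = g :=
  whiskerRight_injective (by simpa [leftCross] using h (𝟙_ C))

theorem leftCup_ext {X Y : C} {f g : 𝟙_ C ⟶ X ⊗ Y} (h : ∀ Z, leftCup f Z = leftCup g Z) : f = g :=
  whiskerRight_injective (by simpa [leftCup] using h (𝟙_ C))

theorem leftCap_ext {X Y : C} {f g : X ⊗ Y ⟶ 𝟙_ C} (h : ∀ Z, leftCap f Z = leftCap g Z) : f = g :=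
  whiskerRight_injective (by simpa [leftCap] using h (𝟙_ C))

theorem leftUnit_ext {f g : 𝟙_ C ⟶ 𝟙_ C} (h : ∀ Z, leftUnit f Z = leftUnit g Z) : f = g :=
  whiskerRight_injective (by simpa [leftUnit] using h (𝟙_ C))

theorem leftCross_id {X Y : C} (Z : C) : leftCross (𝟙 (X ⊗ Y)) Z = 𝟙 _ := by simp [leftCross]

theorem leftUnit_id (Z : C) : leftUnit (𝟙 (𝟙_ C)) Z = 𝟙 _ := by simp [leftUnit]

theorem leftCross_comp {X Y X' Y' X'' Y'' : C} (f : X ⊗ Y ⟶ X' ⊗ Y') (g : X' ⊗ Y' ⟶ X'' ⊗ Y'')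
    (Z : C) : leftCross (f ≫ g) Z = leftCross f Z ≫ leftCross g Z := by simp [leftCross]

theorem leftCup_comp_cross {X Y X' Y' : C} (f : 𝟙_ C ⟶ X ⊗ Y) (g : X ⊗ Y ⟶ X' ⊗ Y') (Z : C) :
    leftCup (f ≫ g) Z = leftCup f Z ≫ leftCross g Z := by simp [leftCross, leftCup]

theorem leftCross_comp_cap {X Y X' Y' : C} (f : X ⊗ Y ⟶ X' ⊗ Y') (g : X' ⊗ Y' ⟶ 𝟙_ C) (Z : C) :
    leftCap (f ≫ g) Z = leftCross f Z ≫ leftCap g Z := by simp [leftCross, leftCap]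

theorem leftCap_comp_cup {X Y X' Y' : C} (f : X ⊗ Y ⟶ 𝟙_ C) (g : 𝟙_ C ⟶ X' ⊗ Y') (Z : C) :
    leftCross (f ≫ g) Z = leftCap f Z ≫ leftCup g Z := by simp [leftCross, leftCap, leftCup]

theorem leftCup_comp_cap {X Y : C} (f : 𝟙_ C ⟶ X ⊗ Y) (g : X ⊗ Y ⟶ 𝟙_ C) (Z : C) :
    leftUnit (f ≫ g) Z = leftCup f Z ≫ leftCap g Z := by simp [leftUnit, leftCap, leftCup]

theorem leftUnit_comp_cup {X Y : C} (b : 𝟙_ C ⟶ 𝟙_ C) (f : 𝟙_ C ⟶ X ⊗ Y) (Z : C) :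
    leftCup (b ≫ f) Z = leftUnit b Z ≫ leftCup f Z := by simp [leftUnit, leftCup]

theorem leftUnit_comp (b b' : 𝟙_ C ⟶ 𝟙_ C) (Z : C) :
    leftUnit (b ≫ b') Z = leftUnit b Z ≫ leftUnit b' Z := by simp [leftUnit]

/-- The interchange law, read as naturality in the untouched object on the right. -/
theorem leftCup_nat {X Y : C} (f : 𝟙_ C ⟶ X ⊗ Y) {Z W : C} (h : Z ⟶ W) :
    h ≫ leftCup f W = leftCup f Z ≫ X ◁ Y ◁ h := by
  simp only [leftCup, Category.assoc]
  rw [← associator_naturality_right, ← whisker_exchange_assoc, leftUnitor_inv_naturality_assoc]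

theorem leftCap_nat {X Y : C} (f : X ⊗ Y ⟶ 𝟙_ C) {Z W : C} (h : Z ⟶ W) :
    X ◁ Y ◁ h ≫ leftCap f W = leftCap f Z ≫ h := by
  simp only [leftCap, Category.assoc]
  rw [associator_inv_naturality_right_assoc, whisker_exchange_assoc, leftUnitor_naturality]

theorem leftCross_nat {X Y X' Y' : C} (f : X ⊗ Y ⟶ X' ⊗ Y') {Z W : C} (h : Z ⟶ W) :
    X ◁ Y ◁ h ≫ leftCross f W = leftCross f Z ≫ X' ◁ Y' ◁ h := by
  simp only [leftCross, Category.assoc]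
  rw [associator_inv_naturality_right_assoc, whisker_exchange_assoc, associator_naturality_right]

theorem leftUnit_nat (b : 𝟙_ C ⟶ 𝟙_ C) {Z W : C} (h : Z ⟶ W) :
    h ≫ leftUnit b W = leftUnit b Z ≫ h := by
  simp only [leftUnit, Category.assoc]
  rw [← leftUnitor_naturality, ← whisker_exchange_assoc, leftUnitor_inv_naturality_assoc]

/-- A morphism factoring through the unit object leaves a gap into which the bubble can be moved;
there the two unitors agree. -/
theorem bubbleRight_eq {X Y : C} (f : X ⟶ 𝟙_ C) (g : 𝟙_ C ⟶ Y) (b : 𝟙_ C ⟶ 𝟙_ C) :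
    FullData.bubbleRight (f ≫ g) b = f ≫ b ≫ g := by
  have h : f ≫ b ≫ g = f ≫ (ρ_ (𝟙_ C)).inv ≫ (𝟙_ C ◁ b) ≫ (ρ_ (𝟙_ C)).hom ≫ g := by
    rw [← unitors_equal, ← unitors_inv_equal]
    simp
  rw [FullData.bubbleRight, MonoidalCategory.tensorHom_def, h, comp_whiskerRight, Category.assoc,
    Category.assoc, ← whisker_exchange_assoc, rightUnitor_naturality,
    ← rightUnitor_inv_naturality_assoc]

theorem bubbleLeft_eq {X Y : C} (f : X ⟶ 𝟙_ C) (g : 𝟙_ C ⟶ Y) (b : 𝟙_ C ⟶ 𝟙_ C) :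
    FullData.bubbleLeft b (f ≫ g) = f ≫ b ≫ g := by
  have h : f ≫ b ≫ g = f ≫ (λ_ (𝟙_ C)).inv ≫ (b ▷ 𝟙_ C) ≫ (λ_ (𝟙_ C)).hom ≫ g := by
    rw [unitors_equal, unitors_inv_equal]
    simp
  rw [FullData.bubbleLeft, MonoidalCategory.tensorHom_def', h, whiskerLeft_comp, Category.assoc,
    Category.assoc, whisker_exchange_assoc, leftUnitor_naturality,
    ← leftUnitor_inv_naturality_assoc]

variable [Preadditive C] [MonoidalPreadditive C]

theorem leftCross_add {X Y X' Y' : C} (f g : X ⊗ Y ⟶ X' ⊗ Y') (Z : C) :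
    leftCross (f + g) Z = leftCross f Z + leftCross g Z := by
  simp [leftCross, MonoidalPreadditive.add_whiskerRight]

theorem leftCross_sum {X Y X' Y' : C} {ι : Type*} (I : Finset ι) (f : ι → (X ⊗ Y ⟶ X' ⊗ Y')) (Z : C) :
    leftCross (∑ i ∈ I, f i) Z = ∑ i ∈ I, leftCross (f i) Z := by
  simp [leftCross, sum_whiskerRight, Preadditive.comp_sum, Preadditive.sum_comp]

theorem leftCup_sum {X Y : C} {ι : Type*} (I : Finset ι) (f : ι → (𝟙_ C ⟶ X ⊗ Y)) (Z : C) :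
    leftCup (∑ i ∈ I, f i) Z = ∑ i ∈ I, leftCup (f i) Z := by
  simp [leftCup, sum_whiskerRight, Preadditive.comp_sum, Preadditive.sum_comp]

theorem leftCup_zero {X Y : C} (Z : C) : leftCup (0 : 𝟙_ C ⟶ X ⊗ Y) Z = 0 := by
  simp [leftCup]

theorem leftCup_neg {X Y : C} (f : 𝟙_ C ⟶ X ⊗ Y) (Z : C) : leftCup (-f) Z = -leftCup f Z := by
  rw [eq_neg_iff_add_eq_zero]
  simp [leftCup, ← Preadditive.comp_add, ← Preadditive.add_comp,
    ← MonoidalPreadditive.add_whiskerRight]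

theorem leftCup_sub {X Y : C} (f g : 𝟙_ C ⟶ X ⊗ Y) (Z : C) :
    leftCup (f - g) Z = leftCup f Z - leftCup g Z := by
  rw [sub_eq_add_neg, sub_eq_add_neg, ← leftCup_neg]
  simp [leftCup, MonoidalPreadditive.add_whiskerRight]

theorem leftCap_zero {X Y : C} (Z : C) : leftCap (0 : X ⊗ Y ⟶ 𝟙_ C) Z = 0 := by
  simp [leftCap]

theorem leftUnit_zero (Z : C) : leftUnit (0 : 𝟙_ C ⟶ 𝟙_ C) Z = 0 := by
  simp [leftUnit]

theorem leftUnit_neg (f : 𝟙_ C ⟶ 𝟙_ C) (Z : C) : leftUnit (-f) Z = -leftUnit f Z := by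
  rw [eq_neg_iff_add_eq_zero]
  simp [leftUnit, ← Preadditive.comp_add, ← Preadditive.add_comp,
    ← MonoidalPreadditive.add_whiskerRight]

theorem leftUnit_sum {ι : Type*} (I : Finset ι) (f : ι → (𝟙_ C ⟶ 𝟙_ C)) (Z : C) :
    leftUnit (∑ i ∈ I, f i) Z = ∑ i ∈ I, leftUnit (f i) Z := by
  simp [leftUnit, sum_whiskerRight, Preadditive.comp_sum, Preadditive.sum_comp]

namespace RightData

/-- The degenerate Hecke relations and the right adjunction relations hold. -/
def IsBasic (D : RightData C) : Prop :=
  ∀ ⦃X Y : C⦄ (f g : X ⟶ Y), D.BasicRel f g → f = g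

/-- The inversion relation holds. -/
def IsInverse (D : RightData C) (k : ℤ) (τ : D.down ⊗ D.up ⟶ D.up ⊗ D.down)
    (e : Fin k.toNat → (𝟙_ C ⟶ D.up ⊗ D.down))
    (f : Fin (-k).toNat → (D.down ⊗ D.up ⟶ 𝟙_ C)) : Prop :=
  ∀ ⦃X Y : C⦄ (p q : X ⟶ Y), D.InversionRel k τ e f p q → p = q

variable {D : RightData C}

omit [MonoidalPreadditive C] in
theorem IsBasic.left_braid (hD : D.IsBasic) (Z : C) :
    leftCross D.s (D.up ⊗ Z) ≫ D.up ◁ leftCross D.s Z ≫ leftCross D.s (D.up ⊗ Z) =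
      D.up ◁ leftCross D.s Z ≫ leftCross D.s (D.up ⊗ Z) ≫ D.up ◁ leftCross D.s Z := by
  have h := congrArg (fun f => 𝟙 (D.up ⊗ D.up ⊗ D.up ⊗ Z) ⊗≫ f ▷ Z ⊗≫ 𝟙 (D.up ⊗ D.up ⊗ D.up ⊗ Z))
    (hD _ _ .braid)
  refine Eq.trans ?_ (h.trans ?_) <;> dsimp only [leftCross] <;> monoidal

omit [MonoidalPreadditive C] in
theorem IsBasic.left_adj_up (hD : D.IsBasic) (Z : C) :
    D.up ◁ leftCup D.c Z ≫ leftCap D.d (D.up ⊗ Z) = 𝟙 (D.up ⊗ Z) := by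
  have h := congrArg (fun f => 𝟙 (D.up ⊗ Z) ⊗≫ f ▷ Z ⊗≫ 𝟙 (D.up ⊗ Z)) (hD _ _ .adj_up)
  refine Eq.trans ?_ (h.trans ?_)
  · dsimp only [leftCup, leftCap]; monoidal
  · monoidal

omit [MonoidalPreadditive C] in
theorem IsBasic.left_adj_down (hD : D.IsBasic) (Z : C) :
    leftCup D.c (D.down ⊗ Z) ≫ D.down ◁ leftCap D.d Z = 𝟙 (D.down ⊗ Z) := by
  have h := congrArg (fun f => 𝟙 (D.down ⊗ Z) ⊗≫ f ▷ Z ⊗≫ 𝟙 (D.down ⊗ Z)) (hD _ _ .adj_down)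
  refine Eq.trans ?_ (h.trans ?_)
  · dsimp only [leftCup, leftCap]; monoidal
  · monoidal

variable (hD : D.IsBasic)

/-- Tensoring with the generating objects on the left. -/
def IsBasic.leftAction : HeisAction C where
  U := tensorLeft D.up
  V := tensorLeft D.down
  addU := inferInstance
  addV := inferInstance
  x Z := D.x ▷ Z
  s Z := leftCross D.s Z
  c Z := leftCup D.c Z
  d Z := leftCap D.d Z
  x_nat f := whisker_exchange _ _
  s_nat f := leftCross_nat _ _
  c_nat f := leftCup_nat _ _
  d_nat f := leftCap_nat _ _
  s_s Z := by
    rw [← leftCross_comp, hD _ _ .square, leftCross_id]; rfl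
  braid Z := hD.left_braid Z
  dot Z := by
    have h := congrArg (fun f => leftCross f Z) (sub_eq_iff_eq_add.1 (hD _ _ .dot))
    rw [leftCross_add, leftCross_id] at h
    refine sub_eq_iff_eq_add.2 (Eq.trans ?_ (h.trans (congrArg _ ?_))) <;> simp [leftCross]
  adj_up Z := hD.left_adj_up Z
  adj_down Z := hD.left_adj_down Z

theorem IsBasic.leftAction_t (Z : C) : hD.leftAction.t Z = leftCross D.crossR Z := by
  change leftCup D.c (D.up ⊗ D.down ⊗ Z) ≫ D.down ◁ leftCross D.s (D.down ⊗ Z) ≫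
    D.down ◁ D.up ◁ leftCap D.d Z = _
  dsimp only [leftCross, leftCup, leftCap, crossR]
  monoidal

theorem IsBasic.leftAction_xn (n : ℕ) (Z : C) : hD.leftAction.xn n Z = D.dots n ▷ Z := by
  induction n with
  | zero => exact (id_whiskerRight _ _).symm
  | succ n ih => rw [HeisAction.xn_succ, ih, dots, comp_whiskerRight]; rfl

theorem IsBasic.leftAction_cap (n : ℕ) (Z : C) :
    hD.leftAction.cap n Z = leftCap (D.capDots n) Z := by
  rw [HeisAction.cap, hD.leftAction_xn, capDots]
  change D.dots n ▷ (D.down ⊗ Z) ≫ leftCap D.d Z = _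
  simp [leftCap]

theorem IsBasic.leftCup_comp_xn (c' : 𝟙_ C ⟶ D.up ⊗ D.down) (n : ℕ) (Z : C) :
    leftCup c' Z ≫ hD.leftAction.xn n (D.down ⊗ Z) = leftCup (c' ≫ D.dots n ▷ D.down) Z := by
  rw [hD.leftAction_xn]
  change leftCup c' Z ≫ D.dots n ▷ (D.down ⊗ Z) = _
  simp [leftCup]

/-- Whiskering gives one direction and the component at the unit object the other. The family `f`
has empty index type, so it does not appear on the right. -/
theorem IsInverse_iff_of_nonneg {k : ℤ} (hk : 0 ≤ k) (τ : D.down ⊗ D.up ⟶ D.up ⊗ D.down)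
    (e : Fin k.toNat → (𝟙_ C ⟶ D.up ⊗ D.down)) (f : Fin (-k).toNat → (D.down ⊗ D.up ⟶ 𝟙_ C)) :
    D.IsInverse k τ e f ↔
      hD.leftAction.IsInverse k.toNat (leftCross τ) (fun i => leftCup (e i)) := by
  have hemp : IsEmpty (Fin (-k).toNat) := by
    rw [show (-k).toNat = 0 by omega]; infer_instance
  constructor
  · intro h
    refine ⟨fun Z => ?_, fun Z => ?_, fun i Z => ?_, fun i Z => ?_, fun i j Z => ?_⟩
    · simp only [hD.leftAction_t, hD.leftAction_cap]
      change leftCross D.crossR Z ≫ leftCross τ Z +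
        ∑ i : Fin k.toNat, leftCap (D.capDots i) Z ≫ leftCup (e i) Z = 𝟙 (D.up ⊗ D.down ⊗ Z)
      simp only [← leftCap_comp_cup]
      rw [← leftCross_comp, ← leftCross_sum, ← leftCross_add, h _ _ .up_down, leftCross_id]
    · have := h _ _ .down_up
      rw [Finset.univ_eq_empty, Finset.sum_empty, add_zero] at this
      rw [hD.leftAction_t]
      change leftCross τ Z ≫ leftCross D.crossR Z = 𝟙 (D.down ⊗ D.up ⊗ Z)
      rw [← leftCross_comp, this, leftCross_id]
    · rw [hD.leftAction_t]
      change leftCup (e i) Z ≫ leftCross D.crossR Z = 0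
      rw [← leftCup_comp_cross, h _ _ (.cInv_cross i), leftCup_zero]
    · rw [hD.leftAction_cap]
      change leftCross τ Z ≫ leftCap (D.capDots i) Z = 0
      rw [← leftCross_comp_cap, h _ _ (.tInv_cap i), leftCap_zero]
    · rw [hD.leftAction_cap]
      change leftCup (e j) Z ≫ leftCap (D.capDots i) Z = _
      rw [← leftCup_comp_cap, h _ _ (.cInv_cap i j)]
      split_ifs
      · exact leftUnit_id Z
      · exact leftUnit_zero Z
  · rintro h X Y p q (_ | _ | i | i | ⟨i, j⟩ | i | j | ⟨i, j⟩)
    · refine leftCross_ext fun Z => ?_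
      have := h.up_down Z
      simp only [hD.leftAction_t, hD.leftAction_cap] at this
      rw [leftCross_add, leftCross_comp, leftCross_sum, leftCross_id]
      simp only [leftCap_comp_cup]
      exact this
    · refine leftCross_ext fun Z => ?_
      have := h.down_up Z
      rw [hD.leftAction_t] at this
      rw [Finset.univ_eq_empty, Finset.sum_empty, add_zero, leftCross_comp, leftCross_id]
      exact this
    · refine leftCup_ext fun Z => ?_
      have := h.e_t i Z
      rw [hD.leftAction_t] at this
      rw [leftCup_comp_cross, leftCup_zero]
      exact this
    · refine leftCap_ext fun Z => ?_
      have := h.inv_cap i Z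
      rw [hD.leftAction_cap] at this
      rw [leftCross_comp_cap, leftCap_zero]
      exact this
    · refine leftUnit_ext fun Z => ?_
      have := h.e_cap i j Z
      rw [hD.leftAction_cap] at this
      rw [leftCup_comp_cap]
      refine this.trans ?_
      split_ifs
      · exact (leftUnit_id Z).symm
      · exact (leftUnit_zero Z).symm
    · exact hemp.elim i
    · exact hemp.elim j
    · exact hemp.elim i

end RightData

/-! ### Leftward cups, caps and bubbles under the left action -/

namespace FullData

variable (E : FullData C)

/-- All relations on leftward cups and caps hold. -/
def IsLeft (k : ℤ) : Prop :=
  ∀ ⦃X Y : C⦄ (f g : X ⟶ Y), E.LeftRel k f g → f = g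

variable {E} (hD : E.toRightData.IsBasic)

include hD

theorem leftAction_crossL (Z : C) :
    hD.leftAction.crossL (leftCup E.cupL) (leftCap E.capL) Z = leftCross E.crossL Z := by
  change E.down ◁ E.up ◁ leftCup E.cupL Z ≫ E.down ◁ leftCross E.s (E.down ⊗ Z) ≫
    leftCap E.capL (E.up ⊗ E.down ⊗ Z) = _
  dsimp only [leftCross, leftCup, leftCap, crossL]
  monoidal

theorem leftAction_curlR (Z : C) :
    hD.leftAction.U.map (leftCup E.cupL Z) ≫ hD.leftAction.s _ ≫
      hD.leftAction.U.map (hD.leftAction.d Z) = E.curlR ▷ Z := by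
  change E.up ◁ leftCup E.cupL Z ≫ leftCross E.s (E.down ⊗ Z) ≫ E.up ◁ leftCap E.d Z = _
  dsimp only [leftCross, leftCup, leftCap, curlR]
  monoidal

theorem leftAction_curlL (Z : C) :
    hD.leftAction.c _ ≫ hD.leftAction.V.map (hD.leftAction.s Z) ≫ leftCap E.capL (E.up ⊗ Z) =
      E.curlL ▷ Z := by
  change leftCup E.c (E.up ⊗ Z) ≫ E.down ◁ leftCross E.s Z ≫ leftCap E.capL (E.up ⊗ Z) = _
  dsimp only [leftCross, leftCup, leftCap, curlL]
  monoidal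

theorem leftAction_clockNat (n : ℕ) (Z : C) :
    leftCup E.cupL Z ≫ hD.leftAction.cap n Z = leftUnit (E.clockNat n) Z := by
  rw [hD.leftAction_cap]
  exact (leftCup_comp_cap _ _ Z).symm

end FullData

end LeftTensor

theorem RightData.IsBasic.leftCap_isCap {C : Type u} [Category.{v} C] [MonoidalCategory C]
    [Preadditive C] [MonoidalPreadditive C] {D : RightData C} (hD : D.IsBasic)
    (d' : D.down ⊗ D.up ⟶ 𝟙_ C) : hD.leftAction.IsCap (leftCap d') := fun _ _ f => leftCap_nat _ f

namespace FullData

variable {C : Type u} [Category.{v} C] [MonoidalCategory C] [Preadditive C] [MonoidalPreadditive C]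
variable {E : FullData C} {k : ℤ}

omit [MonoidalPreadditive C] in
theorem clock_natCast (r : ℕ) : E.clock k r = E.clockNat r := by
  rw [clock, if_pos (by omega), Int.toNat_natCast]

omit [MonoidalPreadditive C] in
/-- The anticlockwise bubbles with a negative number of dots, for nonnegative central charge. -/
theorem anti_neg (hk : 0 ≤ k) (i : ℕ) : E.anti k (-(i : ℤ) - 1) =
    if i ≤ k.toNat then bubbleDet E.clockNat k.toNat (k.toNat - i) else 0 := by
  obtain ⟨n, rfl⟩ := Int.eq_ofNat_of_zero_le hk
  rw [anti, if_neg (by omega), Int.toNat_natCast]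
  by_cases h : i ≤ n
  · rw [if_neg (by omega), if_pos h]
    have : (-(i : ℤ) - 1 + n + 1).toNat = n - i := by omega
    exact congrArg (bubbleDet E.clockNat n) this
  · rw [if_pos (by omega), if_neg h]

omit [MonoidalPreadditive C] in
theorem IsLeft.clockNat_eq (h : E.IsLeft k) (r : ℕ) (hr : r < k.toNat) :
    E.clockNat r = -(if r + 1 = k.toNat then 1 else 0) := by
  have := h _ _ (.clock r (by omega))
  rw [clock_natCast] at this
  rw [this]
  have e : ((r : ℤ) = k - 1) ↔ r + 1 = k.toNat := by omega
  simp only [e]; rfl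

section

variable (hP : ∀ r < k.toNat, E.clockNat r = -(if r + 1 = k.toNat then 1 else 0)) (hk : 0 ≤ k)
  (hD : E.toRightData.IsBasic)

include hP hk

/-- The Grassmannian relation in the form of the hypothesis `hg` of the results on actions, with the
anticlockwise bubble with `-i - 1` dots as `g i`. -/
theorem sum_anti_comp_clockNat {i j : ℕ} (hi : i < k.toNat) (hj : j < k.toNat) (Z : C) :
    ∑ b ∈ Finset.range k.toNat, leftUnit (E.anti k (-((j + b + 1 : ℕ) : ℤ) - 1)) Z ≫
      leftCup E.cupL Z ≫ hD.leftAction.cap (b + i) Z = if i = j then -𝟙 Z else 0 := by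
  have h := congrArg (fun f : End (𝟙_ C) => leftUnit f Z) (bubbleDet_grassmannian hP hi hj)
  simp only [← anti_neg hk] at h
  simp only [leftAction_clockNat]
  refine Eq.trans ?_ (h.trans ?_)
  · refine Eq.trans ?_ (leftUnit_sum _ _ _).symm
    refine Finset.sum_congr rfl fun b _ => ?_
    exact (leftUnit_comp _ _ Z).symm
  · split_ifs
    · exact (leftUnit_neg _ _).trans (congrArg _ (leftUnit_id Z))
    · exact leftUnit_zero Z

theorem sum_anti_comp_clockNat' {j : ℕ} (hj : j < k.toNat) (hj' : 1 ≤ j) (Z : C) :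
    ∑ b ∈ Finset.range k.toNat, leftUnit (E.anti k (-((j + b + 1 : ℕ) : ℤ) - 1)) Z ≫
      leftCup E.cupL Z ≫ hD.leftAction.cap (b + k.toNat) Z =
        leftUnit (E.anti k (-(j : ℤ) - 1)) Z := by
  have h := congrArg (fun f : End (𝟙_ C) => leftUnit f Z) (bubbleDet_recursion hP hj hj')
  simp only [← anti_neg hk] at h
  simp only [leftAction_clockNat]
  refine Eq.trans ?_ (h.trans ?_)
  · refine Eq.trans ?_ (leftUnit_sum _ _ _).symm
    refine Finset.sum_congr rfl fun b _ => ?_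
    exact (leftUnit_comp _ _ Z).symm
  · rw [anti_neg hk, if_pos hj.le]

end

section

variable (hk : 0 ≤ k) (hD : E.toRightData.IsBasic)

theorem leftCross_sum_bubbleRight (Z : C) :
    leftCross (∑ r ∈ Finset.range k.toNat, ∑ s ∈ Finset.range k.toNat,
      bubbleRight (E.capDots s ≫ E.cupLDots r) (E.anti k (-(r : ℤ) - (s : ℤ) - 2))) Z =
    ∑ a ∈ Finset.range k.toNat, ∑ b ∈ Finset.range k.toNat, leftCap (E.capDots a) Z ≫
      leftUnit (E.anti k (-((a + b + 1 : ℕ) : ℤ) - 1)) Z ≫ leftCup (E.cupLDots b) Z := by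
  rw [Finset.sum_comm, leftCross_sum]
  refine Finset.sum_congr rfl fun a _ => ?_
  rw [leftCross_sum]
  refine Finset.sum_congr rfl fun b _ => ?_
  rw [bubbleRight_eq, leftCap_comp_cup, leftUnit_comp_cup]
  congr 4
  push_cast; ring

include hk

theorem isLeft_of_nonneg (hc : hD.leftAction.IsCup k.toNat (leftCup E.cupL))
    (pos : ∀ Z, hD.leftAction.t Z ≫ leftCross E.crossL Z = 𝟙 _ + ∑ a ∈ Finset.range k.toNat,
      ∑ b ∈ Finset.range k.toNat, hD.leftAction.cap a Z ≫
        leftUnit (E.anti k (-((a + b + 1 : ℕ) : ℤ) - 1)) Z ≫ leftCup E.cupL Z ≫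
          hD.leftAction.xn b _)
    (neg : ∀ Z, leftCross E.crossL Z ≫ hD.leftAction.t Z = 𝟙 _)
    (curl : k = 0 → E.curlL = 𝟙 _) : E.IsLeft k := by
  have hk' : (-k).toNat = 0 := by omega
  rintro X Y p q (_ | _ | hk₁ | ⟨r, hr⟩ | hk₁ | ⟨r, hr⟩)
  · refine leftCross_ext fun Z => ?_
    have := pos Z
    simp only [hD.leftAction_t, hD.leftAction_cap] at this
    rw [leftCross_comp, leftCross_add, leftCross_id, leftCross_sum_bubbleRight]
    refine this.trans (congrArg _ ?_)
    refine Finset.sum_congr rfl fun a _ => Finset.sum_congr rfl fun b _ => ?_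
    exact congrArg _ (congrArg _ (hD.leftCup_comp_xn _ b Z))
  · refine leftCross_ext fun Z => ?_
    have := neg Z
    rw [hD.leftAction_t] at this
    rw [hk', Finset.range_zero, Finset.sum_empty, add_zero, leftCross_comp, leftCross_id]
    exact this
  · apply whiskerRight_injective
    refine ((leftAction_curlR hD _).symm.trans (hc.curl _)).trans ?_
    have : k.toNat = 0 ↔ k = 0 := by omega
    simp only [this]
    split_ifs
    · exact (id_whiskerRight _ _).symm
    · exact MonoidalPreadditive.zero_whiskerRight.symm
  · refine leftUnit_ext fun Z => ?_
    have := (leftAction_clockNat hD r Z).symm.trans (hc.clock r (by omega) Z)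
    rw [clock_natCast, this, leftUnit_neg]
    have e : ((r : ℤ) = k - 1) ↔ r + 1 = k.toNat := by omega
    simp only [e]
    split_ifs
    · rw [leftUnit_id]
    · rw [leftUnit_zero]
  · obtain rfl : k = 0 := by omega
    rw [if_pos rfl, curl rfl]
  · omega

theorem IsLeft.isCup (h : E.IsLeft k) : hD.leftAction.IsCup k.toNat (leftCup E.cupL) where
  nat f := leftCup_nat _ _
  curl Z := by
    refine (leftAction_curlR hD Z).trans ?_
    rw [h _ _ (.curlR hk)]
    have : k.toNat = 0 ↔ k = 0 := by omega
    simp only [this]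
    split_ifs
    · exact id_whiskerRight _ _
    · exact MonoidalPreadditive.zero_whiskerRight
  clock r hr Z := by
    refine (leftAction_clockNat hD r Z).trans ?_
    rw [h.clockNat_eq r hr]
    refine (leftUnit_neg _ _).trans (congrArg _ ?_)
    split_ifs
    · exact leftUnit_id Z
    · exact leftUnit_zero Z

theorem IsLeft.crossL_t (h : E.IsLeft k) (Z : C) :
    hD.leftAction.crossL (leftCup E.cupL) (leftCap E.capL) Z ≫ hD.leftAction.t Z = 𝟙 _ := by
  have hk' : (-k).toNat = 0 := by omega
  have := h _ _ .neg
  rw [hk', Finset.range_zero, Finset.sum_empty, add_zero] at this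
  rw [leftAction_crossL, hD.leftAction_t]
  refine (leftCross_comp _ _ Z).symm.trans ?_
  rw [this, leftCross_id]; rfl

omit hk in
theorem IsLeft.t_crossL (h : E.IsLeft k) (Z : C) :
    hD.leftAction.t Z ≫ hD.leftAction.crossL (leftCup E.cupL) (leftCap E.capL) Z =
      𝟙 _ + ∑ a ∈ Finset.range k.toNat,
      ∑ b ∈ Finset.range k.toNat, hD.leftAction.cap a Z ≫
        leftUnit (E.anti k (-((a + b + 1 : ℕ) : ℤ) - 1)) Z ≫ leftCup E.cupL Z ≫
          hD.leftAction.xn b _ := by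
  have := h _ _ .pos
  rw [leftAction_crossL, hD.leftAction_t]
  refine (leftCross_comp _ _ Z).symm.trans ?_
  rw [this, leftCross_add, leftCross_sum_bubbleRight, leftCross_id]
  refine congrArg _ ?_
  refine Finset.sum_congr rfl fun a _ => Finset.sum_congr rfl fun b _ => ?_
  rw [hD.leftAction_cap]
  exact congrArg _ (congrArg _ (hD.leftCup_comp_xn _ b Z).symm)

include hD

theorem IsLeft.exists_isInverse_of_nonneg (h : E.IsLeft k) :
    ∃ τ e f, E.toRightData.IsInverse k τ e f := by
  have := HeisAction.isInverse_of_crossL (h.isCup hk hD) (hD.leftCap_isCap E.capL)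
    (g := fun i Z => leftUnit (E.anti k (-(i : ℤ) - 1)) Z) (h.t_crossL hD) (h.crossL_t hk hD)
    (fun i hi j hj Z => sum_anti_comp_clockNat h.clockNat_eq hk hD hi hj Z)
  refine ⟨E.crossL, fun j => -∑ b ∈ Finset.range k.toNat,
    (E.anti k (-((j + b + 1 : ℕ) : ℤ) - 1) : 𝟙_ C ⟶ 𝟙_ C) ≫ E.cupLDots b, fun _ => 0,
    (RightData.IsInverse_iff_of_nonneg hD hk _ _ _).2 ?_⟩
  have h₁ : leftCross E.crossL = hD.leftAction.crossL (leftCup E.cupL) (leftCap E.capL) :=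
    funext fun Z => (leftAction_crossL hD Z).symm
  have h₂ : (fun j : Fin k.toNat => leftCup (-∑ b ∈ Finset.range k.toNat,
      (E.anti k (-((j + b + 1 : ℕ) : ℤ) - 1) : 𝟙_ C ⟶ 𝟙_ C) ≫ E.cupLDots b)) =
      fun (j : Fin k.toNat) Z => -∑ b ∈ Finset.range k.toNat,
        leftUnit (E.anti k (-((j + b + 1 : ℕ) : ℤ) - 1)) Z ≫ leftCup E.cupL Z ≫
          hD.leftAction.xn b _ := by
    funext j Z
    rw [leftCup_neg, leftCup_sum]
    refine congrArg _ (Finset.sum_congr rfl fun b _ => ?_)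
    rw [leftUnit_comp_cup]
    exact congrArg _ (hD.leftCup_comp_xn _ b Z).symm
  rw [h₁, h₂]
  exact this

end

end FullData

namespace RightData

variable {C : Type u} [Category.{v} C] [MonoidalCategory C] [Preadditive C] [MonoidalPreadditive C]
variable {D : RightData C} {k : ℤ} (hk : 0 ≤ k) (hD : D.IsBasic)
  {τ : D.down ⊗ D.up ⟶ D.up ⊗ D.down}
  {e : Fin k.toNat → (𝟙_ C ⟶ D.up ⊗ D.down)} {f : Fin (-k).toNat → (D.down ⊗ D.up ⟶ 𝟙_ C)}

include hk hD

theorem IsInverse.leftPair_unique_of_nonneg (h : D.IsInverse k τ e f)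
    {c₁ c₂ : 𝟙_ C ⟶ D.up ⊗ D.down} {d₁ d₂ : D.down ⊗ D.up ⟶ 𝟙_ C}
    (h₁ : (D.withLeft c₁ d₁).IsLeft k) (h₂ : (D.withLeft c₂ d₂).IsLeft k) :
    c₁ = c₂ ∧ d₁ = d₂ := by
  have hi := (IsInverse_iff_of_nonneg hD hk τ e f).1 h
  refine ⟨leftCup_ext fun Z => ?_, leftCap_ext fun Z => ?_⟩
  · exact hi.cup_unique (h₁.isCup hk hD) (h₂.isCup hk hD) Z
  · have e₁ := hi.cap_eq (h₁.isCup hk hD) (hD.leftCap_isCap d₁)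
      (h₁.crossL_t hk hD) Z
    have e₂ := hi.cap_eq (h₂.isCup hk hD) (hD.leftCap_isCap d₂)
      (h₂.crossL_t hk hD) Z
    exact e₁.trans e₂.symm

end RightData

namespace FullData

variable {C : Type u} [Category.{v} C] [MonoidalCategory C] [Preadditive C] [MonoidalPreadditive C]
variable {E : FullData C} {k : ℤ}

/-- The clockwise bubbles, and through them the negatively dotted anticlockwise ones, involve only
`c'`. So the relations on `c'` and the Grassmannian relation are available before `d'` enters, and
they give `t' = τ`; the inversion relation does the rest. -/
theorem isLeft_of_isInverse_of_nonneg (hk : 0 ≤ k) (hD : E.toRightData.IsBasic)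
    {τ : E.down ⊗ E.up ⟶ E.up ⊗ E.down} {e : Fin k.toNat → (𝟙_ C ⟶ E.up ⊗ E.down)}
    (hi : hD.leftAction.IsInverse k.toNat (leftCross τ) (fun i => leftCup (e i)))
    (hc' : E.cupL = (if k.toNat = 0 then E.c ≫ τ else 0) -
      ∑ i : Fin k.toNat, if (i : ℕ) + 1 = k.toNat then e i else 0)
    (hd' : E.capL = τ ≫ E.capDots k.toNat) : E.IsLeft k := by
  have hc : hD.leftAction.IsCup k.toNat (leftCup E.cupL) := by
    refine hi.isCup (fun Z => ?_) (leftCup_nat E.cupL)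
    rw [hc', leftCup_sub, leftCup_sum]
    congr 1
    · split_ifs
      · exact leftCup_comp_cross _ _ Z
      · exact leftCup_zero Z
    · refine Finset.sum_congr rfl fun i _ => ?_
      by_cases hin : (i : ℕ) + 1 = k.toNat
      · rw [if_pos hin]
        exact (if_pos hin).symm
      · rw [if_neg hin]
        exact (leftCup_zero Z).trans (if_neg hin).symm
  have hd : ∀ Z, leftCap E.capL Z = leftCross τ Z ≫ hD.leftAction.cap k.toNat Z := by
    intro Z
    rw [hD.leftAction_cap, hd']
    exact leftCross_comp_cap _ _ Z
  have hP : ∀ r < k.toNat, E.clockNat r = -(if r + 1 = k.toNat then 1 else 0) := by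
    intro r hr
    refine leftUnit_ext fun Z => ?_
    have := hc.clock r hr Z
    refine ((leftAction_clockNat hD r Z).symm.trans this).trans ?_
    refine Eq.trans (congrArg _ ?_) (leftUnit_neg _ _).symm
    split_ifs
    · exact (leftUnit_id Z).symm
    · exact (leftUnit_zero Z).symm
  have hg := fun i (hi : i < k.toNat) j (hj : j < k.toNat) Z =>
    sum_anti_comp_clockNat hP hk hD hi hj Z
  have hcross : ∀ Z, leftCross E.crossL Z = leftCross τ Z := by
    intro Z
    refine (leftAction_crossL hD Z).symm.trans ?_
    refine hi.crossL_eq_inv hc hd (g := fun i Z => leftUnit (E.anti k (-(i : ℤ) - 1)) Z)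
      (fun i _ _ f => leftUnit_nat _ f) (fun Z => ?_) (fun i hi Z => ?_) hg
      (fun j hj hj' Z => sum_anti_comp_clockNat' hP hk hD hj hj' Z) Z
    · rw [anti_neg hk, if_pos le_rfl, Nat.sub_self, bubbleDet, Matrix.det_fin_zero]
      exact leftUnit_id Z
    · rw [anti_neg hk, if_neg (by omega)]
      exact leftUnit_zero Z
  refine isLeft_of_nonneg hk hD hc (fun Z => ?_) (fun Z => ?_) ?_
  · rw [hcross]
    exact hi.pos hc (g := fun i Z => leftUnit (E.anti k (-(i : ℤ) - 1)) Z) hg Z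
  · rw [hcross]
    exact hi.down_up Z
  · rintro rfl
    apply whiskerRight_injective
    rw [id_whiskerRight]
    exact (leftAction_curlL hD _).symm.trans
      (hi.curlL (hD.leftCap_isCap E.capL) hd _)

end FullData

theorem RightData.IsInverse.exists_leftPair_of_nonneg
    {C : Type u} [Category.{v} C] [MonoidalCategory C] [Preadditive C] [MonoidalPreadditive C]
    {D : RightData C} {k : ℤ} (hk : 0 ≤ k) (hD : D.IsBasic)
    {τ : D.down ⊗ D.up ⟶ D.up ⊗ D.down}
    {e : Fin k.toNat → (𝟙_ C ⟶ D.up ⊗ D.down)} {f : Fin (-k).toNat → (D.down ⊗ D.up ⟶ 𝟙_ C)}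
    (h : D.IsInverse k τ e f) : ∃ c' d', (D.withLeft c' d').IsLeft k :=
  -- These are the only possible values, by `cup_unique` and `cap_eq`.
  ⟨(if k.toNat = 0 then D.c ≫ τ else 0) -
      ∑ i : Fin k.toNat, if (i : ℕ) + 1 = k.toNat then e i else 0, τ ≫ D.capDots k.toNat,
    FullData.isLeft_of_isInverse_of_nonneg (E := D.withLeft _ _) hk hD
    ((IsInverse_iff_of_nonneg hD hk τ e f).1 h) rfl rfl⟩

/-! ## Rotation by 180 degrees -/

/-- The category `C` with composition and tensor product reversed. -/
def Rotated (C : Type u) : Type u := C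

namespace Rotated

variable {C : Type u} [Category.{v} C]

instance : Category.{v} (Rotated C) where
  Hom X Y := @Quiver.Hom C _ Y X
  id X := @CategoryStruct.id C _ X
  comp f g := @CategoryStruct.comp C _ _ _ _ g f
  id_comp f := @Category.comp_id C _ _ _ f
  comp_id f := @Category.id_comp C _ _ _ f
  assoc f g h := (@Category.assoc C _ _ _ _ _ h g f).symm

def isoMk {X Y : C} (i : X ≅ Y) : @Iso (Rotated C) _ X Y where
  hom := i.inv
  inv := i.hom
  hom_inv_id := i.hom_inv_id
  inv_hom_id := i.inv_hom_id

instance [Preadditive C] : Preadditive (Rotated C) where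
  homGroup X Y := @Preadditive.homGroup C _ _ Y X
  add_comp _ _ _ f f' g := @Preadditive.comp_add C _ _ _ _ _ g f f'
  comp_add _ _ _ f g g' := @Preadditive.add_comp C _ _ _ _ _ g g' f

variable [MonoidalCategory C]

instance : MonoidalCategoryStruct (Rotated C) where
  tensorObj X Y := @MonoidalCategoryStruct.tensorObj C _ _ Y X
  tensorUnit := 𝟙_ C
  tensorHom f g := @MonoidalCategoryStruct.tensorHom C _ _ _ _ _ _ g f
  whiskerLeft X _ _ f := @MonoidalCategoryStruct.whiskerRight C _ _ _ _ f X
  whiskerRight f Y := @MonoidalCategoryStruct.whiskerLeft C _ _ Y _ _ f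
  associator X Y Z := isoMk (@MonoidalCategoryStruct.associator C _ _ Z Y X).symm
  leftUnitor X := isoMk (@MonoidalCategoryStruct.rightUnitor C _ _ X)
  rightUnitor X := isoMk (@MonoidalCategoryStruct.leftUnitor C _ _ X)

instance : MonoidalCategory (Rotated C) where
  tensorHom_def f g :=
    @MonoidalCategory.tensorHom_def C _ _ _ _ _ _ g f
  id_tensorHom_id X Y := @MonoidalCategory.id_tensorHom_id C _ _ Y X
  tensorHom_comp_tensorHom f₁ f₂ g₁ g₂ :=
    @MonoidalCategory.tensorHom_comp_tensorHom C _ _ _ _ _ _ _ _ g₂ g₁ f₂ f₁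
  whiskerLeft_id X Y := @MonoidalCategory.id_whiskerRight C _ _ Y X
  id_whiskerRight X Y := @MonoidalCategory.whiskerLeft_id C _ _ Y X
  associator_naturality f₁ f₂ f₃ :=
    @MonoidalCategory.associator_naturality C _ _ _ _ _ _ _ _ f₃ f₂ f₁ |>.symm
  leftUnitor_naturality f := (@MonoidalCategory.rightUnitor_inv_naturality C _ _ _ _ f).symm
  rightUnitor_naturality f := (@MonoidalCategory.leftUnitor_inv_naturality C _ _ _ _ f).symm
  pentagon W X Y Z :=
    (@Category.assoc C _ _ _ _ _ _ _ _).trans (@MonoidalCategory.pentagon C _ _ Z Y X W)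
  triangle X Y := (@MonoidalCategory.triangle_assoc_comp_right_inv C _ _ Y X)

instance [Preadditive C] [MonoidalPreadditive C] : MonoidalPreadditive (Rotated C) where
  whiskerLeft_zero {X Y Z} := @MonoidalPreadditive.zero_whiskerRight C _ _ _ _ X Z Y
  zero_whiskerRight {X Y Z} := @MonoidalPreadditive.whiskerLeft_zero C _ _ _ _ X Z Y
  whiskerLeft_add f g := @MonoidalPreadditive.add_whiskerRight C _ _ _ _ _ _ _ f g
  add_whiskerRight f g := @MonoidalPreadditive.whiskerLeft_add C _ _ _ _ _ _ _ f g

end Rotated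

/-! ### Diagrams with explicit associators, and their rotation -/

section Diagrams

variable {C : Type u} [Category.{v} C] [MonoidalCategory C] {U V : C}

/-- This and the following definitions spell out the coherence isomorphisms hidden in `⊗≫`, so that
rotation acts by unfolding and strict functors act by rewriting. -/
def rightwardCrossing (c : 𝟙_ C ⟶ V ⊗ U) (s : U ⊗ U ⟶ U ⊗ U) (d : U ⊗ V ⟶ 𝟙_ C) : U ⊗ V ⟶ V ⊗ U :=
  (λ_ (U ⊗ V)).inv ≫ c ▷ (U ⊗ V) ≫ (α_ V U (U ⊗ V)).hom ≫ V ◁ ((α_ U U V).inv ≫ s ▷ V ≫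
    (α_ U U V).hom) ≫ (α_ V U (U ⊗ V)).inv ≫ (V ⊗ U) ◁ d ≫ (ρ_ (V ⊗ U)).hom

def leftwardCrossing (c' : 𝟙_ C ⟶ U ⊗ V) (s : U ⊗ U ⟶ U ⊗ U) (d' : V ⊗ U ⟶ 𝟙_ C) :
    V ⊗ U ⟶ U ⊗ V :=
  (ρ_ (V ⊗ U)).inv ≫ (V ⊗ U) ◁ c' ≫ (α_ V U (U ⊗ V)).hom ≫ V ◁ ((α_ U U V).inv ≫ s ▷ V ≫
    (α_ U U V).hom) ≫ (α_ V U (U ⊗ V)).inv ≫ d' ▷ (U ⊗ V) ≫ (λ_ (U ⊗ V)).hom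

def rightCurl (c' : 𝟙_ C ⟶ U ⊗ V) (s : U ⊗ U ⟶ U ⊗ U) (d : U ⊗ V ⟶ 𝟙_ C) : U ⟶ U :=
  (ρ_ U).inv ≫ U ◁ c' ≫ (α_ U U V).inv ≫ s ▷ V ≫ (α_ U U V).hom ≫ U ◁ d ≫ (ρ_ U).hom

def leftCurl (c : 𝟙_ C ⟶ V ⊗ U) (s : U ⊗ U ⟶ U ⊗ U) (d' : V ⊗ U ⟶ 𝟙_ C) : U ⟶ U :=
  (λ_ U).inv ≫ c ▷ U ≫ (α_ V U U).hom ≫ V ◁ s ≫ (α_ V U U).inv ≫ d' ▷ U ≫ (λ_ U).hom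

def zigzagUp (c : 𝟙_ C ⟶ V ⊗ U) (d : U ⊗ V ⟶ 𝟙_ C) : U ⟶ U :=
  (ρ_ U).inv ≫ U ◁ c ≫ (α_ U V U).inv ≫ d ▷ U ≫ (λ_ U).hom

def braidLeft (s : U ⊗ U ⟶ U ⊗ U) : U ⊗ U ⊗ U ⟶ U ⊗ U ⊗ U :=
  (α_ U U U).inv ≫ s ▷ U ≫ (α_ U U U).hom ≫ U ◁ s ≫ (α_ U U U).inv ≫ s ▷ U ≫ (α_ U U U).hom

def braidRight (s : U ⊗ U ⟶ U ⊗ U) : U ⊗ U ⊗ U ⟶ U ⊗ U ⊗ U :=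
  U ◁ s ≫ (α_ U U U).inv ≫ s ▷ U ≫ (α_ U U U).hom ≫ U ◁ s

def zigzagDown (c : 𝟙_ C ⟶ V ⊗ U) (d : U ⊗ V ⟶ 𝟙_ C) : V ⟶ V :=
  (λ_ V).inv ≫ c ▷ V ≫ (α_ V U V).hom ≫ V ◁ d ≫ (ρ_ V).hom

theorem rotated_rightwardCrossing (c : 𝟙_ C ⟶ V ⊗ U) (s : U ⊗ U ⟶ U ⊗ U) (d : U ⊗ V ⟶ 𝟙_ C) :
    rightwardCrossing (C := Rotated C) (U := U) (V := V) d s c = rightwardCrossing c s d := by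
  refine Eq.trans (b := ((((((λ_ (U ⊗ V)).inv ≫ c ▷ (U ⊗ V)) ≫ (α_ (V ⊗ U) U V).inv) ≫
    (((α_ V U U).hom ≫ V ◁ s) ≫ (α_ V U U).inv) ▷ V) ≫ (α_ (V ⊗ U) U V).hom) ≫ (V ⊗ U) ◁ d) ≫
      (ρ_ (V ⊗ U)).hom) rfl ?_
  rw [rightwardCrossing]
  monoidal

theorem rotated_leftwardCrossing (c' : 𝟙_ C ⟶ U ⊗ V) (s : U ⊗ U ⟶ U ⊗ U) (d' : V ⊗ U ⟶ 𝟙_ C) :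
    leftwardCrossing (C := Rotated C) (U := U) (V := V) d' s c' = leftwardCrossing c' s d' := by
  refine Eq.trans (b := ((((((ρ_ (V ⊗ U)).inv ≫ (V ⊗ U) ◁ c') ≫ (α_ (V ⊗ U) U V).inv) ≫
    (((α_ V U U).hom ≫ V ◁ s) ≫ (α_ V U U).inv) ▷ V) ≫ (α_ (V ⊗ U) U V).hom) ≫ d' ▷ (U ⊗ V)) ≫
      (λ_ (U ⊗ V)).hom) rfl ?_
  rw [leftwardCrossing]
  monoidal

theorem rotated_rightCurl (c : 𝟙_ C ⟶ V ⊗ U) (s : U ⊗ U ⟶ U ⊗ U) (d' : V ⊗ U ⟶ 𝟙_ C) :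
    rightCurl (C := Rotated C) (U := U) (V := V) d' s c = leftCurl c s d' := by
  refine Eq.trans (b := ((((((λ_ U).inv ≫ c ▷ U) ≫ (α_ V U U).hom) ≫ V ◁ s) ≫
    (α_ V U U).inv) ≫ d' ▷ U) ≫ (λ_ U).hom) rfl ?_
  simp only [leftCurl, Category.assoc]

theorem rotated_leftCurl (c' : 𝟙_ C ⟶ U ⊗ V) (s : U ⊗ U ⟶ U ⊗ U) (d : U ⊗ V ⟶ 𝟙_ C) :
    leftCurl (C := Rotated C) (U := U) (V := V) d s c' = rightCurl c' s d := by
  refine Eq.trans (b := ((((((ρ_ U).inv ≫ U ◁ c') ≫ (α_ U U V).inv) ≫ s ▷ V) ≫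
    (α_ U U V).hom) ≫ U ◁ d) ≫ (ρ_ U).hom) rfl ?_
  simp only [rightCurl, Category.assoc]

theorem rotated_zigzagUp (c : 𝟙_ C ⟶ V ⊗ U) (d : U ⊗ V ⟶ 𝟙_ C) :
    zigzagUp (C := Rotated C) (U := U) (V := V) d c = zigzagUp c d := by
  refine Eq.trans (b := (((((ρ_ U).inv ≫ U ◁ c) ≫ (α_ U V U).inv) ≫ d ▷ U) ≫ (λ_ U).hom)) ?_ ?_
  · rfl
  simp only [zigzagUp, Category.assoc]

theorem rotated_zigzagDown (c : 𝟙_ C ⟶ V ⊗ U) (d : U ⊗ V ⟶ 𝟙_ C) :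
    zigzagDown (C := Rotated C) (U := U) (V := V) d c = zigzagDown c d := by
  refine Eq.trans (b := (((((λ_ V).inv ≫ c ▷ V) ≫ (α_ V U V).hom) ≫ V ◁ d) ≫ (ρ_ V).hom)) ?_ ?_
  · rfl
  simp only [zigzagDown, Category.assoc]

/-- Rotation exchanges the two sides of the braid relation, up to conjugation by the associator. -/
theorem rotated_braid {s : U ⊗ U ⟶ U ⊗ U} (h : braidLeft s = braidRight s) :
    @braidLeft (Rotated C) Rotated.instCategory Rotated.instMonoidalCategory U s =
      @braidRight (Rotated C) Rotated.instCategory Rotated.instMonoidalCategory U s := by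
  refine Eq.trans (b := (((((((α_ U U U).hom ≫ U ◁ s) ≫ (α_ U U U).inv) ≫ s ▷ U) ≫
    (α_ U U U).hom) ≫ U ◁ s) ≫ (α_ U U U).inv)) rfl ?_
  refine Eq.trans (b := ((((s ▷ U) ≫ (α_ U U U).hom) ≫ U ◁ s) ≫ (α_ U U U).inv) ≫ s ▷ U) ?_ rfl
  have := congrArg (fun f => (α_ U U U).hom ≫ f ≫ (α_ U U U).inv) h
  simpa [braidLeft, braidRight, Category.assoc] using this.symm

theorem RightData.crossR_eq (D : RightData C) : D.crossR = rightwardCrossing D.c D.s D.d := by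
  rw [RightData.crossR, rightwardCrossing]
  monoidal

theorem FullData.crossL_eq (E : FullData C) : E.crossL = leftwardCrossing E.cupL E.s E.capL := by
  rw [FullData.crossL, leftwardCrossing]
  monoidal

theorem FullData.curlR_eq (E : FullData C) : E.curlR = rightCurl E.cupL E.s E.d := by
  rw [FullData.curlR, rightCurl]
  monoidal

theorem FullData.curlL_eq (E : FullData C) : E.curlL = leftCurl E.c E.s E.capL := by
  rw [FullData.curlL, leftCurl]
  monoidal

theorem RightData.braid_left_eq (D : RightData C) :
    𝟙 (D.up ⊗ D.up ⊗ D.up) ⊗≫ D.s ▷ D.up ⊗≫ D.up ◁ D.s ⊗≫ D.s ▷ D.up ⊗≫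
        𝟙 (D.up ⊗ D.up ⊗ D.up) = braidLeft D.s := by
  rw [braidLeft]
  monoidal

theorem RightData.braid_right_eq (D : RightData C) :
    𝟙 (D.up ⊗ D.up ⊗ D.up) ⊗≫ D.up ◁ D.s ⊗≫ D.s ▷ D.up ⊗≫ D.up ◁ D.s ⊗≫
        𝟙 (D.up ⊗ D.up ⊗ D.up) = braidRight D.s := by
  rw [braidRight]
  monoidal

theorem RightData.adj_up_eq (D : RightData C) :
    𝟙 D.up ⊗≫ D.up ◁ D.c ⊗≫ D.d ▷ D.up ⊗≫ 𝟙 D.up = zigzagUp D.c D.d := by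
  rw [zigzagUp]
  monoidal

theorem RightData.adj_down_eq (D : RightData C) :
    𝟙 D.down ⊗≫ D.c ▷ D.down ⊗≫ D.down ◁ D.d ⊗≫ 𝟙 D.down = zigzagDown D.c D.d := by
  rw [zigzagDown]
  monoidal

theorem RightData.isBasic_iff [Preadditive C] [MonoidalPreadditive C] {D : RightData C} : D.IsBasic ↔
    D.s ≫ D.s = 𝟙 _ ∧ braidLeft D.s = braidRight D.s ∧
      D.s ≫ D.x ▷ D.up - D.up ◁ D.x ≫ D.s = 𝟙 _ ∧ zigzagUp D.c D.d = 𝟙 _ ∧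
      zigzagDown D.c D.d = 𝟙 _ := by
  refine ⟨fun h => ⟨h _ _ .square, ?_, h _ _ .dot, ?_, ?_⟩, ?_⟩
  · rw [← D.braid_left_eq, ← D.braid_right_eq]
    exact h _ _ .braid
  · rw [← D.adj_up_eq]
    exact h _ _ .adj_up
  · rw [← D.adj_down_eq]
    exact h _ _ .adj_down
  · rintro ⟨h₁, h₂, h₃, h₄, h₅⟩ X Y f g (_ | _ | _ | _ | _)
    · exact h₁
    · rwa [D.braid_left_eq, D.braid_right_eq]
    · exact h₃
    · rwa [D.adj_up_eq]
    · rwa [D.adj_down_eq]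

section

variable [Preadditive C] [MonoidalPreadditive C]

theorem neg_whiskerRight {X Y : C} (f : X ⟶ Y) (Z : C) : (-f) ▷ Z = -(f ▷ Z) :=
  ((tensorRight Z).map_neg (f := f))

theorem whiskerLeft_neg {X Y : C} (f : X ⟶ Y) (Z : C) : Z ◁ (-f) = -(Z ◁ f) :=
  ((tensorLeft Z).map_neg (f := f))

/-- Rotation changes the signs of `s`, `c'` and `d'`. A crossing contains an odd number of these and
a curl contains two, so crossings change sign and curls do not. -/
theorem rightwardCrossing_neg (c : 𝟙_ C ⟶ V ⊗ U) (s : U ⊗ U ⟶ U ⊗ U) (d : U ⊗ V ⟶ 𝟙_ C) :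
    rightwardCrossing c (-s) d = -rightwardCrossing c s d := by
  simp [rightwardCrossing, neg_whiskerRight, whiskerLeft_neg]

theorem leftwardCrossing_neg (c' : 𝟙_ C ⟶ U ⊗ V) (s : U ⊗ U ⟶ U ⊗ U) (d' : V ⊗ U ⟶ 𝟙_ C) :
    leftwardCrossing (-c') (-s) (-d') = -leftwardCrossing c' s d' := by
  simp [leftwardCrossing, neg_whiskerRight, whiskerLeft_neg]

theorem rightCurl_neg (c' : 𝟙_ C ⟶ U ⊗ V) (s : U ⊗ U ⟶ U ⊗ U) (d : U ⊗ V ⟶ 𝟙_ C) :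
    rightCurl (-c') (-s) d = rightCurl c' s d := by
  simp [rightCurl, neg_whiskerRight, whiskerLeft_neg]

theorem leftCurl_neg (c : 𝟙_ C ⟶ V ⊗ U) (s : U ⊗ U ⟶ U ⊗ U) (d' : V ⊗ U ⟶ 𝟙_ C) :
    leftCurl c (-s) (-d') = leftCurl c s d' := by
  simp [leftCurl, neg_whiskerRight, whiskerLeft_neg]

theorem braidLeft_neg (s : U ⊗ U ⟶ U ⊗ U) : braidLeft (-s) = -braidLeft s := by
  simp [braidLeft, neg_whiskerRight, whiskerLeft_neg]

theorem braidRight_neg (s : U ⊗ U ⟶ U ⊗ U) : braidRight (-s) = -braidRight s := by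
  simp [braidRight, neg_whiskerRight, whiskerLeft_neg]

namespace RightData

/-- Right data, rotated by 180 degrees. -/
def rotate (D : RightData C) : RightData (Rotated C) where
  up := (D.up : C)
  down := (D.down : C)
  x := (D.x : (D.up : C) ⟶ D.up)
  -- Reversal exchanges the two products in the dot relation, which negates their difference; the
  -- sign on `s` compensates.
  s := (-D.s : (D.up ⊗ D.up : C) ⟶ D.up ⊗ D.up)
  c := (D.d : (D.up ⊗ D.down : C) ⟶ 𝟙_ C)
  d := (D.c : 𝟙_ C ⟶ (D.down ⊗ D.up : C))

variable (D : RightData C)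

omit [Preadditive C] [MonoidalPreadditive C] in
theorem dots_comp_x (n : ℕ) : D.dots n ≫ D.x = D.x ≫ D.dots n := by
  induction n with
  | zero => simp [dots]
  | succ n ih => rw [dots, ih, Category.assoc, ih]

omit [MonoidalPreadditive C] in
theorem rotate_dots (n : ℕ) : D.rotate.dots n = D.dots n := by
  induction n with
  | zero => rfl
  | succ n ih =>
    rw [dots, ih, dots, dots_comp_x]
    rfl

omit [MonoidalPreadditive C] in
theorem rotate_cupDots (n : ℕ) : D.rotate.cupDots n = D.capDots n := by
  rw [cupDots, rotate_dots]
  rfl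

omit [MonoidalPreadditive C] in
theorem rotate_capDots (n : ℕ) : D.rotate.capDots n = D.cupDots n := by
  rw [capDots, rotate_dots]
  rfl

theorem rotate_crossR : D.rotate.crossR = -D.crossR := by
  rw [crossR_eq, crossR_eq, ← rightwardCrossing_neg]
  exact rotated_rightwardCrossing D.c (-D.s) D.d

variable {D}

theorem IsBasic.rotate (hD : D.IsBasic) : D.rotate.IsBasic := by
  obtain ⟨h₁, h₂, h₃, h₄, h₅⟩ := isBasic_iff.1 hD
  refine isBasic_iff.2 ⟨?_, ?_, ?_, ?_, ?_⟩
  · change (-D.s) ≫ (-D.s) = _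
    rw [Preadditive.neg_comp_neg]
    exact h₁
  · exact @rotated_braid C _ _ _ (-D.s) (by rw [braidLeft_neg, braidRight_neg, h₂])
  · change D.up ◁ D.x ≫ (-D.s) - (-D.s) ≫ D.x ▷ D.up = _
    refine Eq.trans ?_ h₃
    rw [Preadditive.comp_neg, Preadditive.neg_comp, neg_sub_neg]
  · exact (rotated_zigzagUp D.c D.d).trans h₄
  · exact (rotated_zigzagDown D.c D.d).trans h₅

/-- Dotted cups become dotted caps, so the row for `k` becomes the column for `-k`. The families `e`
and `e'` have empty index types, hence may be arbitrary. -/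
theorem rotate_isInverse {k : ℤ} (hk : k ≤ 0) {τ : D.down ⊗ D.up ⟶ D.up ⊗ D.down}
    {e : Fin k.toNat → (𝟙_ C ⟶ D.up ⊗ D.down)} {f : Fin (-k).toNat → (D.down ⊗ D.up ⟶ 𝟙_ C)}
    {e' : Fin (-(-k)).toNat → (𝟙_ C ⟶ D.up ⊗ D.down)} :
    D.rotate.IsInverse (-k) (-τ) f e' ↔ D.IsInverse k τ e f := by
  have hemp : IsEmpty (Fin k.toNat) := by
    rw [show k.toNat = 0 by omega]; infer_instance
  have hemp' : IsEmpty (Fin (-(-k)).toNat) := by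
    rw [show (-(-k)).toNat = 0 by omega]; infer_instance
  constructor
  · rintro h X Y p q (_ | _ | i | i | ⟨i, j⟩ | i | j | ⟨i, j⟩)
    · have h₁ := h _ _ .down_up
      rw [Finset.univ_eq_empty, Finset.sum_empty, add_zero, rotate_crossR] at h₁
      rw [Finset.univ_eq_empty, Finset.sum_empty, add_zero, ← Preadditive.neg_comp_neg]
      exact h₁
    · have h₁ := h _ _ .up_down
      simp only [rotate_crossR, rotate_capDots] at h₁
      rw [← Preadditive.neg_comp_neg]
      exact h₁
    · exact hemp.elim i
    · exact hemp.elim i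
    · exact hemp.elim i
    · have h₁ := h _ _ (.cInv_cross i)
      rw [rotate_crossR] at h₁
      rw [← neg_eq_zero, ← Preadditive.neg_comp]
      exact h₁
    · have h₁ := h _ _ (.tInv_cap j)
      rw [rotate_capDots] at h₁
      rw [← neg_eq_zero, ← Preadditive.comp_neg]
      exact h₁
    · have h₁ := h _ _ (.cInv_cap j i)
      rw [rotate_capDots] at h₁
      simp only [eq_comm (a := i)]
      exact h₁
  · rintro h X Y p q (_ | _ | i | i | ⟨i, j⟩ | i | j | ⟨i, j⟩)
    · have h₁ := h _ _ .down_up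
      simp only [rotate_crossR, rotate_capDots]
      rw [← Preadditive.neg_comp_neg] at h₁
      exact h₁
    · have h₁ := h _ _ .up_down
      rw [Finset.univ_eq_empty, Finset.sum_empty, add_zero, ← Preadditive.neg_comp_neg] at h₁
      rw [Finset.univ_eq_empty, Finset.sum_empty, add_zero, rotate_crossR]
      exact h₁
    · have h₁ := h _ _ (.cross_dInv i)
      rw [← neg_eq_zero, ← Preadditive.neg_comp] at h₁
      rw [rotate_crossR]
      exact h₁
    · have h₁ := h _ _ (.cup_tInv i)
      rw [← neg_eq_zero, ← Preadditive.comp_neg] at h₁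
      rw [rotate_capDots]
      exact h₁
    · have h₁ := h _ _ (.cup_dInv j i)
      rw [rotate_capDots]
      simp only [eq_comm (a := i)]
      exact h₁
    · exact hemp'.elim i
    · exact hemp'.elim j
    · exact hemp'.elim i

end RightData

namespace FullData

/-- Full data, rotated by 180 degrees. -/
def rotate (E : FullData C) : FullData (Rotated C) where
  __ := E.toRightData.rotate
  -- The signs on cup and cap match the normalisations: the extreme clockwise bubble is `-1`, the
  -- extreme anticlockwise one is `1`.
  cupL := (-E.capL : (E.down ⊗ E.up : C) ⟶ 𝟙_ C)
  capL := (-E.cupL : 𝟙_ C ⟶ (E.up ⊗ E.down : C))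

variable (E : FullData C)

theorem rotate_crossL : E.rotate.crossL = -E.crossL := by
  rw [crossL_eq, crossL_eq, ← leftwardCrossing_neg]
  exact rotated_leftwardCrossing (-E.cupL) (-E.s) (-E.capL)

theorem rotate_curlR : E.rotate.curlR = E.curlL := by
  rw [curlR_eq, curlL_eq, ← leftCurl_neg]
  exact rotated_rightCurl E.c (-E.s) (-E.capL)

theorem rotate_curlL : E.rotate.curlL = E.curlR := by
  rw [curlR_eq, curlL_eq, ← rightCurl_neg]
  exact rotated_leftCurl (-E.cupL) (-E.s) E.d

omit [MonoidalPreadditive C] in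
theorem rotate_cupLDots (n : ℕ) : E.rotate.cupLDots n = -E.capLDots n := by
  have : E.rotate.dots n = E.dots n := E.toRightData.rotate_dots n
  rw [cupLDots, this, capLDots, ← Preadditive.comp_neg]
  rfl

omit [MonoidalPreadditive C] in
theorem rotate_capLDots (n : ℕ) : E.rotate.capLDots n = -E.cupLDots n := by
  have : E.rotate.dots n = E.dots n := E.toRightData.rotate_dots n
  rw [capLDots, this, cupLDots, ← Preadditive.neg_comp]
  rfl

omit [MonoidalPreadditive C] in
theorem rotate_clockNat (n : ℕ) : E.rotate.clockNat n = -E.antiNat n := by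
  have : E.rotate.dots n = E.dots n := E.toRightData.rotate_dots n
  rw [clockNat, this, antiNat]
  refine Eq.trans (b := (E.c ≫ E.down ◁ E.dots n) ≫ (-E.capL)) rfl ?_
  rw [Preadditive.comp_neg, Category.assoc]

omit [MonoidalPreadditive C] in
theorem rotate_antiNat (n : ℕ) : E.rotate.antiNat n = -E.clockNat n := by
  have : E.rotate.dots n = E.dots n := E.toRightData.rotate_dots n
  rw [antiNat, this, clockNat]
  refine Eq.trans (b := ((-E.cupL) ≫ E.dots n ▷ E.down) ≫ E.d) rfl ?_
  rw [Preadditive.neg_comp, Preadditive.neg_comp, Category.assoc]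

/-- Rotation identifies the endomorphism rings of the unit objects. -/
def rotateUnitEnd : End (𝟙_ C) →+* End (𝟙_ (Rotated C)) where
  toFun f := (f : 𝟙_ C ⟶ 𝟙_ C)
  map_one' := rfl
  map_mul' f g := unitEnd_comm (C := C) g f
  map_zero' := rfl
  map_add' _ _ := rfl

omit [MonoidalPreadditive C] in
theorem clock_of_neg {k n : ℤ} (hn : n < 0) {r : ℕ} (hr : n - k + 1 = r) :
    E.clock k n = -Matrix.det (Matrix.of fun i j : Fin r =>
      -E.antiNat ((i : ℤ) - (j : ℤ) - k).toNat) := by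
  obtain rfl : (n - k + 1).toNat = r := by omega
  rw [clock, if_neg (by omega), if_neg (by omega)]

omit [MonoidalPreadditive C] in
theorem clock_eq_zero {k n : ℤ} (hn : n < 0) (h : n - k + 1 < 0) : E.clock k n = 0 := by
  rw [clock, if_neg (by omega), if_pos h]

omit [MonoidalPreadditive C] in
theorem anti_of_neg {k n : ℤ} (hn : n < 0) {r : ℕ} (hr : n + k + 1 = r) :
    E.anti k n = Matrix.det (Matrix.of fun i j : Fin r =>
      E.clockNat ((i : ℤ) - (j : ℤ) + k).toNat) := by
  obtain rfl : (n + k + 1).toNat = r := by omega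
  rw [anti, if_neg (by omega), if_neg (by omega)]

omit [MonoidalPreadditive C] in
theorem anti_eq_zero {k n : ℤ} (hn : n < 0) (h : n + k + 1 < 0) : E.anti k n = 0 := by
  rw [anti, if_neg (by omega), if_pos h]

-- The signs in the definition of `clock` for negative dots are such that the rule for nonnegative
-- dots persists: the rotated matrix has the same entries as the one that defines `anti`.
omit [MonoidalPreadditive C] in
theorem rotate_clock (k n : ℤ) : E.rotate.clock (-k) n = -E.anti k n := by
  by_cases hn : 0 ≤ n
  · rw [clock, anti, if_pos hn, if_pos hn]
    exact E.rotate_clockNat _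
  rw [not_le] at hn
  by_cases h : n + k + 1 < 0
  · rw [clock_eq_zero _ hn (by omega), anti_eq_zero _ hn h]
    exact (neg_zero (G := (𝟙_ C ⟶ 𝟙_ C))).symm
  · obtain ⟨r, hr⟩ := Int.eq_ofNat_of_zero_le (not_lt.1 h)
    rw [clock_of_neg _ hn (r := r) (by omega), anti_of_neg _ hn hr]
    have hdet : (Matrix.of fun i j : Fin r =>
        -E.rotate.antiNat ((i : ℤ) - (j : ℤ) - -k).toNat).det = rotateUnitEnd (Matrix.of
        fun i j : Fin r => E.clockNat ((i : ℤ) - (j : ℤ) + k).toNat).det := by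
      rw [RingHom.map_det]
      refine congrArg Matrix.det (Matrix.ext fun i j => ?_)
      change -E.rotate.antiNat _ = E.clockNat _
      rw [rotate_antiNat, sub_neg_eq_add]
      exact neg_neg (G := (𝟙_ C ⟶ 𝟙_ C)) _
    exact congrArg (fun b : End (𝟙_ (Rotated C)) => -b) hdet

omit [MonoidalPreadditive C] in
theorem rotate_anti (k n : ℤ) : E.rotate.anti (-k) n = -E.clock k n := by
  by_cases hn : 0 ≤ n
  · rw [clock, anti, if_pos hn, if_pos hn]
    exact E.rotate_antiNat _
  rw [not_le] at hn
  by_cases h : n - k + 1 < 0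
  · rw [clock_eq_zero _ hn h, anti_eq_zero _ hn (by omega)]
    exact (neg_zero (G := (𝟙_ C ⟶ 𝟙_ C))).symm
  · obtain ⟨r, hr⟩ := Int.eq_ofNat_of_zero_le (not_lt.1 h)
    rw [clock_of_neg _ hn hr, anti_of_neg _ hn (r := r) (by omega)]
    have hdet : (Matrix.of fun i j : Fin r =>
        E.rotate.clockNat ((i : ℤ) - (j : ℤ) + -k).toNat).det = rotateUnitEnd (Matrix.of
        fun i j : Fin r => -E.antiNat ((i : ℤ) - (j : ℤ) - k).toNat).det := by
      rw [RingHom.map_det]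
      refine congrArg Matrix.det (Matrix.ext fun i j => ?_)
      change E.rotate.clockNat _ = -E.antiNat _
      rw [rotate_clockNat, sub_eq_add_neg _ k]
    exact hdet.trans (neg_neg (G := (𝟙_ C ⟶ 𝟙_ C)) _).symm

variable {E}

-- Bubbles written in the gap between cap and cup make the relations visibly symmetric under
-- rotation.
omit [MonoidalPreadditive C] in
theorem isLeft_iff {k : ℤ} : E.IsLeft k ↔
    (E.crossR ≫ E.crossL = 𝟙 (E.up ⊗ E.down) + ∑ r ∈ Finset.range k.toNat,
      ∑ s ∈ Finset.range k.toNat,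
        E.capDots s ≫ (E.anti k (-(r : ℤ) - (s : ℤ) - 2) : 𝟙_ C ⟶ 𝟙_ C) ≫ E.cupLDots r) ∧
    (E.crossL ≫ E.crossR = 𝟙 (E.down ⊗ E.up) + ∑ r ∈ Finset.range (-k).toNat,
      ∑ s ∈ Finset.range (-k).toNat,
        E.capLDots r ≫ (E.clock k (-(r : ℤ) - (s : ℤ) - 2) : 𝟙_ C ⟶ 𝟙_ C) ≫ E.cupDots s) ∧
    (0 ≤ k → E.curlR = if k = 0 then 𝟙 E.up else 0) ∧
    (k ≤ 0 → E.curlL = if k = 0 then 𝟙 E.up else 0) ∧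
    (∀ r : ℕ, (r : ℤ) < k →
      (E.clock k r : 𝟙_ C ⟶ 𝟙_ C) = -(if (r : ℤ) = k - 1 then 𝟙 (𝟙_ C) else 0)) ∧
    (∀ r : ℕ, (r : ℤ) < -k →
      (E.anti k r : 𝟙_ C ⟶ 𝟙_ C) = if (r : ℤ) = -k - 1 then 𝟙 (𝟙_ C) else 0) := by
  constructor
  · intro h
    refine ⟨(h _ _ .pos).trans ?_, (h _ _ .neg).trans ?_, fun hk => h _ _ (.curlR hk),
      fun hk => h _ _ (.curlL hk), fun r hr => h _ _ (.clock r hr), fun r hr => h _ _ (.anti r hr)⟩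
    · simp only [bubbleRight_eq]
    · simp only [bubbleLeft_eq]
  · rintro ⟨h₁, h₂, h₃, h₄, h₅, h₆⟩ X Y f g (_ | _ | hk | ⟨r, hr⟩ | hk | ⟨r, hr⟩)
    · simpa only [bubbleRight_eq] using h₁
    · simpa only [bubbleLeft_eq] using h₂
    · exact h₃ hk
    · exact h₅ r hr
    · exact h₄ hk
    · exact h₆ r hr

/-- Rotation exchanges (pos) with (neg) and right curls with left curls. In each summand the sign of
the bubble cancels that of the leftward cup or cap. -/
theorem rotate_isLeft {k : ℤ} : E.rotate.IsLeft (-k) ↔ E.IsLeft k := by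
  rw [isLeft_iff, isLeft_iff]
  simp only [neg_neg, rotate_clock, rotate_anti, rotate_curlR, rotate_curlL, rotate_cupLDots,
    rotate_capLDots, rotate_crossL]
  have hR : E.rotate.crossR = -E.crossR := E.toRightData.rotate_crossR
  have hcap (n : ℕ) : E.rotate.capDots n = E.cupDots n := E.toRightData.rotate_capDots n
  have hcup (n : ℕ) : E.rotate.cupDots n = E.capDots n := E.toRightData.rotate_cupDots n
  simp only [hR, hcap, hcup]
  have hpos : ((-E.crossL) ≫ (-E.crossR) = 𝟙 (E.down ⊗ E.up) + ∑ r ∈ Finset.range (-k).toNat,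
      ∑ s ∈ Finset.range (-k).toNat, ((-E.capLDots r) ≫
        Neg.neg (α := 𝟙_ C ⟶ 𝟙_ C) (E.clock k (-(r : ℤ) - (s : ℤ) - 2))) ≫ E.cupDots s) ↔
      E.crossL ≫ E.crossR = 𝟙 (E.down ⊗ E.up) + ∑ r ∈ Finset.range (-k).toNat,
        ∑ s ∈ Finset.range (-k).toNat, E.capLDots r ≫
          (E.clock k (-(r : ℤ) - (s : ℤ) - 2) : 𝟙_ C ⟶ 𝟙_ C) ≫ E.cupDots s := by
    simp only [Preadditive.neg_comp_neg, Category.assoc]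
  have hneg : ((-E.crossR) ≫ (-E.crossL) = 𝟙 (E.up ⊗ E.down) + ∑ r ∈ Finset.range k.toNat,
      ∑ s ∈ Finset.range k.toNat, (E.capDots s ≫
        Neg.neg (α := 𝟙_ C ⟶ 𝟙_ C) (E.anti k (-(r : ℤ) - (s : ℤ) - 2))) ≫ (-E.cupLDots r)) ↔
      E.crossR ≫ E.crossL = 𝟙 (E.up ⊗ E.down) + ∑ r ∈ Finset.range k.toNat,
        ∑ s ∈ Finset.range k.toNat, E.capDots s ≫
          (E.anti k (-(r : ℤ) - (s : ℤ) - 2) : 𝟙_ C ⟶ 𝟙_ C) ≫ E.cupLDots r := by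
    simp only [Category.assoc, Preadditive.comp_neg, Preadditive.neg_comp, neg_neg]
  have hcl (r : ℕ) : ((-E.anti k r : 𝟙_ C ⟶ 𝟙_ C) =
      -(if (r : ℤ) = -k - 1 then 𝟙 (𝟙_ C) else 0)) ↔
      (E.anti k r : 𝟙_ C ⟶ 𝟙_ C) = if (r : ℤ) = -k - 1 then 𝟙 (𝟙_ C) else 0 := neg_inj
  have han (r : ℕ) : ((-E.clock k r : 𝟙_ C ⟶ 𝟙_ C) = if (r : ℤ) = k - 1 then 𝟙 (𝟙_ C) else 0) ↔
      (E.clock k r : 𝟙_ C ⟶ 𝟙_ C) = -(if (r : ℤ) = k - 1 then 𝟙 (𝟙_ C) else 0) :=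
    neg_eq_iff_eq_neg
  have h0 : (-k = 0) ↔ k = 0 := neg_eq_zero
  simp only [h0, Left.nonneg_neg_iff, Left.neg_nonpos_iff]
  constructor
  · rintro ⟨h₁, h₂, h₃, h₄, h₅, h₆⟩
    exact ⟨hneg.1 h₂, hpos.1 h₁, h₄, h₃, fun r hr => (han r).1 (h₆ r hr),
      fun r hr => (hcl r).1 (h₅ r hr)⟩
  · rintro ⟨h₁, h₂, h₃, h₄, h₅, h₆⟩
    exact ⟨hpos.2 h₂, hneg.2 h₁, h₄, h₃, fun r hr => (hcl r).2 (h₆ r hr),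
      fun r hr => (han r).2 (h₅ r hr)⟩

end FullData

/-! ### Left pairs and inverses for every central charge -/

section

variable {D : RightData C} {k : ℤ}

theorem FullData.IsLeft.exists_isInverse {E : FullData C} (hE : E.toRightData.IsBasic)
    (h : E.IsLeft k) : ∃ τ e f, E.toRightData.IsInverse k τ e f := by
  rcases le_total 0 k with hk | hk
  · exact h.exists_isInverse_of_nonneg hk hE
  · obtain ⟨τ, e, f, h⟩ :=
      (FullData.rotate_isLeft.2 h).exists_isInverse_of_nonneg (by omega) hE.rotate
    have hemp : IsEmpty (Fin k.toNat) := by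
      rw [show k.toNat = 0 by omega]; infer_instance
    obtain ⟨τ', rfl⟩ : ∃ τ' : E.down ⊗ E.up ⟶ E.up ⊗ E.down, -τ' = τ := ⟨_, neg_neg _⟩
    exact ⟨τ', fun i => hemp.elim i, e, (RightData.rotate_isInverse hk).1 h⟩

namespace RightData

variable (hD : D.IsBasic) {τ : D.down ⊗ D.up ⟶ D.up ⊗ D.down}
  {e : Fin k.toNat → (𝟙_ C ⟶ D.up ⊗ D.down)} {f : Fin (-k).toNat → (D.down ⊗ D.up ⟶ 𝟙_ C)}

include hD

theorem IsInverse.leftPair_unique (h : D.IsInverse k τ e f)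
    {c₁ c₂ : 𝟙_ C ⟶ D.up ⊗ D.down} {d₁ d₂ : D.down ⊗ D.up ⟶ 𝟙_ C}
    (h₁ : (D.withLeft c₁ d₁).IsLeft k) (h₂ : (D.withLeft c₂ d₂).IsLeft k) :
    c₁ = c₂ ∧ d₁ = d₂ := by
  rcases le_total 0 k with hk | hk
  · exact h.leftPair_unique_of_nonneg hk hD h₁ h₂
  · have := ((rotate_isInverse hk (e' := fun _ => 0)).2 h).leftPair_unique_of_nonneg (by omega)
      hD.rotate (FullData.rotate_isLeft.2 h₁) (FullData.rotate_isLeft.2 h₂)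
    -- Rotation interchanges cup and cap, up to sign, so the two equalities come in the opposite
    -- order.
    exact ⟨neg_injective (G := (𝟙_ C ⟶ D.up ⊗ D.down)) this.2,
      neg_injective (G := (D.down ⊗ D.up ⟶ 𝟙_ C)) this.1⟩

theorem IsInverse.exists_leftPair (h : D.IsInverse k τ e f) :
    ∃ c' d', (D.withLeft c' d').IsLeft k := by
  rcases le_total 0 k with hk | hk
  · exact h.exists_leftPair_of_nonneg hk hD
  · obtain ⟨c, d, h⟩ := ((rotate_isInverse hk (e' := fun _ => 0)).2 h).exists_leftPair_of_nonneg
      (by omega) hD.rotate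
    obtain ⟨c', rfl⟩ : ∃ c' : 𝟙_ C ⟶ D.up ⊗ D.down, -c' = d := ⟨_, neg_neg _⟩
    obtain ⟨d', rfl⟩ : ∃ d' : D.down ⊗ D.up ⟶ 𝟙_ C, -d' = c := ⟨_, neg_neg _⟩
    exact ⟨c', d', FullData.rotate_isLeft.1 h⟩

end RightData

end

end

end Diagrams

/-! ## Strict monoidal functors between presented categories -/

namespace Presented

open MonSig

variable {K : Type u} [CommRing K] {O : Type} {S S' S'' : MonSig O}
  {R : ∀ ⦃X Y : List O⦄, S.Term K X Y → S.Term K X Y → Prop}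
  {R' : ∀ ⦃X Y : List O⦄, S'.Term K X Y → S'.Term K X Y → Prop}
  {R'' : ∀ ⦃X Y : List O⦄, S''.Term K X Y → S''.Term K X Y → Prop}

/-- A strict `K`-linear monoidal functor that is the identity on words. -/
structure StrictFunctor (R : ∀ ⦃X Y : List O⦄, S.Term K X Y → S.Term K X Y → Prop)
    (R' : ∀ ⦃X Y : List O⦄, S'.Term K X Y → S'.Term K X Y → Prop) where
  map : ∀ {X Y : Presented K S R},
    (X ⟶ Y) →ₗ[K] ((⟨X.word⟩ : Presented K S' R') ⟶ ⟨Y.word⟩)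
  map_id : ∀ X : Presented K S R, map (𝟙 X) = 𝟙 _
  map_comp : ∀ {X Y Z : Presented K S R} (f : X ⟶ Y) (g : Y ⟶ Z), map (f ≫ g) = map f ≫ map g
  map_tensor : ∀ {X Y X' Y' : Presented K S R} (f : X ⟶ Y) (g : X' ⟶ Y'),
    map (f ⊗ₘ g) = map f ⊗ₘ map g

section Eval

variable (φ : ∀ g : S.Gen, (⟨S.src g⟩ : Presented K S' R') ⟶ ⟨S.tgt g⟩)

/-- The value of a formal expression under an assignment of the generators. -/
def eval : ∀ {X Y : List O}, S.Term K X Y → ((⟨X⟩ : Presented K S' R') ⟶ ⟨Y⟩)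
  | _, _, .gen g => φ g
  | _, _, .id _ => 𝟙 _
  | _, _, .comp f g => eval f ≫ eval g
  | _, _, .tensor f g => eval f ⊗ₘ eval g
  | _, _, .zero _ _ => 0
  | _, _, .add f g => eval f + eval g
  | _, _, .smul a f => a • eval f

theorem eval_eqTo {X Y : List O} (h : X = Y) :
    eval φ (Term.eqTo K S h) = eqToHom (congrArg Presented.mk h) := by
  subst h; rfl

theorem eval_rel (hφ : ∀ ⦃X Y : List O⦄ (f g : S.Term K X Y), R f g → eval φ f = eval φ g)
    {X Y : List O} {f g : S.Term K X Y} (h : Rel R f g) : eval φ f = eval φ g := by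
  induction h with
  | of h => exact hφ _ _ h
  | refl f => rfl
  | symm _ ih => exact ih.symm
  | trans _ _ ih₁ ih₂ => exact ih₁.trans ih₂
  | comp _ _ ih₁ ih₂ => simp only [eval, ih₁, ih₂]
  | tensor _ _ ih₁ ih₂ => simp only [eval, ih₁, ih₂]
  | add _ _ ih₁ ih₂ => simp only [eval, ih₁, ih₂]
  | smul a _ ih => simp only [eval, ih]
  | id_comp f => exact Category.id_comp _
  | comp_id f => exact Category.comp_id _
  | comp_assoc f g h => exact Category.assoc _ _ _
  | add_assoc f g h => exact add_assoc _ _ _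
  | add_comm f g => exact add_comm _ _
  | zero_add f => exact zero_add _
  | smul_add a f g => exact smul_add _ _ _
  | add_smul a b f => exact add_smul _ _ _
  | mul_smul a b f => exact mul_smul _ _ _
  | one_smul f => exact one_smul _ _
  | zero_smul f => exact zero_smul _ _
  | add_comp f f' g => exact Preadditive.add_comp _ _ _ _ _ _
  | comp_add f g g' => exact Preadditive.comp_add _ _ _ _ _ _
  | smul_comp a f g => exact Linear.smul_comp _ _ _ _ _ _
  | comp_smul a f g => exact Linear.comp_smul _ _ _ _ _ _
  | add_tensor f f' g => exact MonoidalPreadditive.add_tensor _ _ _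
  | tensor_add f g g' => exact MonoidalPreadditive.tensor_add _ _ _
  | smul_tensor a f g =>
    simp only [eval, MonoidalCategory.tensorHom_def, MonoidalLinear.smul_whiskerRight, Linear.smul_comp]
  | tensor_smul a f g =>
    simp only [eval, MonoidalCategory.tensorHom_def, MonoidalLinear.whiskerLeft_smul, Linear.comp_smul]
  | id_tensor_id X Y => exact Presented.id_tensor_id _ _
  | interchange f g f' g' => exact tensorHom_comp_tensorHom _ _ _ _
  | tensor_assoc f g h =>
    simp only [eval, eval_eqTo]
    exact associator_naturality (eval φ f) (eval φ g) (eval φ h)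
  | unit_tensor f =>
    simp only [eval]
    have := leftUnitor_naturality (eval φ f)
    change _ ≫ 𝟙 _ = 𝟙 _ ≫ _ at this
    rw [Category.comp_id, Category.id_comp] at this
    exact this
  | tensor_unit f =>
    simp only [eval, eval_eqTo]
    exact rightUnitor_naturality (eval φ f)

/-- An assignment of the generators that respects the imposed relations extends to a strict
functor. -/
def lift (hφ : ∀ ⦃X Y : List O⦄ (f g : S.Term K X Y), R f g → eval φ f = eval φ g) :
    StrictFunctor R R' where
  map {X Y} :=
    { toFun := Quot.lift (eval φ) fun _ _ h => eval_rel φ hφ h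
      map_add' := fun f g => by
        induction f using hom_ind; induction g using hom_ind; rfl
      map_smul' := fun a f => by
        induction f using hom_ind; rfl }
  map_id _ := rfl
  map_comp f g := by
    induction f using hom_ind; induction g using hom_ind; rfl
  map_tensor f g := by
    induction f using hom_ind; induction g using hom_ind; rfl

end Eval

theorem eval_gen {X Y : List O} (f : S.Term K X Y) :
    eval (fun g => homMk R (Term.gen g)) f = homMk R f := by
  induction f with
  | gen g => rfl
  | id X => rfl
  | comp f g ihf ihg => rw [eval, ihf, ihg]; rfl
  | tensor f g ihf ihg => rw [eval, ihf, ihg]; rfl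
  | zero X Y => rfl
  | add f g ihf ihg => rw [eval, ihf, ihg]; rfl
  | smul a f ih => rw [eval, ih]; rfl

/-- A strict functor is determined by its values on the generators. -/
theorem StrictFunctor.map_homMk (F : StrictFunctor R R') {X Y : List O} (f : S.Term K X Y) :
    F.map (homMk R f) = eval (fun g => F.map (homMk R (Term.gen g))) f := by
  induction f with
  | gen g => rfl
  | id X => exact F.map_id _
  | comp f g ihf ihg => rw [eval, ← ihf, ← ihg]; exact F.map_comp (homMk R f) (homMk R g)
  | tensor f g ihf ihg => rw [eval, ← ihf, ← ihg]; exact F.map_tensor (homMk R f) (homMk R g)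
  | zero X Y => exact map_zero F.map
  | add f g ihf ihg => rw [eval, ← ihf, ← ihg]; exact map_add F.map (homMk R f) (homMk R g)
  | smul a f ih => rw [eval, ← ih]; exact map_smul F.map a (homMk R f)

namespace StrictFunctor

/-- The composite of two strict functors. -/
def comp (F : StrictFunctor R R') (G : StrictFunctor R' R'') : StrictFunctor R R'' where
  map := G.map ∘ₗ F.map
  map_id X := by
    change G.map (F.map _) = _
    rw [F.map_id, G.map_id]
  map_comp f g := by
    change G.map (F.map _) = G.map (F.map _) ≫ G.map (F.map _)
    rw [F.map_comp, G.map_comp]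
  map_tensor f g := by
    change G.map (F.map _) = G.map (F.map _) ⊗ₘ G.map (F.map _)
    rw [F.map_tensor, G.map_tensor]

theorem map_eq_self (F : StrictFunctor R R)
    (h : ∀ g : S.Gen, F.map (homMk R (Term.gen g)) = homMk R (Term.gen g))
    {X Y : Presented K S R} (f : X ⟶ Y) : F.map f = f := by
  induction f using hom_ind with | h f
  refine (F.map_homMk f).trans (Eq.trans ?_ (eval_gen f))
  rw [funext h]

/-- Mutually inverse strict functors form an isomorphism. -/
def toIso (F : StrictFunctor R R') (G : StrictFunctor R' R)
    (hFG : ∀ g : S.Gen, G.map (F.map (homMk R (Term.gen g))) = homMk R (Term.gen g))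
    (hGF : ∀ g : S'.Gen, F.map (G.map (homMk R' (Term.gen g))) = homMk R' (Term.gen g)) :
    StrictIso R R' where
  map X Y :=
    { F.map (X := ⟨X⟩) (Y := ⟨Y⟩) with
      invFun := G.map (X := ⟨X⟩) (Y := ⟨Y⟩)
      left_inv := fun f => (F.comp G).map_eq_self hFG f
      right_inv := fun f => (G.comp F).map_eq_self hGF f }
  map_id X := F.map_id ⟨X⟩
  map_comp f g := F.map_comp f g
  map_tensor f g := F.map_tensor f g

/-- The image of an object. -/
abbrev obj (_F : StrictFunctor R R') (X : Presented K S R) : Presented K S' R' := ⟨X.word⟩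

variable (F : StrictFunctor R R')

/-- Associators and unitors of a presented category are of the form `eqToHom`, so this is what makes
strict functors preserve them. -/
theorem map_eqToHom {X Y : Presented K S R} (h : X = Y) :
    F.map (eqToHom h) = eqToHom (congrArg F.obj h) := by
  subst h; exact F.map_id X

theorem map_whiskerLeft (X : Presented K S R) {Y Z : Presented K S R} (f : Y ⟶ Z) :
    F.map (X ◁ f) = F.obj X ◁ F.map f := by
  rw [← id_tensorHom, ← id_tensorHom, F.map_tensor, F.map_id]

theorem map_whiskerRight {Y Z : Presented K S R} (f : Y ⟶ Z) (X : Presented K S R) :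
    F.map (f ▷ X) = F.map f ▷ F.obj X := by
  rw [← tensorHom_id, ← tensorHom_id, F.map_tensor, F.map_id]

theorem map_associator_hom (X Y Z : Presented K S R) :
    F.map (α_ X Y Z).hom = (α_ (F.obj X) (F.obj Y) (F.obj Z)).hom :=
  F.map_eqToHom (ext_word (List.append_assoc X.word Y.word Z.word))

theorem map_associator_inv (X Y Z : Presented K S R) :
    F.map (α_ X Y Z).inv = (α_ (F.obj X) (F.obj Y) (F.obj Z)).inv :=
  F.map_eqToHom ((ext_word (List.append_assoc X.word Y.word Z.word)).symm)

theorem map_leftUnitor_hom (X : Presented K S R) :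
    F.map (λ_ X).hom = (λ_ (F.obj X)).hom :=
  F.map_eqToHom (ext_word (List.nil_append X.word))

theorem map_leftUnitor_inv (X : Presented K S R) :
    F.map (λ_ X).inv = (λ_ (F.obj X)).inv :=
  F.map_eqToHom ((ext_word (List.nil_append X.word)).symm)

theorem map_rightUnitor_hom (X : Presented K S R) :
    F.map (ρ_ X).hom = (ρ_ (F.obj X)).hom :=
  F.map_eqToHom (ext_word (List.append_nil X.word))

theorem map_rightUnitor_inv (X : Presented K S R) :
    F.map (ρ_ X).inv = (ρ_ (F.obj X)).inv :=
  F.map_eqToHom ((ext_word (List.append_nil X.word)).symm)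

variable {U V : Presented K S R}

theorem map_rightwardCrossing (c : 𝟙_ _ ⟶ V ⊗ U) (s : U ⊗ U ⟶ U ⊗ U) (d : U ⊗ V ⟶ 𝟙_ _) :
    F.map (rightwardCrossing c s d) = rightwardCrossing (U := F.obj U) (V := F.obj V)
      (F.map c) (F.map s) (F.map d) := by
  simp only [rightwardCrossing, map_comp, map_whiskerLeft, map_whiskerRight, map_associator_hom,
    map_associator_inv, map_leftUnitor_inv, map_rightUnitor_hom]
  rfl

theorem map_leftwardCrossing (c : 𝟙_ _ ⟶ U ⊗ V) (s : U ⊗ U ⟶ U ⊗ U) (d : V ⊗ U ⟶ 𝟙_ _) :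
    F.map (leftwardCrossing c s d) = leftwardCrossing (U := F.obj U) (V := F.obj V)
      (F.map c) (F.map s) (F.map d) := by
  simp only [leftwardCrossing, map_comp, map_whiskerLeft, map_whiskerRight, map_associator_hom,
    map_associator_inv, map_leftUnitor_hom, map_rightUnitor_inv]
  rfl

theorem map_rightCurl (c : 𝟙_ _ ⟶ U ⊗ V) (s : U ⊗ U ⟶ U ⊗ U) (d : U ⊗ V ⟶ 𝟙_ _) :
    F.map (rightCurl c s d) = rightCurl (U := F.obj U) (V := F.obj V)
      (F.map c) (F.map s) (F.map d) := by
  simp only [rightCurl, map_comp, map_whiskerLeft, map_whiskerRight, map_associator_hom,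
    map_associator_inv, map_rightUnitor_hom, map_rightUnitor_inv]

theorem map_leftCurl (c : 𝟙_ _ ⟶ V ⊗ U) (s : U ⊗ U ⟶ U ⊗ U) (d : V ⊗ U ⟶ 𝟙_ _) :
    F.map (leftCurl c s d) = leftCurl (U := F.obj U) (V := F.obj V)
      (F.map c) (F.map s) (F.map d) := by
  simp only [leftCurl, map_comp, map_whiskerLeft, map_whiskerRight, map_associator_hom,
    map_associator_inv, map_leftUnitor_hom, map_leftUnitor_inv]

theorem map_zigzagUp (c : 𝟙_ _ ⟶ V ⊗ U) (d : U ⊗ V ⟶ 𝟙_ _) :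
    F.map (zigzagUp c d) = zigzagUp (U := F.obj U) (V := F.obj V) (F.map c) (F.map d) := by
  simp only [zigzagUp, map_comp, map_whiskerLeft, map_whiskerRight, map_associator_inv,
    map_leftUnitor_hom, map_rightUnitor_inv]

theorem map_zigzagDown (c : 𝟙_ _ ⟶ V ⊗ U) (d : U ⊗ V ⟶ 𝟙_ _) :
    F.map (zigzagDown c d) = zigzagDown (U := F.obj U) (V := F.obj V) (F.map c) (F.map d) := by
  simp only [zigzagDown, map_comp, map_whiskerLeft, map_whiskerRight, map_associator_hom,
    map_leftUnitor_inv, map_rightUnitor_hom]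

theorem map_braidLeft (s : U ⊗ U ⟶ U ⊗ U) :
    F.map (braidLeft s) = braidLeft (U := F.obj U) (F.map s) := by
  simp only [braidLeft, map_comp, map_whiskerLeft, map_whiskerRight, map_associator_hom,
    map_associator_inv]

theorem map_braidRight (s : U ⊗ U ⟶ U ⊗ U) :
    F.map (braidRight s) = braidRight (U := F.obj U) (F.map s) := by
  simp only [braidRight, map_comp, map_whiskerLeft, map_whiskerRight, map_associator_hom,
    map_associator_inv]

/-- The ring homomorphism induced on the endomorphisms of the unit object. -/
def unitEnd : End (𝟙_ (Presented K S R)) →+* End (𝟙_ (Presented K S' R')) where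
  toFun f := F.map f
  map_one' := F.map_id _
  map_mul' f g := F.map_comp g f
  map_zero' := map_zero F.map
  map_add' f g := map_add F.map f g

end StrictFunctor

end Presented

/-! ## Transport of the relations along strict functors -/

section Transport

open MonSig Presented

variable {K : Type u} [CommRing K] {O : Type} {S S' : MonSig O}
  {R : ∀ ⦃X Y : List O⦄, S.Term K X Y → S.Term K X Y → Prop}
  {R' : ∀ ⦃X Y : List O⦄, S'.Term K X Y → S'.Term K X Y → Prop}
  (F : StrictFunctor R R')

namespace RightData

/-- The image of right data under a strict functor. -/
def image (D : RightData (Presented K S R)) : RightData (Presented K S' R') where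
  up := F.obj D.up
  down := F.obj D.down
  x := F.map D.x
  s := F.map D.s
  c := F.map D.c
  d := F.map D.d

variable (D : RightData (Presented K S R))

theorem map_dots (n : ℕ) : F.map (D.dots n) = (D.image F).dots n := by
  induction n with
  | zero => exact F.map_id _
  | succ n ih => rw [dots, F.map_comp, ih]; rfl

theorem map_crossR : F.map D.crossR = (D.image F).crossR := by
  rw [crossR_eq, crossR_eq]
  exact F.map_rightwardCrossing _ _ _

theorem map_cupDots (n : ℕ) : F.map (D.cupDots n) = (D.image F).cupDots n := by
  rw [cupDots, F.map_comp, F.map_whiskerLeft, map_dots]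
  rfl

theorem map_capDots (n : ℕ) : F.map (D.capDots n) = (D.image F).capDots n := by
  rw [capDots, F.map_comp, F.map_whiskerRight, map_dots]
  rfl

variable {D}

/-- Used in both directions: for a quotient functor it shows that the imposed relations hold, and
for a functor out of the free category it shows that an assignment of generators respects them. -/
theorem image_isBasic_iff : (D.image F).IsBasic ↔
    ∀ ⦃X Y : Presented K S R⦄ (f g : X ⟶ Y), D.BasicRel f g → F.map f = F.map g := by
  have h₁ : F.map (D.s ≫ D.s) = F.map (𝟙 _) ↔
      (D.image F).s ≫ (D.image F).s = 𝟙 _ := by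
    rw [F.map_comp, F.map_id]; rfl
  have h₂ : F.map (braidLeft D.s) = F.map (braidRight D.s) ↔
      braidLeft (D.image F).s = braidRight (D.image F).s := by
    rw [F.map_braidLeft, F.map_braidRight]; rfl
  have h₃ : F.map (D.s ≫ D.x ▷ D.up - D.up ◁ D.x ≫ D.s) = F.map (𝟙 _) ↔
      (D.image F).s ≫ (D.image F).x ▷ (D.image F).up -
        (D.image F).up ◁ (D.image F).x ≫ (D.image F).s = 𝟙 _ := by
    rw [map_sub, F.map_comp, F.map_comp, F.map_whiskerLeft, F.map_whiskerRight, F.map_id]; rfl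
  have h₄ : F.map (zigzagUp D.c D.d) = F.map (𝟙 _) ↔
      zigzagUp (D.image F).c (D.image F).d = 𝟙 _ := by
    rw [F.map_zigzagUp, F.map_id]; rfl
  have h₅ : F.map (zigzagDown D.c D.d) = F.map (𝟙 _) ↔
      zigzagDown (D.image F).c (D.image F).d = 𝟙 _ := by
    rw [F.map_zigzagDown, F.map_id]; rfl
  rw [isBasic_iff, ← h₁, ← h₂, ← h₃, ← h₄, ← h₅]
  constructor
  · rintro ⟨h₁, h₂, h₃, h₄, h₅⟩ X Y f g (_ | _ | _ | _ | _)
    · exact h₁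
    · rwa [D.braid_left_eq, D.braid_right_eq]
    · exact h₃
    · rwa [D.adj_up_eq]
    · rwa [D.adj_down_eq]
  · intro h
    refine ⟨h _ _ .square, ?_, h _ _ .dot, ?_, ?_⟩
    · rw [← D.braid_left_eq, ← D.braid_right_eq]
      exact h _ _ .braid
    · rw [← D.adj_up_eq]
      exact h _ _ .adj_up
    · rw [← D.adj_down_eq]
      exact h _ _ .adj_down

/-- Two-sided inverses of a matrix are unique; each entry follows by evaluating the corresponding
entry of (inverse)(matrix)(inverse) in two ways. -/
theorem IsInverse.unique {C : Type u} [Category.{v} C] [Preadditive C] [MonoidalCategory C]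
    {D : RightData C} {k : ℤ} {τ τ' : D.down ⊗ D.up ⟶ D.up ⊗ D.down}
    {e e' : Fin k.toNat → (𝟙_ C ⟶ D.up ⊗ D.down)}
    {f f' : Fin (-k).toNat → (D.down ⊗ D.up ⟶ 𝟙_ C)} (h : D.IsInverse k τ e f)
    (h' : D.IsInverse k τ' e' f') : τ = τ' ∧ e = e' ∧ f = f' := by
  refine ⟨?_, funext fun i => ?_, funext fun i => ?_⟩
  · have h₁ := congrArg (τ ≫ ·) (h' _ _ .up_down)
    have h₂ := congrArg (· ≫ τ') (h _ _ .down_up)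
    simp only [Preadditive.comp_add, Preadditive.comp_sum, Preadditive.add_comp,
      Preadditive.sum_comp, Category.assoc, Category.comp_id, Category.id_comp] at h₁ h₂
    have h₃ (i : Fin k.toNat) : τ ≫ D.capDots i ≫ e' i = 0 := by
      rw [← Category.assoc, h _ _ (.tInv_cap i), Limits.zero_comp]
    have h₄ (i : Fin (-k).toNat) : f i ≫ D.cupDots i ≫ τ' = 0 := by
      rw [h' _ _ (.cup_tInv i), Limits.comp_zero]
    simp only [h₃, h₄, Finset.sum_const_zero, add_zero] at h₁ h₂
    exact h₁.symm.trans h₂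
  · have h₁ := congrArg (e i ≫ ·) (h' _ _ .up_down)
    simp only [Preadditive.comp_add, Preadditive.comp_sum, Category.comp_id] at h₁
    have h₂ (j : Fin k.toNat) : e i ≫ D.capDots j ≫ e' j = if j = i then e' j else 0 := by
      rw [← Category.assoc, h _ _ (.cInv_cap j i)]
      split_ifs
      · exact Category.id_comp _
      · exact Limits.zero_comp
    rw [← Category.assoc, h _ _ (.cInv_cross i), Limits.zero_comp, zero_add] at h₁
    simp only [h₂, Finset.sum_ite_eq', Finset.mem_univ, if_true] at h₁
    exact h₁.symm
  · have h₁ := congrArg (· ≫ f' i) (h _ _ .down_up)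
    simp only [Preadditive.add_comp, Preadditive.sum_comp, Category.assoc,
      Category.id_comp] at h₁
    have h₂ (j : Fin (-k).toNat) : f j ≫ D.cupDots j ≫ f' i = if i = j then f j else 0 := by
      rw [h' _ _ (.cup_dInv i j)]
      split_ifs
      · exact Category.comp_id _
      · exact Limits.comp_zero
    rw [h' _ _ (.cross_dInv i), Limits.comp_zero, zero_add] at h₁
    simp only [h₂, Finset.sum_ite_eq, Finset.mem_univ, if_true] at h₁
    exact h₁

theorem image_isInverse_iff {k : ℤ} {τ : D.down ⊗ D.up ⟶ D.up ⊗ D.down}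
    {e : Fin k.toNat → (𝟙_ _ ⟶ D.up ⊗ D.down)}
    {f : Fin (-k).toNat → (D.down ⊗ D.up ⟶ 𝟙_ _)} :
    (D.image F).IsInverse k (F.map τ) (fun i => F.map (e i)) (fun i => F.map (f i)) ↔
    ∀ ⦃X Y : Presented K S R⦄ (p q : X ⟶ Y), D.InversionRel k τ e f p q → F.map p = F.map q := by
  have hδ {n : ℕ} (i j : Fin n) : F.map (if i = j then 𝟙 (𝟙_ _) else 0) =
      if i = j then 𝟙 (𝟙_ _) else 0 := by
    split_ifs
    · exact F.map_id _
    · exact map_zero F.map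
  constructor
  · rintro h X Y p q (_ | _ | i | i | ⟨i, j⟩ | i | j | ⟨i, j⟩)
    · simp only [map_add, map_sum, F.map_comp, map_crossR, map_capDots, F.map_id]
      exact h _ _ .up_down
    · simp only [map_add, map_sum, F.map_comp, map_crossR, map_cupDots, F.map_id]
      exact h _ _ .down_up
    · simp only [F.map_comp, map_crossR, map_zero]
      exact h _ _ (.cInv_cross i)
    · simp only [F.map_comp, map_capDots, map_zero]
      exact h _ _ (.tInv_cap i)
    · rw [F.map_comp, map_capDots, hδ]
      exact h _ _ (.cInv_cap i j)
    · simp only [F.map_comp, map_crossR, map_zero]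
      exact h _ _ (.cross_dInv i)
    · simp only [F.map_comp, map_cupDots, map_zero]
      exact h _ _ (.cup_tInv j)
    · rw [F.map_comp, map_cupDots, hδ]
      exact h _ _ (.cup_dInv i j)
  · rintro h X Y p q (_ | _ | i | i | ⟨i, j⟩ | i | j | ⟨i, j⟩)
    · have := h _ _ .up_down
      simp only [map_add, map_sum, F.map_comp, map_crossR, map_capDots, F.map_id] at this
      exact this
    · have := h _ _ .down_up
      simp only [map_add, map_sum, F.map_comp, map_crossR, map_cupDots, F.map_id] at this
      exact this
    · have := h _ _ (.cInv_cross i)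
      simp only [F.map_comp, map_crossR, map_zero] at this
      exact this
    · have := h _ _ (.tInv_cap i)
      simp only [F.map_comp, map_capDots, map_zero] at this
      exact this
    · have := h _ _ (.cInv_cap i j)
      rw [F.map_comp, map_capDots, hδ] at this
      exact this
    · have := h _ _ (.cross_dInv i)
      simp only [F.map_comp, map_crossR, map_zero] at this
      exact this
    · have := h _ _ (.cup_tInv j)
      simp only [F.map_comp, map_cupDots, map_zero] at this
      exact this
    · have := h _ _ (.cup_dInv i j)
      rw [F.map_comp, map_cupDots, hδ] at this
      exact this

end RightData

namespace FullData

/-- The image of full data under a strict functor. -/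
def image (E : FullData (Presented K S R)) : FullData (Presented K S' R') where
  __ := E.toRightData.image F
  cupL := F.map E.cupL
  capL := F.map E.capL

variable (E : FullData (Presented K S R))

theorem map_crossL : F.map E.crossL = (E.image F).crossL := by
  rw [crossL_eq, crossL_eq]
  exact F.map_leftwardCrossing _ _ _

theorem map_curlR : F.map E.curlR = (E.image F).curlR := by
  rw [curlR_eq, curlR_eq]
  exact F.map_rightCurl _ _ _

theorem map_curlL : F.map E.curlL = (E.image F).curlL := by
  rw [curlL_eq, curlL_eq]
  exact F.map_leftCurl _ _ _

theorem map_cupLDots (n : ℕ) : F.map (E.cupLDots n) = (E.image F).cupLDots n := by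
  rw [cupLDots, F.map_comp, F.map_whiskerRight, E.toRightData.map_dots]
  rfl

theorem map_capLDots (n : ℕ) : F.map (E.capLDots n) = (E.image F).capLDots n := by
  rw [capLDots, F.map_comp, F.map_whiskerLeft, E.toRightData.map_dots]
  rfl

theorem map_clockNat (n : ℕ) : F.unitEnd (E.clockNat n) = (E.image F).clockNat n := by
  change F.map (E.cupL ≫ E.dots n ▷ E.down ≫ E.d) = _
  rw [F.map_comp, F.map_comp, F.map_whiskerRight, E.toRightData.map_dots]
  rfl

theorem map_antiNat (n : ℕ) : F.unitEnd (E.antiNat n) = (E.image F).antiNat n := by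
  change F.map (E.c ≫ E.down ◁ E.dots n ≫ E.capL) = _
  rw [F.map_comp, F.map_comp, F.map_whiskerLeft, E.toRightData.map_dots]
  rfl

/-- The functor induces a ring homomorphism on endomorphisms of the unit object, and ring
homomorphisms commute with determinants. -/
theorem map_clock (k n : ℤ) : F.unitEnd (E.clock k n) = (E.image F).clock k n := by
  rw [clock, clock]
  split_ifs
  · exact E.map_clockNat F _
  · exact map_zero _
  · rw [map_neg, RingHom.map_det]
    refine congrArg (fun M => -Matrix.det M) (Matrix.ext fun i j => ?_)
    exact (map_neg _ _).trans (congrArg _ (E.map_antiNat F _))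

theorem map_anti (k n : ℤ) : F.unitEnd (E.anti k n) = (E.image F).anti k n := by
  rw [anti, anti]
  split_ifs
  · exact E.map_antiNat F _
  · exact map_zero _
  · rw [RingHom.map_det]
    exact congrArg Matrix.det (Matrix.ext fun i j => E.map_clockNat F _)

variable {E}

theorem image_isLeft_iff {k : ℤ} : (E.image F).IsLeft k ↔
    ∀ ⦃X Y : Presented K S R⦄ (f g : X ⟶ Y), E.LeftRel k f g → F.map f = F.map g := by
  have hR : F.map E.crossR = (E.image F).crossR := E.toRightData.map_crossR F
  have hcap (n : ℕ) : F.map (E.capDots n) = (E.image F).capDots n := E.toRightData.map_capDots F n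
  have hcup (n : ℕ) : F.map (E.cupDots n) = (E.image F).cupDots n := E.toRightData.map_cupDots F n
  have hc (n : ℤ) : F.map (E.clock k n : 𝟙_ _ ⟶ 𝟙_ _) = (E.image F).clock k n := E.map_clock F k n
  have ha (n : ℤ) : F.map (E.anti k n : 𝟙_ _ ⟶ 𝟙_ _) = (E.image F).anti k n := E.map_anti F k n
  have hδ {X : Presented K S R} (p : Prop) [Decidable p] : F.map (if p then 𝟙 X else 0) =
      if p then 𝟙 _ else 0 := by
    split_ifs
    · exact F.map_id _
    · exact map_zero F.map
  have hpos : F.map (E.crossR ≫ E.crossL) = F.map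
      (𝟙 (E.up ⊗ E.down) + ∑ r ∈ Finset.range k.toNat, ∑ s ∈ Finset.range k.toNat,
        bubbleRight (E.capDots s ≫ E.cupLDots r) (E.anti k (-(r : ℤ) - (s : ℤ) - 2))) ↔
      (E.image F).crossR ≫ (E.image F).crossL = 𝟙 ((E.image F).up ⊗ (E.image F).down) +
        ∑ r ∈ Finset.range k.toNat, ∑ s ∈ Finset.range k.toNat, (E.image F).capDots s ≫
          ((E.image F).anti k (-(r : ℤ) - (s : ℤ) - 2) : 𝟙_ _ ⟶ 𝟙_ _) ≫
            (E.image F).cupLDots r := by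
    simp only [bubbleRight_eq, F.map_comp, map_add, map_sum, F.map_id, map_crossL,
      map_cupLDots, hR, hcap, ha]
    exact Iff.rfl
  have hneg : F.map (E.crossL ≫ E.crossR) = F.map
      (𝟙 (E.down ⊗ E.up) + ∑ r ∈ Finset.range (-k).toNat, ∑ s ∈ Finset.range (-k).toNat,
        bubbleLeft (E.clock k (-(r : ℤ) - (s : ℤ) - 2)) (E.capLDots r ≫ E.cupDots s)) ↔
      (E.image F).crossL ≫ (E.image F).crossR = 𝟙 ((E.image F).down ⊗ (E.image F).up) +
        ∑ r ∈ Finset.range (-k).toNat, ∑ s ∈ Finset.range (-k).toNat, (E.image F).capLDots r ≫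
          ((E.image F).clock k (-(r : ℤ) - (s : ℤ) - 2) : 𝟙_ _ ⟶ 𝟙_ _) ≫
            (E.image F).cupDots s := by
    simp only [bubbleLeft_eq, F.map_comp, map_add, map_sum, F.map_id, map_crossL,
      map_capLDots, hR, hcup, hc]
    exact Iff.rfl
  have hcr (r : ℕ) : F.map (E.clock k r : 𝟙_ _ ⟶ 𝟙_ _) =
      F.map (-(if (r : ℤ) = k - 1 then 𝟙 (𝟙_ _) else 0)) ↔
      ((E.image F).clock k r : 𝟙_ (Presented K S' R') ⟶ 𝟙_ _) =
        -(if (r : ℤ) = k - 1 then 𝟙 (𝟙_ _) else 0) := by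
    rw [hc, map_neg, hδ]
    exact Iff.rfl
  have har (r : ℕ) : F.map (E.anti k r : 𝟙_ _ ⟶ 𝟙_ _) =
      F.map (if (r : ℤ) = -k - 1 then 𝟙 (𝟙_ _) else 0) ↔
      ((E.image F).anti k r : 𝟙_ (Presented K S' R') ⟶ 𝟙_ _) =
        if (r : ℤ) = -k - 1 then 𝟙 (𝟙_ _) else 0 := by
    rw [ha, hδ]
    exact Iff.rfl
  rw [isLeft_iff]
  constructor
  · rintro ⟨h₁, h₂, h₃, h₄, h₅, h₆⟩ X Y f g (_ | _ | hk | ⟨r, hr⟩ | hk | ⟨r, hr⟩)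
    · exact hpos.2 h₁
    · exact hneg.2 h₂
    · rw [map_curlR, hδ]
      exact h₃ hk
    · exact (hcr r).2 (h₅ r hr)
    · rw [map_curlL, hδ]
      exact h₄ hk
    · exact (har r).2 (h₆ r hr)
  · intro h
    refine ⟨hpos.1 (h _ _ .pos), hneg.1 (h _ _ .neg), fun hk => ?_, fun hk => ?_,
      fun r hr => (hcr r).1 (h _ _ (.clock r hr)), fun r hr => (har r).1 (h _ _ (.anti r hr))⟩
    · have := h _ _ (.curlR hk)
      rw [map_curlR, hδ] at this
      exact this
    · have := h _ _ (.curlL hk)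
      rw [map_curlL, hδ] at this
      exact this

end FullData

end Transport

/-! ## The two presentations of the Heisenberg category -/

section Simplified

variable {C : Type u} [Category.{v} C] [MonoidalCategory C] [Preadditive C]

theorem FullData.IsLeft.crossR_comp_crossL {E : FullData C} {k : ℤ} (h : E.IsLeft k) (hk : k ≤ 1) :
    E.crossR ≫ E.crossL = 𝟙 (E.up ⊗ E.down) + if k = 1 then E.d ≫ E.cupL else 0 := by
  rw [(isLeft_iff.1 h).1]
  congr 1
  split_ifs with h₁
  · subst h₁
    -- Only `r = s = 0` occurs, and the bubble with `-2` dots is the determinant of an empty matrix.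
    change ∑ r ∈ Finset.range 1, ∑ s ∈ Finset.range 1, _ = _
    rw [Finset.sum_range_one, Finset.sum_range_one,
      E.anti_of_neg (k := 1) (r := 0) (by norm_num) (by norm_num), Matrix.det_fin_zero]
    change E.capDots 0 ≫ 𝟙 _ ≫ E.cupLDots 0 = _
    simp [RightData.capDots, RightData.dots, FullData.cupLDots]
  · rw [show k.toNat = 0 by omega, Finset.sum_range_zero]

theorem FullData.IsLeft.crossL_comp_crossR {E : FullData C} {k : ℤ} (h : E.IsLeft k) (hk : -1 ≤ k) :
    E.crossL ≫ E.crossR = 𝟙 (E.down ⊗ E.up) - if k = -1 then E.capL ≫ E.c else 0 := by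
  rw [(isLeft_iff.1 h).2.1, sub_eq_add_neg]
  congr 1
  split_ifs with h₁
  · subst h₁
    change ∑ r ∈ Finset.range 1, ∑ s ∈ Finset.range 1, _ = _
    rw [Finset.sum_range_one, Finset.sum_range_one,
      E.clock_of_neg (k := -1) (r := 0) (by norm_num) (by norm_num), Matrix.det_fin_zero]
    change E.capLDots 0 ≫ (-𝟙 (𝟙_ C)) ≫ E.cupDots 0 = _
    simp [RightData.cupDots, RightData.dots, FullData.capLDots]
  · rw [show (-k).toNat = 0 by omega, Finset.sum_range_zero, neg_zero]

end Simplified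

namespace Heis

open MonSig Presented

variable {K : Type u} [CommRing K]

theorem eval_noRel {S S' : MonSig Arrow}
    {R' : ∀ ⦃X Y : List Arrow⦄, S'.Term K X Y → S'.Term K X Y → Prop}
    (φ : ∀ g : S.Gen, (⟨S.src g⟩ : Presented K S' R') ⟶ ⟨S.tgt g⟩) ⦃X Y : List Arrow⦄
    (f g : S.Term K X Y) (h : noRel f g) : eval φ f = eval φ g := h.elim

/-- The quotient functor from the free category. -/
def quotient {S : MonSig Arrow} (R : ∀ ⦃X Y : List Arrow⦄, S.Term K X Y → S.Term K X Y → Prop) :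
    StrictFunctor (noRel (K := K) (S := S)) R :=
  lift (fun g => homMk R (Term.gen g)) (eval_noRel _)

theorem quotient_homMk {S : MonSig Arrow}
    {R : ∀ ⦃X Y : List Arrow⦄, S.Term K X Y → S.Term K X Y → Prop} {X Y : List Arrow}
    (f : S.Term K X Y) : (quotient R).map (homMk noRel f) = homMk R f := eval_gen f

/-- The value on generators of the functor from the first presentation given by right data and the
entries of an inverse. -/
def genMap {S : MonSig Arrow} {R : ∀ ⦃X Y : List Arrow⦄, S.Term K X Y → S.Term K X Y → Prop}
    {k : ℤ} (x : (⟨[.up]⟩ : Presented K S R) ⟶ ⟨[.up]⟩)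
    (s : (⟨[.up, .up]⟩ : Presented K S R) ⟶ ⟨[.up, .up]⟩)
    (c : (⟨[]⟩ : Presented K S R) ⟶ ⟨[.down, .up]⟩) (d : (⟨[.up, .down]⟩ : Presented K S R) ⟶ ⟨[]⟩)
    (τ : (⟨[.down, .up]⟩ : Presented K S R) ⟶ ⟨[.up, .down]⟩)
    (e : Fin k.toNat → ((⟨[]⟩ : Presented K S R) ⟶ ⟨[.up, .down]⟩))
    (f : Fin (-k).toNat → ((⟨[.down, .up]⟩ : Presented K S R) ⟶ ⟨[]⟩)) :
    ∀ g : (sig k).Gen, (⟨(sig k).src g⟩ : Presented K S R) ⟶ ⟨(sig k).tgt g⟩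
  | .x => x
  | .s => s
  | .c => c
  | .d => d
  | .tInv => τ
  | .cInv i => e i
  | .dInv i => f i

/-- The value on generators of the functor from the second presentation given by full data. -/
def altGenMap {S : MonSig Arrow} {R : ∀ ⦃X Y : List Arrow⦄, S.Term K X Y → S.Term K X Y → Prop}
    (x : (⟨[.up]⟩ : Presented K S R) ⟶ ⟨[.up]⟩)
    (s : (⟨[.up, .up]⟩ : Presented K S R) ⟶ ⟨[.up, .up]⟩)
    (c : (⟨[]⟩ : Presented K S R) ⟶ ⟨[.down, .up]⟩) (d : (⟨[.up, .down]⟩ : Presented K S R) ⟶ ⟨[]⟩)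
    (c' : (⟨[]⟩ : Presented K S R) ⟶ ⟨[.up, .down]⟩)
    (d' : (⟨[.down, .up]⟩ : Presented K S R) ⟶ ⟨[]⟩) :
    ∀ g : altSig.Gen, (⟨altSig.src g⟩ : Presented K S R) ⟶ ⟨altSig.tgt g⟩
  | .x => x
  | .s => s
  | .c => c
  | .d => d
  | .c' => c'
  | .d' => d'

variable (K) (k : ℤ)

/-- The relations are stated between morphisms of the free category. The quotient functor carries
the free generators to those of `heisData` by definition and identifies both sides of each relation.
-/
theorem heisData_isBasic : (heisData K k).IsBasic :=
  (RightData.image_isBasic_iff (quotient (rel K k)) (D := rightData noRel)).2 fun X Y f g h => by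
    induction f using hom_ind with | h f
    induction g using hom_ind with | h g
    rw [quotient_homMk, quotient_homMk]
    exact Quot.sound (Rel.of (Or.inl h))

theorem heisData_isInverse : (heisData K k).IsInverse k
    (homMk _ (Term.gen (S := sig k) Gen.tInv))
    (fun i => homMk _ (Term.gen (S := sig k) (Gen.cInv i)))
    (fun i => homMk _ (Term.gen (S := sig k) (Gen.dInv i))) :=
  (RightData.image_isInverse_iff (quotient (rel K k)) (D := rightData noRel)
    (τ := homMk _ (Term.gen (S := sig k) Gen.tInv))
    (e := fun i => homMk _ (Term.gen (S := sig k) (Gen.cInv i)))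
    (f := fun i => homMk _ (Term.gen (S := sig k) (Gen.dInv i)))).2
    fun X Y f g h => by
      induction f using hom_ind with | h f
      induction g using hom_ind with | h g
      rw [quotient_homMk, quotient_homMk]
      exact Quot.sound (Rel.of (Or.inr h))

theorem altData_isBasic : (altData K k).IsBasic :=
  (RightData.image_isBasic_iff (quotient (altRel K k)) (D := (fullData noRel).toRightData)).2
    fun X Y f g h => by
      induction f using hom_ind with | h f
      induction g using hom_ind with | h g
      rw [quotient_homMk, quotient_homMk]
      exact Quot.sound (Rel.of (Or.inl h))

theorem altData_isLeft : (altData K k).IsLeft k :=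
  (FullData.image_isLeft_iff (quotient (altRel K k)) (E := fullData noRel)).2
    fun X Y f g h => by
      induction f using hom_ind with | h f
      induction g using hom_ind with | h g
      rw [quotient_homMk, quotient_homMk]
      exact Quot.sound (Rel.of (Or.inr h))

variable {K} {k}

/-- The functor from the second presentation to the first given by a left pair. -/
def fromAlt {c' : 𝟙_ (HeisCat K k) ⟶ (heisData K k).up ⊗ (heisData K k).down}
    {d' : (heisData K k).down ⊗ (heisData K k).up ⟶ 𝟙_ (HeisCat K k)}
    (h : ((heisData K k).withLeft c' d').IsLeft k) : StrictFunctor (altRel K k) (rel K k) :=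
  let φ := altGenMap (heisData K k).x (heisData K k).s (heisData K k).c (heisData K k).d c' d'
  -- The lift to the free category evaluates formal expressions, so the image criteria for it say
  -- precisely that `φ` respects the relations.
  lift φ fun _ _ _ _ hpq => hpq.elim
    ((RightData.image_isBasic_iff (lift φ (eval_noRel φ))
      (D := (fullData noRel).toRightData)).1 (heisData_isBasic K k) _ _)
    ((FullData.image_isLeft_iff (lift φ (eval_noRel φ)) (E := fullData noRel)).1 h _ _)

/-- The functor from the first presentation to the second given by an inverse. -/
def toAlt {τ : (altData K k).down ⊗ (altData K k).up ⟶ (altData K k).up ⊗ (altData K k).down}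
    {e : Fin k.toNat → (𝟙_ (AltHeisCat K k) ⟶ (altData K k).up ⊗ (altData K k).down)}
    {f : Fin (-k).toNat → ((altData K k).down ⊗ (altData K k).up ⟶ 𝟙_ (AltHeisCat K k))}
    (h : (altData K k).IsInverse k τ e f) : StrictFunctor (rel K k) (altRel K k) :=
  let φ := genMap (altData K k).x (altData K k).s (altData K k).c (altData K k).d τ e f
  lift φ fun _ _ _ _ hpq => hpq.elim
    ((RightData.image_isBasic_iff (lift φ (eval_noRel φ)) (D := rightData noRel)).1
      (altData_isBasic K k) _ _)
    ((RightData.image_isInverse_iff (lift φ (eval_noRel φ)) (D := rightData noRel)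
      (τ := homMk _ (Term.gen (S := sig k) Gen.tInv))
      (e := fun i => homMk _ (Term.gen (S := sig k) (Gen.cInv i)))
      (f := fun i => homMk _ (Term.gen (S := sig k) (Gen.dInv i)))).1 h _ _)

end Heis

theorem theorem1 (K : Type u) [CommRing K] (k : ℤ) :
    ∃ (c' : 𝟙_ (HeisCat K k) ⟶ (heisData K k).up ⊗ (heisData K k).down)
      (d' : (heisData K k).down ⊗ (heisData K k).up ⟶ 𝟙_ (HeisCat K k)),
      -- the relations hold, and the pair is unique
      (heisData K k).IsLeftPair k c' d' ∧
      (∀ c₁ d₁, (heisData K k).IsLeftPair k c₁ d₁ → c₁ = c' ∧ d₁ = d') ∧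
      -- the simplified forms of the first two relations for `k ≤ 1`, respectively `-1 ≤ k`
      (k ≤ 1 → ((heisData K k).withLeft c' d').crossR ≫ ((heisData K k).withLeft c' d').crossL =
        𝟙 ((heisData K k).up ⊗ (heisData K k).down) +
          if k = 1 then (heisData K k).d ≫ c' else 0) ∧
      (-1 ≤ k → ((heisData K k).withLeft c' d').crossL ≫ ((heisData K k).withLeft c' d').crossR =
        𝟙 ((heisData K k).down ⊗ (heisData K k).up) -
          if k = -1 then d' ≫ (heisData K k).c else 0) ∧
      -- the second presentation, with matching generators
      ∃ A : Presented.StrictIso (Heis.altRel K k) (Heis.rel K k),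
        A.map [.up] [.up] (altData K k).x = (heisData K k).x ∧
        A.map [.up, .up] [.up, .up] (altData K k).s = (heisData K k).s ∧
        A.map [] [.down, .up] (altData K k).c = (heisData K k).c ∧
        A.map [.up, .down] [] (altData K k).d = (heisData K k).d ∧
        A.map [] [.up, .down] (altData K k).cupL = c' ∧
        A.map [.down, .up] [] (altData K k).capL = d' := by
  have hD := Heis.heisData_isBasic K k
  have hI := Heis.heisData_isInverse K k
  obtain ⟨c', d', hL⟩ := hI.exists_leftPair hD
  obtain ⟨τ, e, f, hA⟩ := (Heis.altData_isLeft K k).exists_isInverse (Heis.altData_isBasic K k)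
  -- The image under `fromAlt` of the inverse found in the second category inverts the same matrix
  -- as the generators `tInv`, `cInv`, `dInv`, hence equals them. Likewise the image of `c'`, `d'`
  -- under `toAlt` is a left pair, hence the generating one. These are the only generators on which
  -- the composites of the two functors are not visibly the identity.
  have hF := (RightData.image_isInverse_iff (Heis.fromAlt hL)
    (D := (altData K k).toRightData)).2 fun _ _ p q h => congrArg _ (hA p q h)
  obtain ⟨hτ, he, hf⟩ := RightData.IsInverse.unique hF hI
  have hG := (FullData.image_isLeft_iff (Heis.toAlt hA) (E := (heisData K k).withLeft c' d')).2
    fun _ _ p q h => congrArg _ (hL p q h)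
  obtain ⟨hc, hd⟩ := hA.leftPair_unique (Heis.altData_isBasic K k) hG (Heis.altData_isLeft K k)
  refine ⟨c', d', hL, fun c₁ d₁ h => hI.leftPair_unique hD h hL, hL.crossR_comp_crossL,
    hL.crossL_comp_crossR, (Heis.fromAlt hL).toIso (Heis.toAlt hA) ?_ ?_, rfl, rfl, rfl, rfl, rfl,
    rfl⟩
  · rintro (_ | _ | _ | _ | _ | _)
    · rfl
    · rfl
    · rfl
    · rfl
    · exact hc
    · exact hd
  · rintro (_ | _ | _ | _ | _ | i | i)
    · rfl
    · rfl
    · rfl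
    · rfl
    · exact hτ
    · exact congrFun he i
    · exact congrFun hf i
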